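/- For $\sigma\in\mathbb R$ let $\Lambda^{\sigma}=(1-\partial_x^2)^{\sigma/2}$ and $\|f\|_{H^\sigma}=\|\Lambda^\sigma f\|_{L^2(\mathbb R)}$. Consider, for real-valued $u,\eta$, the Cauchy problem of the two-component Fornberg–Whitham system $$u_t+uu_x=\partial_x\Lambda^{-2}(\eta-u),\qquad \eta_t+(\eta u)_x=0,\qquad u(0)=u_0,\quad \eta(0)=\eta_0\qquad (x\in\mathbb R).\tag{FW}$$ By a solution on $[0,T]$ we mean a pair $(u,\eta)\in C([0,T];H^s\times H^{s-1})$ that satisfies the equations in the sense of distributions in $x$ at every $t\in[0,T]$. For $m>0$ put $Q_m=\{(u,\eta)\in H^s(\mathbb R)\times H^{s-1}(\mathbb R):\|u\|_{H^s}+\|\eta\|_{H^{s-1}}\le m\}$. **Theorem 3.4.** Let $s>\frac32$. There is a constant $c>0$ depending only on $s$ such that for all $m>0$ and all $\widetilde T$ with $0<\widetilde T\le \frac1{2c}\ln\left(1+\frac1m\right)$ the following holds. For every $(u_0,\eta_0)\in Q_m$ the problem (FW) has a unique solution $(u,\eta)\in C([0,\widetilde T];H^s\times H^{s-1})$. For every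 $r$ with $s-1\le r<s$, the solution map $(u_0,\eta_0)\mapsto(u,\eta)$ is Hölder continuous with exponent $\beta=s-r$ from $Q_m$, equipped with the $H^r\times H^{r-1}$ norm, to $C([0,\widetilde T];H^r\times H^{r-1})$: there is a constant $C$ depending only on $s,r,\widetilde T,m$ such that $$\sup_{0\le t\le\widetilde T}\left(\|u(t)-v(t)\|_{H^r}+\|\eta(t)-\theta(t)\|_{H^{r-1}}\right)\le C\left(\|u_0-v_0\|_{H^r}+\|\eta_0-\theta_0\|_{H^{r-1}}\right)^{s-r}$$ for all solutions $(u,\eta)$ and $(v,\theta)$ of (FW) on $[0,\widetilde T]$ with initial data $(u_0,\eta_0)$ and $(v_0,\theta_0)$ in $Q_m$. -/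

import Mathlib

open MeasureTheory Set Filter Topology
open scoped ENNReal NNReal FourierTransform SchwartzMap

namespace FornbergWhitham

noncomputable section

/-- The real space `L²(ℝ)`. All functions of `x` below live in it: for `s > 3/2` both `H^s(ℝ)` and
`H^{s-1}(ℝ)` are contained in `L²(ℝ)`. -/
abbrev L2 : Type := Lp ℝ 2 (volume : Measure ℝ)

/-- A real `L²` function regarded as a complex-valued one. -/
def toComplex (f : L2) : Lp ℂ 2 (volume : Measure ℝ) :=
  Complex.ofRealCLM.compLp f

/-- The Sobolev norm `‖f‖_{H^σ} = (∫ (1 + |ζ|²)^σ |f̂(ζ)|²)^{1/2}`, `σ ∈ ℝ`, with value `∞` if `f` is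
not in `H^σ(ℝ)`. Mathlib's Fourier transform is `𝓕 f (ξ) = ∫ e^{-2πixξ} f(x) dx`, so the frequency
is `ζ = 2πξ`, and the norm is `‖(1 - ∂ₓ²)^{σ/2} f‖_{L²}`. -/
def sobolevNorm (σ : ℝ) (f : L2) : ℝ≥0∞ :=
  eLpNorm (fun ξ : ℝ ↦
    ((1 + (2 * Real.pi * ξ) ^ 2) ^ (σ / 2) : ℝ) • (𝓕 (toComplex f) : Lp ℂ 2 (volume : Measure ℝ)) ξ)
    2 volume

/-- The norm `‖u‖_{H^σ} + ‖η‖_{H^{σ-1}}` of `H^σ(ℝ) × H^{σ-1}(ℝ)`. -/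
def pairNorm (σ : ℝ) (u η : L2) : ℝ≥0∞ :=
  sobolevNorm σ u + sobolevNorm (σ - 1) η

/-- The tempered distribution defined by a real `L²` function. -/
def toDist (f : L2) : 𝓢'(ℝ, ℂ) :=
  ((toComplex f : Lp ℂ 2 (volume : Measure ℝ)) : 𝓢'(ℝ, ℂ))

/-- The tempered distribution defined by the pointwise product `f g ∈ L¹(ℝ)` of two real `L²`
functions. -/
def prodDist (f g : L2) : 𝓢'(ℝ, ℂ) :=
  ((toComplex f • toComplex g : Lp ℂ 1 (volume : Measure ℝ)) : 𝓢'(ℝ, ℂ))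

/-- The distributional derivative `∂ₓ`. -/
def dx : 𝓢'(ℝ, ℂ) →L[ℂ] 𝓢'(ℝ, ℂ) :=
  TemperedDistribution.derivCLM ℂ

/-- The operator `Λ^σ = (1 - ∂ₓ²)^{σ/2}` on tempered distributions, that is, the Fourier multiplier
with symbol `(1 + |ζ|²)^{σ/2}`, where `ζ = 2πξ`. -/
def Lam (σ : ℝ) : 𝓢'(ℝ, ℂ) →L[ℂ] 𝓢'(ℝ, ℂ) :=
  TemperedDistribution.fourierMultiplierCLM ℂ
    (fun ξ : ℝ ↦ (((1 + (2 * Real.pi * ξ) ^ 2) ^ (σ / 2) : ℝ) : ℂ))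

/-- `(u, η) ∈ C([0, T]; H^s × H^{s-1})` solves
`u_t + u u_x = ∂ₓ Λ^{-2}(η - u)`, `η_t + (η u)_x = 0`, `u(0) = u₀`, `η(0) = η₀`.
The equations hold in the sense of distributions in `x`, at every time `t ∈ [0, T]`
(one-sided time derivatives at the end points), with `u u_x = (u²/2)_x`. -/
structure IsSolution (s T : ℝ) (u₀ η₀ : L2) (u η : ℝ → L2) : Prop where
  finite : ∀ t ∈ Icc 0 T, pairNorm s (u t) (η t) < ∞
  continuous : ∀ t ∈ Icc 0 T,
    Tendsto (fun τ ↦ pairNorm s (u τ - u t) (η τ - η t)) (𝓝[Icc 0 T] t) (𝓝 0)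
  eq_u : ∀ t ∈ Icc 0 T, ∀ φ : 𝓢(ℝ, ℂ),
    HasDerivWithinAt (fun τ ↦ toDist (u τ) φ)
      ((-dx ((1 / 2 : ℂ) • prodDist (u t) (u t)) + dx (Lam (-2) (toDist (η t) - toDist (u t)))) φ)
      (Icc 0 T) t
  eq_η : ∀ t ∈ Icc 0 T, ∀ φ : 𝓢(ℝ, ℂ),
    HasDerivWithinAt (fun τ ↦ toDist (η τ) φ) ((-dx (prodDist (η t) (u t))) φ) (Icc 0 T) t
  init_u : u 0 = u₀
  init_η : η 0 = η₀

/-- The set `Q_m = {(u, η) ∈ H^s × H^{s-1} : ‖u‖_{H^s} + ‖η‖_{H^{s-1}} ≤ m}`. -/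
def Q (s m : ℝ) : Set (L2 × L2) :=
  {d | pairNorm s d.1 d.2 ≤ ENNReal.ofReal m}

end

end FornbergWhitham

/-! The problem is moved to the frequency side. Let k be the frequency, J = (1 + k²)^{1/2}, a = J^s
û and b = J^{s-1} η̂. Then a and b lie in the complex L² space `H`, and real functions correspond to
Hermitian transforms. The system reads d/dt (J⁻¹ a) = `fieldU`, d/dt (J⁻¹ b) = `fieldEta`. Both
fields are continuous on H × H because H^s and H^{s-1} are algebras (s - 1 > 1/2); the J⁻¹ records
the one derivative that transport loses.

The lost derivative is recovered by energy estimates. Pairing a transport term with the transported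
function y gives the imaginary part of ∫∫ k V²(ξ) f(ξ-ζ) y(ζ) conj y(ξ). Since f is Hermitian, the
two frequencies can be exchanged, and only the difference of k V² at ξ and at ζ survives
(`enorm_im_integral_conv_le`). `exists_commutator_bound` estimates this difference by products in
which one of the three functions can be placed in L¹ at the cost of s - 1 > 1/2 derivatives; the
outcome is `exists_transport_estimate`. The weight V is J^σ times min(1, J/N). The second factor
varies no faster than a power of J, so the constants do not depend on N, and the estimate propagates
the smallness of high-frequency tails as well as the norm.

For existence, the system is cut to J ≤ n, where it is an ordinary differential equation, solved by
Picard–Lindelöf after a radial retraction. The energy estimate bounds norms and tails uniformly in n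
(`exists_truncated`). Approximate solutions are compared one derivative lower (`exists_stability`),
and the uniform tails upgrade this to uniform convergence in H (`norm_le_tail_add`), so the limit is
continuous in time at full regularity. The energy grows at a rate governed by C(1 + 2M) as long as
the norms stay below M; the choice M = 2m + 1 leads to a lifespan of the form ln(1 + 1/m)/(2c).

The same stability estimate gives uniqueness and Lipschitz dependence in H^{s-1} × H^{s-2}. Here the
difference of the η components is measured at order σ = s - 2, and s > 3/2 is exactly σ > -1/2.
Interpolating between this Lipschitz bound and the uniform bound in H^s × H^{s-1} produces the
Hölder exponent s - r.

Distributional solutions and frequency-side curves are identified by testing against Fourier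
transforms of Schwartz functions (`IsSolution.isCurve`, `IsCurve.isSolution`). -/

namespace FornbergWhitham

noncomputable section

/-! ### Symbols on the frequency side -/

/-- The frequency variable `ζ = 2πξ`. -/
def freq (ξ : ℝ) : ℝ := 2 * Real.pi * ξ

/-- The Japanese bracket `(1 + ζ²)^{1/2}` of the frequency `ζ = 2πξ`. -/
def jap (ξ : ℝ) : ℝ := √(1 + freq ξ ^ 2)

lemma one_le_jap (ξ : ℝ) : 1 ≤ jap ξ := by
  rw [jap, Real.one_le_sqrt]; nlinarith [sq_nonneg (freq ξ)]

lemma jap_pos (ξ : ℝ) : 0 < jap ξ := zero_lt_one.trans_le (one_le_jap ξ)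

lemma jap_sq (ξ : ℝ) : jap ξ ^ 2 = 1 + freq ξ ^ 2 :=
  Real.sq_sqrt (by positivity)

lemma abs_freq_le_jap (ξ : ℝ) : |freq ξ| ≤ jap ξ := by
  refine abs_le_of_sq_le_sq ?_ (jap_pos ξ).le
  rw [jap_sq]; linarith

lemma freq_sub (ξ ζ : ℝ) : freq (ξ - ζ) = freq ξ - freq ζ := by simp only [freq]; ring

lemma jap_neg (ξ : ℝ) : jap (-ξ) = jap ξ := by simp [jap, freq]

lemma continuous_freq : Continuous freq := by unfold freq; fun_prop

lemma continuous_jap : Continuous jap := by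
  unfold jap; exact (continuous_const.add (continuous_freq.pow 2)).sqrt

lemma measurable_jap : Measurable jap := continuous_jap.measurable

lemma jap_rpow (σ ξ : ℝ) : (1 + (2 * Real.pi * ξ) ^ 2) ^ (σ / 2) = jap ξ ^ σ := by
  rw [jap, Real.sqrt_eq_rpow, ← Real.rpow_mul (by positivity), freq]
  congr 1; ring

lemma jap_le_add (ξ ζ : ℝ) : jap ξ ≤ jap (ξ - ζ) + jap ζ := by
  have h1 := jap_sq ξ
  have h2 := jap_sq ζ
  have h3 := jap_sq (ξ - ζ)
  rw [freq_sub] at h3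
  refine le_of_sq_le_sq ?_ (add_nonneg (jap_pos _).le (jap_pos _).le)
  have h4 : (freq ξ - freq ζ) * freq ζ ≤ jap (ξ - ζ) * jap ζ := by
    refine (le_abs_self _).trans ?_
    rw [abs_mul, ← freq_sub]
    exact mul_le_mul (abs_freq_le_jap _) (abs_freq_le_jap _) (abs_nonneg _) (jap_pos _).le
  nlinarith

lemma jap_sub_comm (ξ ζ : ℝ) : jap (ξ - ζ) = jap (ζ - ξ) := by
  rw [← jap_neg, neg_sub]

lemma jap_le_add' (ξ ζ : ℝ) : jap ζ ≤ jap (ξ - ζ) + jap ξ := by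
  rw [jap_sub_comm]; exact jap_le_add ζ ξ

lemma measurable_jap_rpow (σ : ℝ) : Measurable fun ξ ↦ jap ξ ^ σ := measurable_jap.pow_const σ

lemma jap_rpow_pos (σ ξ : ℝ) : 0 < jap ξ ^ σ := Real.rpow_pos_of_pos (jap_pos ξ) σ

lemma memLp_jap_rpow_neg {τ : ℝ} (hτ : 1 / 2 < τ) :
    MemLp (fun ξ ↦ jap ξ ^ (-τ)) 2 (volume : Measure ℝ) := by
  rw [memLp_two_iff_integrable_sq (measurable_jap_rpow _).aestronglyMeasurable]
  have h : Integrable (fun x : ℝ ↦ (1 + ‖x‖ ^ 2) ^ (-(2 * τ) / 2)) volume :=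
    integrable_rpow_neg_one_add_norm_sq (by simp; linarith)
  have h2 := h.comp_mul_left' (R := 2 * Real.pi) (by positivity)
  refine h2.congr (ae_of_all _ fun ξ ↦ ?_)
  simp only [Real.norm_eq_abs, sq_abs]
  rw [jap_rpow, ← Real.rpow_natCast, ← Real.rpow_mul (jap_pos ξ).le]
  congr 1; push_cast; ring

/-! ### Pointwise estimates of symbols -/

/-- The mean value inequality on the compact interval [1/2, 2]. By homogeneity it yields the version
for two comparable brackets that follows. -/
lemma exists_abs_rpow_sub_one_le (σ : ℝ) :
    ∃ C, 0 ≤ C ∧ ∀ t : ℝ, 1 / 2 ≤ t → t ≤ 2 → |t ^ σ - 1| ≤ C * |t - 1| := by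
  have hpos : ∀ t ∈ Icc (1 / 2 : ℝ) 2, t ≠ 0 := fun t ht ↦ by
    have := ht.1; intro h; rw [h] at this; norm_num at this
  have hc : ContinuousOn (fun t : ℝ ↦ ‖σ * t ^ (σ - 1)‖) (Icc (1 / 2) 2) := by
    refine ContinuousOn.norm (continuousOn_const.mul ?_)
    exact continuousOn_id.rpow_const fun t ht ↦ Or.inl (hpos t ht)
  obtain ⟨C, hC⟩ := isCompact_Icc.exists_bound_of_continuousOn hc
  refine ⟨|C|, abs_nonneg _, fun t h1 h2 ↦ ?_⟩
  have := Convex.norm_image_sub_le_of_norm_hasDerivWithin_le (s := Icc (1 / 2 : ℝ) 2)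
    (f := fun t ↦ t ^ σ) (f' := fun t ↦ σ * t ^ (σ - 1)) (C := |C|) (x := 1) (y := t)
    (fun x hx ↦ (Real.hasDerivAt_rpow_const (Or.inl (hpos x hx))).hasDerivWithinAt)
    (fun x hx ↦ by have := hC x hx; rw [norm_norm] at this; exact this.trans (le_abs_self C))
    (convex_Icc _ _) (by norm_num) ⟨h1, h2⟩
  simpa using this

lemma exists_abs_rpow_sub_rpow_le (σ : ℝ) :
    ∃ C, 0 ≤ C ∧ ∀ x y : ℝ, 0 < y → x ≤ 2 * y → y ≤ 2 * x →
      y * |x ^ σ - y ^ σ| ≤ C * |x - y| * y ^ σ := by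
  obtain ⟨C, hC0, hC⟩ := exists_abs_rpow_sub_one_le σ
  refine ⟨C, hC0, fun x y hy h1 h2 ↦ ?_⟩
  have h := hC (x / y) (by rw [le_div_iff₀ hy]; linarith) (by rw [div_le_iff₀ hy]; linarith)
  have hx : 0 < x := by linarith
  rw [Real.div_rpow hx.le hy.le] at h
  have hyσ := Real.rpow_pos_of_pos hy σ
  have e1 : |x ^ σ / y ^ σ - 1| = |x ^ σ - y ^ σ| / y ^ σ := by
    rw [div_sub_one hyσ.ne', abs_div, abs_of_pos hyσ]
  have e2 : |x / y - 1| = |x - y| / y := by rw [div_sub_one hy.ne', abs_div, abs_of_pos hy]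
  rw [e1, e2, div_le_iff₀ hyσ] at h
  calc y * |x ^ σ - y ^ σ| ≤ y * (C * (|x - y| / y) * y ^ σ) := by gcongr
    _ = C * |x - y| * y ^ σ := by field_simp

/-- The weight `min(1, y / N)`: nondecreasing, with `min(1, y / N) / y` nonincreasing. -/
def rampFun (N y : ℝ) : ℝ := min 1 (y / N)

lemma rampFun_pos {N y : ℝ} (hN : 1 ≤ N) (hy : 1 ≤ y) : 0 < rampFun N y :=
  lt_min one_pos (by positivity)

lemma rampFun_le_one (N y : ℝ) : rampFun N y ≤ 1 := min_le_left _ _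

lemma rampFun_le_mul {N x y c : ℝ} (hN : 1 ≤ N) (hc : 1 ≤ c) (h : x ≤ c * y) :
    rampFun N x ≤ c * rampFun N y := by
  have hN0 : 0 < N := by linarith
  unfold rampFun
  rw [mul_min_of_nonneg _ _ (by linarith)]
  refine min_le_min (by linarith) ?_
  rw [← mul_div_assoc]; gcongr

lemma rampFun_cross {N x y : ℝ} (hN : 1 ≤ N) (hx : 1 ≤ x) (h : x ≤ y) :
    rampFun N y * x ≤ rampFun N x * y := by
  have := rampFun_le_mul (N := N) (x := y) (y := x) (c := y / x) hN
    (by rw [le_div_iff₀ (by linarith)]; linarith) (by rw [div_mul_cancel₀ _ (by linarith)])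
  rw [div_mul_eq_mul_div, le_div_iff₀ (by linarith)] at this
  linarith

lemma rampFun_mono {N x y : ℝ} (hN : 1 ≤ N) (h : x ≤ y) : rampFun N x ≤ rampFun N y := by
  simpa using rampFun_le_mul (c := 1) hN le_rfl (by simpa using h)

/-- The ramp is nondecreasing and the ramp divided by its argument is nonincreasing. Together these
give a relative Lipschitz bound of the same type as for powers, with a constant free of N; this is
what makes every later energy constant uniform in N. -/
lemma mul_abs_rampFun_sub_le {N x y : ℝ} (hN : 1 ≤ N) (hx : 1 ≤ x) (hy : 1 ≤ y) :
    y * |rampFun N x - rampFun N y| ≤ 2 * |x - y| * rampFun N y := by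
  have hp := rampFun_pos hN hy
  rcases le_total x y with h | h
  · have h1 := rampFun_cross hN hx h
    have h3 := rampFun_mono hN h
    rw [abs_of_nonpos (by linarith), abs_of_nonpos (by linarith)]
    nlinarith
  · have h1 := rampFun_cross hN hy h
    have h3 := rampFun_mono hN h
    rw [abs_of_nonneg (by linarith), abs_of_nonneg (by linarith)]
    nlinarith

lemma rpow_le_two_rpow_mul {x y : ℝ} (σ : ℝ) (hx : 0 < x) (hy : 0 < y) (h1 : x ≤ 2 * y)
    (h2 : y ≤ 2 * x) : x ^ σ ≤ 2 ^ |σ| * y ^ σ := by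
  rcases le_total 0 σ with h | h
  · rw [abs_of_nonneg h, ← Real.mul_rpow (by norm_num) hy.le]
    exact Real.rpow_le_rpow hx.le h1 h
  · rw [abs_of_nonpos h]
    have h3 : x ^ σ ≤ (y / 2) ^ σ :=
      Real.rpow_le_rpow_of_nonpos (by positivity) (by linarith) h
    rw [Real.div_rpow hy.le (by norm_num)] at h3
    rwa [Real.rpow_neg (by norm_num), inv_mul_eq_div]

/-- When z dominates both x and y, all σ + 1 derivatives are moved to z. Writing z^{σ+1} = z^s
z^{σ+1-s}, the second exponent is nonpositive, so that factor may be replaced by the same power of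
y. The power σ + 1 - s is low enough to put the function at frequency y into L¹. -/
lemma rpow_mul_le_of_far {s σ c c' N x y z : ℝ} (hσ : -1 ≤ σ) (hσs : σ ≤ s - 1) (hN : 1 ≤ N)
    (hx : 1 ≤ x) (hy : 1 ≤ y) (hz : 1 ≤ z) (hc : 1 ≤ c) (hxz : x ≤ c * z) (hc' : 1 ≤ c')
    (hyz : y ≤ c' * z) :
    x * (x ^ σ * rampFun N x) ≤
      c ^ (σ + 2) * c' ^ (s - 1 - σ) * ((z ^ s * rampFun N z) * y ^ (σ + 1 - s)) := by
  have e : c ^ (σ + 2) = c ^ (σ + 1) * c := by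
    rw [← Real.rpow_add_one (by linarith)]; congr 1; ring
  have h1 : x * x ^ σ ≤ c ^ (σ + 1) * z ^ (σ + 1) := by
    rw [← Real.mul_rpow (by linarith) (by linarith), mul_comm, ← Real.rpow_add_one (by linarith)]
    exact Real.rpow_le_rpow (by linarith) hxz (by linarith)
  have h2 : z ^ (σ + 1 - s) ≤ c' ^ (s - 1 - σ) * y ^ (σ + 1 - s) := by
    have := Real.rpow_le_rpow_of_nonpos (x := y / c') (y := z) (z := σ + 1 - s) (by positivity)
      (by rw [div_le_iff₀ (by linarith)]; linarith) (by linarith)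
    rw [Real.div_rpow (by linarith) (by linarith)] at this
    rwa [show s - 1 - σ = -(σ + 1 - s) by ring, Real.rpow_neg (by linarith), inv_mul_eq_div]
  have h3 : z ^ (σ + 1) = z ^ s * z ^ (σ + 1 - s) := by
    rw [← Real.rpow_add (by linarith)]; congr 1; ring
  have h4 := rampFun_le_mul hN hc hxz
  have p1 := rampFun_pos hN hx
  have p2 := rampFun_pos hN hz
  calc x * (x ^ σ * rampFun N x) = (x * x ^ σ) * rampFun N x := by ring
    _ ≤ (c ^ (σ + 1) * z ^ (σ + 1)) * (c * rampFun N z) := by gcongr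
    _ = c ^ (σ + 2) * (z ^ s * rampFun N z) * z ^ (σ + 1 - s) := by rw [h3, e]; ring
    _ ≤ c ^ (σ + 2) * (z ^ s * rampFun N z) * (c' ^ (s - 1 - σ) * y ^ (σ + 1 - s)) := by gcongr
    _ = _ := by ring

/-- The commutator estimate for the symbol `k V²` in terms of the brackets of the three
frequencies. -/
lemma exists_commutator_bound (s σ : ℝ) (hσ : -1 ≤ σ) (hσs : σ ≤ s - 1) :
    ∃ C, 0 ≤ C ∧ ∀ N k l x y z : ℝ, 1 ≤ N → 1 ≤ x → 1 ≤ y → 1 ≤ z → |k| ≤ x → |l| ≤ y →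
      |k - l| ≤ z → x ≤ z + y → y ≤ z + x →
      |k * (x ^ σ * rampFun N x) ^ 2 - l * (y ^ σ * rampFun N y) ^ 2| ≤
        C * (z * (x ^ σ * rampFun N x) * (y ^ σ * rampFun N y) +
          (z ^ s * rampFun N z) * (y ^ (σ + 1 - s) * (x ^ σ * rampFun N x) +
            x ^ (σ + 1 - s) * (y ^ σ * rampFun N y))) := by
  obtain ⟨C₁, hC₁, h₁⟩ := exists_abs_rpow_sub_rpow_le σ
  set D : ℝ := 2 ^ |σ| * 2 with hD
  set A : ℝ := 3 ^ (σ + 2) * 2 ^ (s - 1 - σ) with hA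
  set A' : ℝ := 2 ^ (σ + 2) * 3 ^ (s - 1 - σ) with hA'
  set B : ℝ := D + (C₁ * 2 + 2) * (D + 1) with hB
  refine ⟨A + A' + B, by positivity, fun N k l x y z hN hx hy hz hk hl hkl hxy hyx ↦ ?_⟩
  have gx := rampFun_pos hN hx
  have gy := rampFun_pos hN hy
  have gz := rampFun_pos hN hz
  set V := x ^ σ * rampFun N x with hV
  set U := y ^ σ * rampFun N y with hU
  set W := z ^ s * rampFun N z with hW
  have V0 : 0 < V := by positivity
  have U0 : 0 < U := by positivity
  have W0 : 0 < W := by positivity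
  have px : 0 < x ^ (σ + 1 - s) := by positivity
  have py : 0 < y ^ (σ + 1 - s) := by positivity
  -- If y ≤ 2z then x ≤ 3z, and both terms are bounded separately without cancellation. Otherwise x
  -- and y are within a factor 2 of each other, and the difference of the symbols gains a factor |x
  -- - y| ≤ z.
  rcases le_total y (2 * z) with hfar | hnear
  · have f1 : x * V ≤ A * (W * y ^ (σ + 1 - s)) :=
      rpow_mul_le_of_far hσ hσs hN hx hy hz (by norm_num) (by linarith) (by norm_num) hfar
    have f2 : y * U ≤ A' * (W * x ^ (σ + 1 - s)) :=
      rpow_mul_le_of_far hσ hσs hN hy hx hz (by norm_num) hfar (by norm_num) (by linarith)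
    calc |k * V ^ 2 - l * U ^ 2| ≤ |k * V ^ 2| + |l * U ^ 2| := abs_sub _ _
      _ = |k| * V * V + |l| * U * U := by
        rw [abs_mul, abs_mul, abs_of_nonneg (sq_nonneg V), abs_of_nonneg (sq_nonneg U)]; ring
      _ ≤ x * V * V + y * U * U := by gcongr
      _ ≤ (A * (W * y ^ (σ + 1 - s))) * V + (A' * (W * x ^ (σ + 1 - s))) * U := by gcongr
      _ ≤ _ := by
        have a1 : 0 ≤ A' * (W * y ^ (σ + 1 - s)) * V := by positivity
        have a2 : 0 ≤ A * (W * x ^ (σ + 1 - s)) * U := by positivity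
        have a3 : 0 ≤ (A + A' + B) * (z * V * U) := by positivity
        have a4 : 0 ≤ B * (W * (y ^ (σ + 1 - s) * V + x ^ (σ + 1 - s) * U)) := by positivity
        nlinarith
  · have b1 : x ≤ 2 * y := by linarith
    have b2 : y ≤ 2 * x := by linarith
    have q1 : V ≤ D * U := by
      calc V ≤ (2 ^ |σ| * y ^ σ) * (2 * rampFun N y) := by
            rw [hV]; gcongr
            · exact rpow_le_two_rpow_mul σ (by linarith) (by linarith) b1 b2
            · exact rampFun_le_mul hN one_le_two b1
        _ = D * U := by rw [hU, hD]; ring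
    have q2 : U ≤ D * V := by
      calc U ≤ (2 ^ |σ| * x ^ σ) * (2 * rampFun N x) := by
            rw [hU]; gcongr
            · exact rpow_le_two_rpow_mul σ (by linarith) (by linarith) b2 b1
            · exact rampFun_le_mul hN one_le_two b2
        _ = D * V := by rw [hV, hD]; ring
    have hxyz : |x - y| ≤ z := abs_sub_le_iff.2 ⟨by linarith, by linarith⟩
    have q3 : y * |V - U| ≤ (C₁ * 2 + 2) * z * U := by
      have e : V - U = (x ^ σ - y ^ σ) * rampFun N x + y ^ σ * (rampFun N x - rampFun N y) := by
        rw [hV, hU]; ring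
      have r1 := h₁ x y (by linarith) b1 b2
      have r2 := mul_abs_rampFun_sub_le hN hx hy
      have r3 := rampFun_le_mul hN one_le_two b1
      calc y * |V - U| ≤ y * (|x ^ σ - y ^ σ| * rampFun N x
            + y ^ σ * |rampFun N x - rampFun N y|) := by
            rw [e]; gcongr
            refine (abs_add_le _ _).trans_eq ?_
            rw [abs_mul, abs_mul, abs_of_pos gx, abs_of_pos (by positivity : 0 < y ^ σ)]
        _ = (y * |x ^ σ - y ^ σ|) * rampFun N x
            + y ^ σ * (y * |rampFun N x - rampFun N y|) := by ring
        _ ≤ (C₁ * |x - y| * y ^ σ) * (2 * rampFun N y)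
            + y ^ σ * (2 * |x - y| * rampFun N y) := by gcongr
        _ = (C₁ * 2 + 2) * |x - y| * U := by rw [hU]; ring
        _ ≤ _ := by gcongr
    calc |k * V ^ 2 - l * U ^ 2| = |(k - l) * V ^ 2 + l * ((V - U) * (V + U))| := by
          congr 1; ring
      _ ≤ |k - l| * V ^ 2 + |l| * |V - U| * (V + U) := by
        refine (abs_add_le _ _).trans_eq ?_
        rw [abs_mul, abs_mul, abs_mul, abs_of_nonneg (sq_nonneg V),
          abs_of_pos (by positivity : 0 < V + U)]
        ring
      _ ≤ z * (V * (D * U)) + y * |V - U| * (V + D * V) := by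
        rw [sq]; gcongr
      _ ≤ z * (V * (D * U)) + ((C₁ * 2 + 2) * z * U) * (V + D * V) := by gcongr
      _ = B * (z * V * U) := by rw [hB]; ring
      _ ≤ (A + A' + B) * (z * V * U + W * (y ^ (σ + 1 - s) * V + x ^ (σ + 1 - s) * U)) := by
        have a1 : 0 ≤ (A + A') * (z * V * U) := by positivity
        have a2 : 0 ≤ (A + A' + B) * (W * (y ^ (σ + 1 - s) * V + x ^ (σ + 1 - s) * U)) := by
          positivity
        nlinarith

/-- The weight `min(1, J / N)` on the frequency side, `J` being the Japanese bracket. -/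
def ramp (N ξ : ℝ) : ℝ := rampFun N (jap ξ)

lemma ramp_pos {N : ℝ} (hN : 1 ≤ N) (ξ : ℝ) : 0 < ramp N ξ := rampFun_pos hN (one_le_jap ξ)

lemma ramp_le_one (N ξ : ℝ) : ramp N ξ ≤ 1 := rampFun_le_one _ _

lemma ramp_one (ξ : ℝ) : ramp 1 ξ = 1 := by
  simp [ramp, rampFun, one_le_jap]

lemma measurable_ramp (N : ℝ) : Measurable (ramp N) := by
  unfold ramp rampFun
  exact measurable_const.min (measurable_jap.div_const N)

lemma jap_rpow_le (τ : ℝ) (hτ : 0 ≤ τ) (ξ ζ : ℝ) :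
    jap ξ ^ τ ≤ 2 ^ τ * (jap (ξ - ζ) ^ τ + jap ζ ^ τ) := by
  have h := jap_le_add ξ ζ
  have p1 := jap_pos (ξ - ζ)
  have p2 := jap_pos ζ
  rcases le_total (jap (ξ - ζ)) (jap ζ) with h' | h'
  · calc jap ξ ^ τ ≤ (2 * jap ζ) ^ τ := Real.rpow_le_rpow (jap_pos ξ).le (by linarith) hτ
      _ = 2 ^ τ * jap ζ ^ τ := Real.mul_rpow (by norm_num) p2.le
      _ ≤ _ := by gcongr; exact le_add_of_nonneg_left (by positivity)
  · calc jap ξ ^ τ ≤ (2 * jap (ξ - ζ)) ^ τ :=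
        Real.rpow_le_rpow (jap_pos ξ).le (by linarith) hτ
      _ = 2 ^ τ * jap (ξ - ζ) ^ τ := Real.mul_rpow (by norm_num) p1.le
      _ ≤ _ := by gcongr; exact le_add_of_nonneg_right (by positivity)

/-! ### Convolution inequalities -/

/-- The convolution of two functions with values in `[0, ∞]`. -/
def lconv (p q : ℝ → ℝ≥0∞) (ξ : ℝ) : ℝ≥0∞ := ∫⁻ ζ, p (ξ - ζ) * q ζ

lemma lconv_comm (p q : ℝ → ℝ≥0∞) (ξ : ℝ) : lconv p q ξ = lconv q p ξ := by
  unfold lconv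
  rw [← lintegral_sub_left_eq_self _ ξ]
  simp [mul_comm]

lemma measurable_lconv_kernel {p q : ℝ → ℝ≥0∞} (hp : Measurable p) (hq : Measurable q) :
    Measurable fun x : ℝ × ℝ ↦ p (x.1 - x.2) * q x.2 :=
  (hp.comp (measurable_fst.sub measurable_snd)).mul (hq.comp measurable_snd)

lemma measurable_lconv {p q : ℝ → ℝ≥0∞} (hp : Measurable p) (hq : Measurable q) :
    Measurable (lconv p q) :=
  (measurable_lconv_kernel hp hq).lintegral_prod_right'

lemma eLpNorm_two_sq (p : ℝ → ℝ≥0∞) : eLpNorm p 2 volume ^ 2 = ∫⁻ ξ, p ξ ^ 2 := by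
  rw [eLpNorm_eq_lintegral_rpow_enorm_toReal (by norm_num) (by norm_num), ← ENNReal.rpow_natCast,
    ← ENNReal.rpow_mul]
  simp

lemma lintegral_mul_le_eLpNorm {p q : ℝ → ℝ≥0∞} (hp : Measurable p) (hq : Measurable q) :
    ∫⁻ ξ, p ξ * q ξ ≤ eLpNorm p 2 volume * eLpNorm q 2 volume := by
  have := ENNReal.lintegral_mul_le_Lp_mul_Lq volume Real.HolderConjugate.two_two
    hp.aemeasurable hq.aemeasurable
  rw [eLpNorm_eq_lintegral_rpow_enorm_toReal (by norm_num) (by norm_num),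
    eLpNorm_eq_lintegral_rpow_enorm_toReal (by norm_num) (by norm_num)]
  simpa using this

lemma eLpNorm_comp_sub_left (p : ℝ → ℝ≥0∞) (ξ : ℝ) :
    eLpNorm (fun ζ ↦ p (ξ - ζ)) 2 volume = eLpNorm p 2 volume := by
  rw [eLpNorm_eq_lintegral_rpow_enorm_toReal (by norm_num) (by norm_num),
    eLpNorm_eq_lintegral_rpow_enorm_toReal (by norm_num) (by norm_num),
    lintegral_sub_left_eq_self (fun ζ ↦ ‖p ζ‖ₑ ^ (2 : ℝ≥0∞).toReal) ξ]

lemma lconv_le {p q : ℝ → ℝ≥0∞} (hp : Measurable p) (hq : Measurable q) (ξ : ℝ) :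
    lconv p q ξ ≤ eLpNorm p 2 volume * eLpNorm q 2 volume := by
  rw [← eLpNorm_comp_sub_left p ξ]
  exact lintegral_mul_le_eLpNorm (hp.comp (measurable_const.sub measurable_id)) hq

/-- Young's inequality `‖p ⋆ q‖₂ ≤ ‖p‖₁ ‖q‖₂`. -/
lemma eLpNorm_lconv_le {p q : ℝ → ℝ≥0∞} (hp : Measurable p) (hq : Measurable q) :
    eLpNorm (lconv p q) 2 volume ≤ (∫⁻ ξ, p ξ) * eLpNorm q 2 volume := by
  have key : ∀ ξ, lconv p q ξ ^ 2 ≤ (∫⁻ ξ, p ξ) * lconv p (fun ζ ↦ q ζ ^ 2) ξ := fun ξ ↦ by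
    have hps : Measurable fun ζ ↦ p (ξ - ζ) := hp.comp (measurable_const.sub measurable_id)
    -- Cauchy–Schwarz after splitting p as √p · √p, so that one factor carries the mass of p and the
    -- other p q².
    have h := lintegral_mul_le_eLpNorm (p := fun ζ ↦ p (ξ - ζ) ^ (1 / 2 : ℝ))
      (q := fun ζ ↦ p (ξ - ζ) ^ (1 / 2 : ℝ) * q ζ) (hps.pow_const _) ((hps.pow_const _).mul hq)
    have e : ∀ x : ℝ≥0∞, x ^ (1 / 2 : ℝ) * x ^ (1 / 2 : ℝ) = x := fun x ↦ by
      rw [← ENNReal.rpow_add_of_nonneg _ _ (by norm_num) (by norm_num)]; norm_num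
    have e2 : ∀ x : ℝ≥0∞, (x ^ (1 / 2 : ℝ)) ^ 2 = x := fun x ↦ by rw [sq, e]
    simp only [← mul_assoc, e] at h
    calc lconv p q ξ ^ 2 ≤ _ := pow_le_pow_left' h 2
      _ = _ := by
        rw [mul_pow, eLpNorm_two_sq, eLpNorm_two_sq]
        simp only [mul_pow, e2, lconv]
        rw [lintegral_sub_left_eq_self p ξ]
  have h2 : eLpNorm (lconv p q) 2 volume ^ 2 ≤ ((∫⁻ ξ, p ξ) * eLpNorm q 2 volume) ^ 2 := by
    rw [mul_pow, eLpNorm_two_sq, eLpNorm_two_sq, sq (∫⁻ ξ, p ξ), mul_assoc]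
    refine (lintegral_mono key).trans ?_
    rw [lintegral_const_mul _ (measurable_lconv hp (hq.pow_const 2))]
    gcongr
    unfold lconv
    rw [lintegral_lintegral_swap (measurable_lconv_kernel hp (hq.pow_const 2)).aemeasurable,
      ← lintegral_const_mul _ (hq.pow_const 2)]
    refine lintegral_mono fun ζ ↦ ?_
    have hps : Measurable fun x ↦ p (x - ζ) := hp.comp (measurable_id.sub_const ζ)
    rw [lintegral_mul_const _ hps, lintegral_sub_right_eq_self p]
  exact (ENNReal.pow_le_pow_left_iff two_ne_zero).1 h2

lemma eLpNorm_lconv_le' {p q : ℝ → ℝ≥0∞} (hp : Measurable p) (hq : Measurable q) :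
    eLpNorm (lconv p q) 2 volume ≤ eLpNorm p 2 volume * ∫⁻ ξ, q ξ := by
  rw [mul_comm, show lconv p q = lconv q p from funext (lconv_comm p q)]
  exact eLpNorm_lconv_le hq hp

/-! ### Weighted norms -/

/-- The weighted modulus `w |f|`. -/
def mag (w : ℝ → ℝ) (f : ℝ → ℂ) (ξ : ℝ) : ℝ≥0∞ := ENNReal.ofReal (w ξ) * ‖f ξ‖ₑ

/-- The weighted norm `‖w f‖_{L²}`. -/
def wnorm (w : ℝ → ℝ) (f : ℝ → ℂ) : ℝ≥0∞ := eLpNorm (fun ξ ↦ w ξ • f ξ) 2 volume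

lemma measurable_mag {w : ℝ → ℝ} {f : ℝ → ℂ} (hw : Measurable w) (hf : Measurable f) :
    Measurable (mag w f) := hw.ennreal_ofReal.mul hf.enorm

lemma enorm_smul_eq_mag {w : ℝ → ℝ} (hw : ∀ ξ, 0 ≤ w ξ) (f : ℝ → ℂ) (ξ : ℝ) :
    ‖w ξ • f ξ‖ₑ = mag w f ξ := by
  rw [enorm_smul, mag, Real.enorm_of_nonneg (hw ξ)]

lemma wnorm_eq {w : ℝ → ℝ} (hw : ∀ ξ, 0 ≤ w ξ) (f : ℝ → ℂ) :
    wnorm w f = eLpNorm (mag w f) 2 volume :=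
  eLpNorm_congr_enorm_ae (ae_of_all _ fun ξ ↦ by
    rw [enorm_smul_eq_mag hw, enorm_eq_self])

lemma wnorm_mono {w w' : ℝ → ℝ} (h0 : ∀ ξ, 0 ≤ w ξ) (h : ∀ ξ, w ξ ≤ w' ξ) (f : ℝ → ℂ) :
    wnorm w f ≤ wnorm w' f := by
  refine eLpNorm_mono fun ξ ↦ ?_
  rw [norm_smul, norm_smul, Real.norm_of_nonneg (h0 ξ), Real.norm_of_nonneg ((h0 ξ).trans (h ξ))]
  exact mul_le_mul_of_nonneg_right (h ξ) (norm_nonneg _)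

lemma wnorm_congr {w : ℝ → ℝ} {f g : ℝ → ℂ} (h : f =ᵐ[volume] g) : wnorm w f = wnorm w g :=
  eLpNorm_congr_ae (h.mono fun ξ hξ ↦ by simp only [hξ])

/-- The constant in the embedding of `H^τ`, `τ > 1/2`, into the functions with integrable Fourier
transform. -/
def embConst (τ : ℝ) : ℝ≥0 := (eLpNorm (fun ξ ↦ jap ξ ^ (-τ)) 2 volume).toNNReal

/-- Cauchy–Schwarz against J^{-τ}, which is square integrable for τ > 1/2. This is the only way in
which L¹ norms on the frequency side are bounded. -/
lemma lintegral_mag_le {τ ρ θ : ℝ} (hτ : 1 / 2 < τ) (h : ρ + τ = θ) {f : ℝ → ℂ}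
    (hf : Measurable f) :
    ∫⁻ ξ, mag (fun ξ ↦ jap ξ ^ ρ) f ξ ≤ embConst τ * wnorm (fun ξ ↦ jap ξ ^ θ) f := by
  have e1 : (embConst τ : ℝ≥0∞) = eLpNorm (fun ξ ↦ ENNReal.ofReal (jap ξ ^ (-τ))) 2 volume := by
    rw [embConst, ENNReal.coe_toNNReal (memLp_jap_rpow_neg hτ).2.ne]
    refine eLpNorm_congr_enorm_ae (ae_of_all _ fun ξ ↦ ?_)
    rw [enorm_eq_self, Real.enorm_of_nonneg (jap_rpow_pos _ _).le]
  rw [e1, wnorm_eq fun ξ ↦ (jap_rpow_pos _ _).le]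
  refine le_trans (le_of_eq ?_) (lintegral_mul_le_eLpNorm
    (measurable_jap_rpow _).ennreal_ofReal (measurable_mag (measurable_jap_rpow _) hf))
  refine lintegral_congr fun ξ ↦ ?_
  rw [mag, mag, ← mul_assoc, ← ENNReal.ofReal_mul (jap_rpow_pos _ _).le,
    ← Real.rpow_add (jap_pos ξ)]
  congr 3; linarith

lemma mag_one (f : ℝ → ℂ) : mag (fun ξ ↦ jap ξ ^ (0 : ℝ)) f = fun ξ ↦ ‖f ξ‖ₑ := by
  ext ξ; simp [mag]

/-- The weight J^τ(ξ) is bounded by a multiple of J^τ(ξ-ζ) + J^τ(ζ). In each of the two terms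
Young's inequality is applied with the unweighted factor in L¹. -/
lemma eLpNorm_mul_lconv_le {τ : ℝ} (hτ : 1 / 2 < τ) {f g : ℝ → ℂ} (hf : Measurable f)
    (hg : Measurable g) :
    eLpNorm (fun ξ ↦ ENNReal.ofReal (jap ξ ^ τ) * lconv (fun ξ ↦ ‖f ξ‖ₑ) (fun ξ ↦ ‖g ξ‖ₑ) ξ)
      2 volume ≤ ENNReal.ofReal (2 ^ τ) * (2 * embConst τ) *
        (wnorm (fun ξ ↦ jap ξ ^ τ) f * wnorm (fun ξ ↦ jap ξ ^ τ) g) := by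
  set F := mag (fun ξ ↦ jap ξ ^ τ) f with hF
  set G := mag (fun ξ ↦ jap ξ ^ τ) g with hG
  have mF : Measurable F := measurable_mag (measurable_jap_rpow _) hf
  have mG : Measurable G := measurable_mag (measurable_jap_rpow _) hg
  have h1 : ∀ ξ, ENNReal.ofReal (jap ξ ^ τ) * lconv (fun ξ ↦ ‖f ξ‖ₑ) (fun ξ ↦ ‖g ξ‖ₑ) ξ ≤
      ENNReal.ofReal (2 ^ τ) * (lconv F (fun ξ ↦ ‖g ξ‖ₑ) ξ + lconv (fun ξ ↦ ‖f ξ‖ₑ) G ξ) := by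
    intro ξ
    have m1 : Measurable fun ζ ↦ ‖f (ξ - ζ)‖ₑ * ‖g ζ‖ₑ :=
      (hf.comp (measurable_const.sub measurable_id)).enorm.mul hg.enorm
    have m2 : Measurable fun ζ ↦ F (ξ - ζ) * ‖g ζ‖ₑ :=
      (mF.comp (measurable_const.sub measurable_id)).mul hg.enorm
    have m3 : Measurable fun ζ ↦ ‖f (ξ - ζ)‖ₑ * G ζ :=
      (hf.comp (measurable_const.sub measurable_id)).enorm.mul mG
    have m4 : Measurable fun ζ ↦ F (ξ - ζ) * ‖g ζ‖ₑ + ‖f (ξ - ζ)‖ₑ * G ζ := m2.add m3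
    unfold lconv
    rw [← lintegral_const_mul _ m1, ← lintegral_add_left m2, ← lintegral_const_mul _ m4]
    refine lintegral_mono fun ζ ↦ ?_
    have h := ENNReal.ofReal_le_ofReal (jap_rpow_le τ (by linarith) ξ ζ)
    rw [ENNReal.ofReal_mul (by positivity),
      ENNReal.ofReal_add (jap_rpow_pos _ _).le (jap_rpow_pos _ _).le] at h
    calc ENNReal.ofReal (jap ξ ^ τ) * (‖f (ξ - ζ)‖ₑ * ‖g ζ‖ₑ) ≤ _ := mul_le_mul_left h _
      _ = _ := by simp only [hF, hG, mag]; ring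
  have i1 := lintegral_mag_le (ρ := 0) hτ (zero_add τ) hf
  have i2 := lintegral_mag_le (ρ := 0) hτ (zero_add τ) hg
  rw [mag_one] at i1 i2
  rw [wnorm_eq fun ξ ↦ (jap_rpow_pos _ _).le] at i1 i2 ⊢
  rw [wnorm_eq fun ξ ↦ (jap_rpow_pos _ _).le]
  have n1 := eLpNorm_lconv_le' mF hg.enorm
  have n2 := eLpNorm_lconv_le hf.enorm mG
  have sm1 := (measurable_lconv mF hg.enorm)
  have sm2 := (measurable_lconv hf.enorm mG)
  calc _ ≤ eLpNorm (fun ξ ↦ ENNReal.ofReal (2 ^ τ) *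
        (lconv F (fun ξ ↦ ‖g ξ‖ₑ) ξ + lconv (fun ξ ↦ ‖f ξ‖ₑ) G ξ)) 2 volume := by
        refine eLpNorm_mono_enorm fun ξ ↦ ?_
        simpa using h1 ξ
    _ ≤ ENNReal.ofReal (2 ^ τ) * eLpNorm (lconv F (fun ξ ↦ ‖g ξ‖ₑ) +
        lconv (fun ξ ↦ ‖f ξ‖ₑ) G) 2 volume := by
        refine (ENNReal.pow_le_pow_left_iff two_ne_zero).1 ?_
        rw [mul_pow, eLpNorm_two_sq, eLpNorm_two_sq,
          ← lintegral_const_mul _ ((sm1.add sm2).pow_const 2)]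
        simp only [mul_pow, Pi.add_apply, le_refl]
    _ ≤ ENNReal.ofReal (2 ^ τ) * (eLpNorm (lconv F (fun ξ ↦ ‖g ξ‖ₑ)) 2 volume +
        eLpNorm (lconv (fun ξ ↦ ‖f ξ‖ₑ) G) 2 volume) := by
        gcongr
        exact eLpNorm_add_le sm1.aestronglyMeasurable sm2.aestronglyMeasurable (by norm_num)
    _ ≤ ENNReal.ofReal (2 ^ τ) * (eLpNorm F 2 volume * (embConst τ * eLpNorm G 2 volume) +
        embConst τ * eLpNorm F 2 volume * eLpNorm G 2 volume) := by
        gcongr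
        · exact n1.trans (by gcongr)
        · exact n2.trans (by gcongr)
    _ = _ := by ring

/-! ### Convolution of complex functions -/

/-- The convolution of two functions on the line. -/
def conv (f g : ℝ → ℂ) (ξ : ℝ) : ℂ := ∫ ζ, f (ξ - ζ) * g ζ

lemma conv_comm (f g : ℝ → ℂ) (ξ : ℝ) : conv f g ξ = conv g f ξ := by
  unfold conv
  rw [← integral_sub_left_eq_self _ volume ξ]
  simp [mul_comm]

lemma enorm_conv_le (f g : ℝ → ℂ) (ξ : ℝ) :
    ‖conv f g ξ‖ₑ ≤ lconv (fun ξ ↦ ‖f ξ‖ₑ) (fun ξ ↦ ‖g ξ‖ₑ) ξ := by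
  unfold conv lconv
  refine (enorm_integral_le_lintegral_enorm _).trans_eq ?_
  simp

lemma measurable_conv {f g : ℝ → ℂ} (hf : Measurable f) (hg : Measurable g) :
    Measurable (conv f g) := by
  have : StronglyMeasurable fun x : ℝ × ℝ ↦ f (x.1 - x.2) * g x.2 :=
    ((hf.comp (measurable_fst.sub measurable_snd)).mul (hg.comp measurable_snd)).stronglyMeasurable
  exact this.integral_prod_right'.measurable

lemma integrable_conv {f g : ℝ → ℂ} (hf : MemLp f 2 volume) (hg : MemLp g 2 volume) (ξ : ℝ) :
    Integrable fun ζ ↦ f (ξ - ζ) * g ζ :=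
  (hf.comp_measurePreserving (Measure.measurePreserving_sub_left volume ξ)).integrable_mul hg

lemma conv_congr {f f' g g' : ℝ → ℂ} (hf : f =ᵐ[volume] f') (hg : g =ᵐ[volume] g') (ξ : ℝ) :
    conv f g ξ = conv f' g' ξ := by
  refine integral_congr_ae ?_
  filter_upwards [(Measure.measurePreserving_sub_left volume ξ).quasiMeasurePreserving.ae hf, hg]
    with ζ h1 h2
  rw [h1, h2]

/-- The algebra property of `H^τ`, `τ > 1/2`. -/
lemma wnorm_conv_le {τ : ℝ} (hτ : 1 / 2 < τ) {f g : ℝ → ℂ} (hf : Measurable f)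
    (hg : Measurable g) :
    wnorm (fun ξ ↦ jap ξ ^ τ) (conv f g) ≤ ENNReal.ofReal (2 ^ τ) * (2 * embConst τ) *
        (wnorm (fun ξ ↦ jap ξ ^ τ) f * wnorm (fun ξ ↦ jap ξ ^ τ) g) := by
  refine le_trans ?_ (eLpNorm_mul_lconv_le hτ hf hg)
  refine eLpNorm_mono_enorm fun ξ ↦ ?_
  rw [enorm_smul_eq_mag fun ξ ↦ (jap_rpow_pos _ _).le, mag, enorm_eq_self]
  gcongr
  exact enorm_conv_le f g ξ

/-- Hermitian symmetry, characterizing the Fourier transforms of real functions. -/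
def IsHerm (f : ℝ → ℂ) : Prop := ∀ᵐ ξ, f (-ξ) = (starRingEnd ℂ) (f ξ)

lemma IsHerm.ae_prod {f : ℝ → ℂ} (h : IsHerm f) (hf : Measurable f) :
    ∀ᵐ p : ℝ × ℝ ∂(volume.prod volume), f (p.2 - p.1) = (starRingEnd ℂ) (f (p.1 - p.2)) := by
  rw [Measure.ae_prod_iff_ae_ae]
  · refine ae_of_all _ fun ξ ↦ ?_
    filter_upwards [(Measure.measurePreserving_sub_left volume ξ).quasiMeasurePreserving.ae h]
      with ζ hζ
    simpa using hζ
  · exact measurableSet_eq_fun (hf.comp (measurable_snd.sub measurable_fst))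
      (Complex.continuous_conj.measurable.comp (hf.comp (measurable_fst.sub measurable_snd)))

/-- The trilinear estimate with the first factor in `L¹`. -/
lemma lintegral_lconv_mul_le {p q r : ℝ → ℝ≥0∞} (hp : Measurable p) (hq : Measurable q)
    (hr : Measurable r) :
    ∫⁻ ξ, lconv p q ξ * r ξ ≤ (∫⁻ ξ, p ξ) * eLpNorm q 2 volume * eLpNorm r 2 volume := by
  refine (lintegral_mul_le_eLpNorm (measurable_lconv hp hq) hr).trans ?_
  gcongr
  exact eLpNorm_lconv_le hp hq

/-- The trilinear estimate with the second factor in `L¹`. -/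
lemma lintegral_lconv_mul_le' {p q r : ℝ → ℝ≥0∞} (hp : Measurable p) (hq : Measurable q)
    (hr : Measurable r) :
    ∫⁻ ξ, lconv p q ξ * r ξ ≤ eLpNorm p 2 volume * (∫⁻ ξ, q ξ) * eLpNorm r 2 volume := by
  refine (lintegral_mul_le_eLpNorm (measurable_lconv hp hq) hr).trans ?_
  gcongr
  exact eLpNorm_lconv_le' hp hq

/-- The trilinear estimate with the third factor in `L¹`. -/
lemma lintegral_lconv_mul_le'' {p q r : ℝ → ℝ≥0∞} (hp : Measurable p) (hq : Measurable q)
    (hr : Measurable r) :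
    ∫⁻ ξ, lconv p q ξ * r ξ ≤ eLpNorm p 2 volume * eLpNorm q 2 volume * ∫⁻ ξ, r ξ := by
  rw [← lintegral_const_mul _ hr]
  exact lintegral_mono fun ξ ↦ by gcongr; exact lconv_le hp hq ξ

/-! ### The transport estimate -/

/-- The weight `J^σ min(1, J / N)`. -/
def weight (σ N ξ : ℝ) : ℝ := jap ξ ^ σ * ramp N ξ

lemma weight_pos {N : ℝ} (hN : 1 ≤ N) (σ ξ : ℝ) : 0 < weight σ N ξ :=
  mul_pos (jap_rpow_pos σ ξ) (ramp_pos hN ξ)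

lemma measurable_weight (σ N : ℝ) : Measurable (weight σ N) :=
  (measurable_jap_rpow σ).mul (measurable_ramp N)

lemma weight_le {σ N : ℝ} (ξ : ℝ) : weight σ N ξ ≤ jap ξ ^ σ :=
  mul_le_of_le_one_right (jap_rpow_pos σ ξ).le (ramp_le_one N ξ)

lemma weight_one (σ : ℝ) : weight σ 1 = fun ξ ↦ jap ξ ^ σ := by
  ext ξ; simp [weight, ramp_one]

lemma enorm_ofReal' (x : ℝ) : ‖(x : ℂ)‖ₑ = ‖x‖ₑ := by
  rw [← ofReal_norm, Complex.norm_real, ofReal_norm]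

/-- The integrand of the energy form of the transport term, as a function of the frequencies `ξ`
of the test function and `ζ` of the transported function. -/
def transportKernel (m : ℝ → ℝ) (f y : ℝ → ℂ) (p : ℝ × ℝ) : ℂ :=
  (m p.1 : ℂ) * (f (p.1 - p.2) * y p.2) * (starRingEnd ℂ) (y p.1)

lemma measurable_transportKernel {m : ℝ → ℝ} {f y : ℝ → ℂ} (hm : Measurable m)
    (hf : Measurable f) (hy : Measurable y) : Measurable (transportKernel m f y) := by
  unfold transportKernel
  have h1 : Measurable fun p : ℝ × ℝ ↦ f (p.1 - p.2) := hf.comp (measurable_fst.sub measurable_snd)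
  have h2 : Measurable fun p : ℝ × ℝ ↦ (starRingEnd ℂ) (y p.1) :=
    Complex.continuous_conj.measurable.comp (hy.comp measurable_fst)
  have h3 : Measurable fun p : ℝ × ℝ ↦ (m p.1 : ℂ) :=
    Complex.measurable_ofReal.comp (hm.comp measurable_fst)
  exact (h3.mul (h1.mul (hy.comp measurable_snd))).mul h2

/-- Absolute convergence, which justifies Fubini and the exchange of variables. One J^τ from the
bound on m goes to the convolution, where the algebra property applies, and the other to the
remaining copy of y. -/
lemma integrable_transportKernel {τ : ℝ} (hτ : 1 / 2 < τ) {m : ℝ → ℝ} {f y : ℝ → ℂ}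
    (hm : Measurable m) (hf : Measurable f) (hy : Measurable y)
    (hmτ : ∀ ξ, |m ξ| ≤ jap ξ ^ τ * jap ξ ^ τ)
    (hfτ : wnorm (fun ξ ↦ jap ξ ^ τ) f < ∞) (hyτ : wnorm (fun ξ ↦ jap ξ ^ τ) y < ∞) :
    Integrable (transportKernel m f y) (volume.prod volume) := by
  refine ⟨(measurable_transportKernel hm hf hy).aestronglyMeasurable, ?_⟩
  rw [hasFiniteIntegral_iff_enorm,
    lintegral_prod _ (measurable_transportKernel hm hf hy).enorm.aemeasurable]
  have hl := measurable_lconv hf.enorm hy.enorm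
  have hj : Measurable fun ξ ↦ ENNReal.ofReal (jap ξ ^ τ) := (measurable_jap_rpow τ).ennreal_ofReal
  calc ∫⁻ ξ, ∫⁻ ζ, ‖transportKernel m f y (ξ, ζ)‖ₑ
      = ∫⁻ ξ, ‖m ξ‖ₑ * lconv (fun ξ ↦ ‖f ξ‖ₑ) (fun ξ ↦ ‖y ξ‖ₑ) ξ * ‖y ξ‖ₑ := by
        refine lintegral_congr fun ξ ↦ ?_
        have m1 : Measurable fun ζ ↦ ‖f (ξ - ζ)‖ₑ * ‖y ζ‖ₑ :=
          (hf.comp (measurable_const.sub measurable_id)).enorm.mul hy.enorm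
        rw [lconv, ← lintegral_const_mul _ m1, ← lintegral_mul_const _ (m1.const_mul _)]
        refine lintegral_congr fun ζ ↦ ?_
        simp only [transportKernel, enorm_mul, RCLike.enorm_conj, enorm_ofReal']
    _ ≤ ∫⁻ ξ, (ENNReal.ofReal (jap ξ ^ τ) * lconv (fun ξ ↦ ‖f ξ‖ₑ) (fun ξ ↦ ‖y ξ‖ₑ) ξ) *
          mag (fun ξ ↦ jap ξ ^ τ) y ξ := by
        refine lintegral_mono fun ξ ↦ ?_
        have : ‖m ξ‖ₑ ≤ ENNReal.ofReal (jap ξ ^ τ) * ENNReal.ofReal (jap ξ ^ τ) := by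
          rw [← ENNReal.ofReal_mul (jap_rpow_pos _ _).le, ← ofReal_norm]
          exact ENNReal.ofReal_le_ofReal (hmτ ξ)
        calc _ ≤ ENNReal.ofReal (jap ξ ^ τ) * ENNReal.ofReal (jap ξ ^ τ) *
              lconv (fun ξ ↦ ‖f ξ‖ₑ) (fun ξ ↦ ‖y ξ‖ₑ) ξ * ‖y ξ‖ₑ := by gcongr
          _ = _ := by rw [mag]; ring
    _ ≤ _ := lintegral_mul_le_eLpNorm (hj.mul hl) (measurable_mag (measurable_jap_rpow _) hy)
    _ < ∞ := by
        rw [← wnorm_eq fun ξ ↦ (jap_rpow_pos _ _).le]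
        refine ENNReal.mul_lt_top ((eLpNorm_mul_lconv_le hτ hf hy).trans_lt ?_) hyτ
        exact ENNReal.mul_lt_top (ENNReal.mul_lt_top ENNReal.ofReal_lt_top
          (ENNReal.mul_lt_top (by norm_num) ENNReal.coe_lt_top)) (ENNReal.mul_lt_top hfτ hyτ)

lemma integral_conv_mul_conj {m : ℝ → ℝ} {f y : ℝ → ℂ}
    (hi : Integrable (transportKernel m f y) (volume.prod volume)) :
    ∫ ξ, (m ξ : ℂ) * conv f y ξ * (starRingEnd ℂ) (y ξ) =
      ∫ p, transportKernel m f y p ∂(volume.prod volume) := by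
  rw [integral_prod _ hi]
  refine integral_congr_ae (ae_of_all _ fun ξ ↦ ?_)
  simp only [transportKernel, conv]
  rw [integral_mul_const, integral_const_mul]

lemma integrable_conv_mul_conj {m : ℝ → ℝ} {f y : ℝ → ℂ}
    (hi : Integrable (transportKernel m f y) (volume.prod volume)) :
    Integrable fun ξ ↦ (m ξ : ℂ) * conv f y ξ * (starRingEnd ℂ) (y ξ) := by
  refine hi.integral_prod_left.congr (ae_of_all _ fun ξ ↦ ?_)
  simp only [transportKernel, conv]
  rw [integral_mul_const, integral_const_mul]

/-- Symmetrization of the transport term by means of the Hermitian symmetry of `f`. -/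
lemma enorm_im_integral_conv_le {m : ℝ → ℝ} {f y : ℝ → ℂ} (hf : Measurable f) (hh : IsHerm f)
    (hi : Integrable (transportKernel m f y) (volume.prod volume)) :
    ‖(∫ ξ, (m ξ : ℂ) * conv f y ξ * (starRingEnd ℂ) (y ξ)).im‖ₑ ≤
      ∫⁻ p : ℝ × ℝ, ‖m p.1 - m p.2‖ₑ * (‖f (p.1 - p.2)‖ₑ * ‖y p.2‖ₑ) * ‖y p.1‖ₑ
        ∂(volume.prod volume) := by
  rw [integral_conv_mul_conj hi]
  set G := transportKernel m f y with hG
  set G' : ℝ × ℝ → ℂ := fun p ↦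
    (m p.2 : ℂ) * (f (p.1 - p.2) * y p.2) * (starRingEnd ℂ) (y p.1) with hG'
  -- Exchanging the two frequencies and conjugating reproduces the kernel, except that m is
  -- evaluated at the other frequency; this uses f(ζ-ξ) = conj f(ξ-ζ).
  have e1 : (fun p ↦ (starRingEnd ℂ) (G p.swap)) =ᵐ[volume.prod volume] G' := by
    filter_upwards [hh.ae_prod hf] with p hp
    simp only [hG, hG', transportKernel, Prod.fst_swap, Prod.snd_swap, map_mul, Complex.conj_conj,
      Complex.conj_ofReal, hp]
    ring
  have i1 : Integrable (fun p ↦ (starRingEnd ℂ) (G p.swap)) (volume.prod volume) :=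
    (LinearIsometryEquiv.integrable_comp_iff Complex.conjLIE).2 hi.swap
  have e2 : (starRingEnd ℂ) (∫ p, G p ∂(volume.prod volume)) =
      ∫ p, G' p ∂(volume.prod volume) := by
    rw [← integral_congr_ae e1, integral_conj, integral_prod_swap G]
  have i2 : Integrable G' (volume.prod volume) := i1.congr e1
  set I := ∫ p, G p ∂(volume.prod volume) with hI
  have e3 : I - (starRingEnd ℂ) I = ∫ p, (G p - G' p) ∂(volume.prod volume) := by
    rw [e2, integral_sub hi i2]
  have e4 : ‖I.im‖ ≤ ‖I - (starRingEnd ℂ) I‖ := by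
    have : I - (starRingEnd ℂ) I = ((2 * I.im : ℝ) : ℂ) * Complex.I := by
      rw [Complex.sub_conj]
    rw [this, norm_mul, Complex.norm_I, mul_one, Complex.norm_real, norm_mul]
    norm_num
    linarith [abs_nonneg I.im]
  calc ‖I.im‖ₑ ≤ ‖I - (starRingEnd ℂ) I‖ₑ := by
        rw [← ofReal_norm, ← ofReal_norm]
        exact ENNReal.ofReal_le_ofReal e4
    _ ≤ ∫⁻ p, ‖G p - G' p‖ₑ ∂(volume.prod volume) := by
        rw [e3]; exact enorm_integral_le_lintegral_enorm _
    _ = _ := by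
        refine lintegral_congr fun p ↦ ?_
        have : G p - G' p = ((m p.1 - m p.2 : ℝ) : ℂ) * (f (p.1 - p.2) * y p.2) *
            (starRingEnd ℂ) (y p.1) := by
          simp only [hG, hG', transportKernel]; push_cast; ring
        rw [this]
        simp only [enorm_mul, RCLike.enorm_conj]
        congr 2
        exact enorm_ofReal' _

/-- After symmetrization the kernel contains the commutator symbol k V², so no derivative falls on
y. Two pieces remain: one pairs the full norm of f with the ramped norm of y, the other the ramped
norm of f with the full norm of y. Hence every term is quadratic in ramped quantities, and tails are
controlled by tails. -/
theorem exists_transport_estimate {s σ : ℝ} (hs : 3 / 2 < s) (hσ : -1 / 2 < σ) (hσs : σ ≤ s - 1) :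
    ∃ C : ℝ≥0, ∀ N : ℝ, 1 ≤ N → ∀ f y : ℝ → ℂ, Measurable f → Measurable y → IsHerm f →
      wnorm (fun ξ ↦ jap ξ ^ (σ + 1)) f < ∞ → wnorm (fun ξ ↦ jap ξ ^ (σ + 1)) y < ∞ →
      ‖(∫ ξ, ((freq ξ * weight σ N ξ ^ 2 : ℝ) : ℂ) * conv f y ξ *
        (starRingEnd ℂ) (y ξ)).im‖ₑ ≤
        C * (wnorm (fun ξ ↦ jap ξ ^ s) f * wnorm (weight σ N) y +
          wnorm (weight s N) f * wnorm (fun ξ ↦ jap ξ ^ σ) y) * wnorm (weight σ N) y := by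
  obtain ⟨C, hC0, hC⟩ := exists_commutator_bound s σ (by linarith) hσs
  refine ⟨C.toNNReal * (2 * embConst (s - 1)), fun N hN f y hf hy hh hf1 hy1 ↦ ?_⟩
  have hm : Measurable fun ξ ↦ freq ξ * weight σ N ξ ^ 2 :=
    continuous_freq.measurable.mul ((measurable_weight σ N).pow_const 2)
  have hi : Integrable (transportKernel (fun ξ ↦ freq ξ * weight σ N ξ ^ 2) f y)
      (volume.prod volume) := by
    -- The norms of order σ + 1 serve only here, for absolute convergence, and do not enter the
    -- constant. The requirement σ + 1 > 1/2 is the hypothesis on σ.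
    refine integrable_transportKernel (τ := σ + 1) (by linarith) hm hf hy (fun ξ ↦ ?_) hf1 hy1
    have h1 := weight_le (σ := σ) (N := N) ξ
    have h2 := (weight_pos hN σ ξ).le
    have h3 := one_le_jap ξ
    have h4 := jap_rpow_pos σ ξ
    rw [abs_mul, abs_of_nonneg (sq_nonneg (weight σ N ξ)), Real.rpow_add_one (jap_pos ξ).ne']
    calc |freq ξ| * weight σ N ξ ^ 2 ≤ jap ξ * (jap ξ ^ σ) ^ 2 := by
          gcongr; exact abs_freq_le_jap ξ
      _ ≤ jap ξ * (jap ξ ^ σ) ^ 2 * jap ξ := by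
          exact le_mul_of_one_le_right (by positivity) h3
      _ = _ := by ring
  refine (enorm_im_integral_conv_le hf hh hi).trans ?_
  set F₁ := mag (fun ξ ↦ jap ξ ^ (1 : ℝ)) f with hF₁
  set F₂ := mag (weight s N) f with hF₂
  set Y₁ := mag (weight σ N) y with hY₁
  set Y₂ := mag (fun ξ ↦ jap ξ ^ (σ + 1 - s)) y with hY₂
  have mF₁ : Measurable F₁ := measurable_mag (measurable_jap_rpow _) hf
  have mF₂ : Measurable F₂ := measurable_mag (measurable_weight _ _) hf
  have mY₁ : Measurable Y₁ := measurable_mag (measurable_weight _ _) hy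
  have mY₂ : Measurable Y₂ := measurable_mag (measurable_jap_rpow _) hy
  have wp : ∀ σ ξ : ℝ, 0 ≤ weight σ N ξ := fun σ ξ ↦ (weight_pos hN σ ξ).le
  have jp : ∀ σ ξ : ℝ, 0 ≤ jap ξ ^ σ := fun σ ξ ↦ (jap_rpow_pos σ ξ).le
  have pt : ∀ ξ ζ, ‖freq ξ * weight σ N ξ ^ 2 - freq ζ * weight σ N ζ ^ 2‖ₑ *
      (‖f (ξ - ζ)‖ₑ * ‖y ζ‖ₑ) * ‖y ξ‖ₑ ≤ C.toNNReal * (F₁ (ξ - ζ) * Y₁ ζ * Y₁ ξ +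
        (F₂ (ξ - ζ) * Y₂ ζ * Y₁ ξ + F₂ (ξ - ζ) * Y₁ ζ * Y₂ ξ)) := by
    intro ξ ζ
    have h := hC N (freq ξ) (freq ζ) (jap ξ) (jap ζ) (jap (ξ - ζ)) hN (one_le_jap _) (one_le_jap _)
      (one_le_jap _) (abs_freq_le_jap _) (abs_freq_le_jap _)
      (by rw [← freq_sub]; exact abs_freq_le_jap _) (jap_le_add ξ ζ) (jap_le_add' ξ ζ)
    have e : ∀ σ ξ : ℝ, jap ξ ^ σ * rampFun N (jap ξ) = weight σ N ξ := fun _ _ ↦ rfl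
    simp only [e] at h
    have h' := ENNReal.ofReal_le_ofReal h
    have p1 := wp σ ξ
    have p2 := wp σ ζ
    have p3 := wp s (ξ - ζ)
    have p4 := jp (σ + 1 - s) ξ
    have p5 := jp (σ + 1 - s) ζ
    have p6 := (jap_pos (ξ - ζ)).le
    rw [← Real.norm_eq_abs, ofReal_norm, ENNReal.ofReal_mul hC0,
      ENNReal.ofReal_add (by positivity) (by positivity), ENNReal.ofReal_mul (by positivity),
      ENNReal.ofReal_mul (by positivity), ENNReal.ofReal_mul (by positivity),
      ENNReal.ofReal_add (by positivity) (by positivity), ENNReal.ofReal_mul (by positivity),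
      ENNReal.ofReal_mul (by positivity)] at h'
    refine (mul_assoc _ _ _).le.trans
      ((mul_le_mul_left h' (‖f (ξ - ζ)‖ₑ * ‖y ζ‖ₑ * ‖y ξ‖ₑ)).trans_eq ?_)
    simp only [hF₁, hF₂, hY₁, hY₂, mag, Real.rpow_one, ENNReal.ofReal]
    ring
  -- In each trilinear form a different slot is taken in L¹: J f in the first, J^{σ+1-s} y in the
  -- second and in the third.
  have T1 := lintegral_lconv_mul_le mF₁ mY₁ mY₁
  have T2 := lintegral_lconv_mul_le' mF₂ mY₂ mY₁
  have T3 := lintegral_lconv_mul_le'' mF₂ mY₁ mY₂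
  have L1 : ∫⁻ ξ, F₁ ξ ≤ embConst (s - 1) * wnorm (fun ξ ↦ jap ξ ^ s) f :=
    lintegral_mag_le (by linarith) (by ring) hf
  have L2 : ∫⁻ ξ, Y₂ ξ ≤ embConst (s - 1) * wnorm (fun ξ ↦ jap ξ ^ σ) y :=
    lintegral_mag_le (by linarith) (by ring) hy
  have it : ∀ p q r : ℝ → ℝ≥0∞, Measurable p → Measurable q →
      ∫⁻ ξ, ∫⁻ ζ, p (ξ - ζ) * q ζ * r ξ = ∫⁻ ξ, lconv p q ξ * r ξ := fun p q r hp hq ↦ by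
    refine lintegral_congr fun ξ ↦ ?_
    have h1 : Measurable fun ζ ↦ p (ξ - ζ) * q ζ :=
      (hp.comp (measurable_const.sub measurable_id)).mul hq
    rw [lconv, lintegral_mul_const _ h1]
  have mk : ∀ p q r : ℝ → ℝ≥0∞, Measurable p → Measurable q → Measurable r →
      Measurable fun x : ℝ × ℝ ↦ p (x.1 - x.2) * q x.2 * r x.1 := fun p q r hp hq hr ↦
    (measurable_lconv_kernel hp hq).mul (hr.comp measurable_fst)
  have k1 := mk _ _ _ mF₁ mY₁ mY₁
  have k2 := mk _ _ _ mF₂ mY₂ mY₁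
  have k3 := mk _ _ _ mF₂ mY₁ mY₂
  calc _ ≤ ∫⁻ x : ℝ × ℝ, C.toNNReal * (F₁ (x.1 - x.2) * Y₁ x.2 * Y₁ x.1 +
        (F₂ (x.1 - x.2) * Y₂ x.2 * Y₁ x.1 + F₂ (x.1 - x.2) * Y₁ x.2 * Y₂ x.1))
          ∂(volume.prod volume) := lintegral_mono fun x ↦ pt x.1 x.2
    _ = C.toNNReal * ((∫⁻ ξ, lconv F₁ Y₁ ξ * Y₁ ξ) + ((∫⁻ ξ, lconv F₂ Y₂ ξ * Y₁ ξ) +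
        ∫⁻ ξ, lconv F₂ Y₁ ξ * Y₂ ξ)) := by
        have k23 : Measurable fun x : ℝ × ℝ ↦ F₂ (x.1 - x.2) * Y₂ x.2 * Y₁ x.1 +
          F₂ (x.1 - x.2) * Y₁ x.2 * Y₂ x.1 := k2.add k3
        have k123 : Measurable fun x : ℝ × ℝ ↦ F₁ (x.1 - x.2) * Y₁ x.2 * Y₁ x.1 +
          (F₂ (x.1 - x.2) * Y₂ x.2 * Y₁ x.1 +
          F₂ (x.1 - x.2) * Y₁ x.2 * Y₂ x.1) := k1.add k23
        rw [lintegral_const_mul _ k123, lintegral_add_left k1, lintegral_add_left k2,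
          lintegral_prod _ k1.aemeasurable, lintegral_prod _ k2.aemeasurable,
          lintegral_prod _ k3.aemeasurable, it _ _ _ mF₁ mY₁, it _ _ _ mF₂ mY₂, it _ _ _ mF₂ mY₁]
    _ ≤ C.toNNReal * (embConst (s - 1) * wnorm (fun ξ ↦ jap ξ ^ s) f * wnorm (weight σ N) y *
          wnorm (weight σ N) y + (wnorm (weight s N) f * (embConst (s - 1) *
          wnorm (fun ξ ↦ jap ξ ^ σ) y) * wnorm (weight σ N) y + wnorm (weight s N) f *
          wnorm (weight σ N) y * (embConst (s - 1) * wnorm (fun ξ ↦ jap ξ ^ σ) y))) := by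
        rw [wnorm_eq (wp σ) y, wnorm_eq (wp s) f]
        gcongr
        · exact T1.trans (by gcongr)
        · exact T2.trans (by gcongr)
        · exact T3.trans (by gcongr)
    _ = C.toNNReal * embConst (s - 1) * (wnorm (fun ξ ↦ jap ξ ^ s) f * wnorm (weight σ N) y +
          2 * (wnorm (weight s N) f * wnorm (fun ξ ↦ jap ξ ^ σ) y)) * wnorm (weight σ N) y := by
        ring
    _ ≤ C.toNNReal * embConst (s - 1) * (2 * (wnorm (fun ξ ↦ jap ξ ^ s) f * wnorm (weight σ N) y) +
          2 * (wnorm (weight s N) f * wnorm (fun ξ ↦ jap ξ ^ σ) y)) * wnorm (weight σ N) y := by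
        have h2 : ∀ x : ℝ≥0∞, x ≤ 2 * x := fun x ↦ le_mul_of_one_le_left zero_le one_le_two
        exact mul_le_mul' (mul_le_mul' le_rfl (add_le_add (h2 _) le_rfl)) le_rfl
    _ = _ := by push_cast; ring

/-! ### Multiplication operators on the frequency side -/

/-- The complex space `L²(ℝ)`, in which Fourier transforms live. -/
abbrev H : Type := Lp ℂ 2 (volume : Measure ℝ)

lemma measurable_coe (a : H) : Measurable (a : ℝ → ℂ) := (Lp.stronglyMeasurable a).measurable

/-- Real symbols that are measurable and bounded by `C`. -/
def IsMult (m : ℝ → ℝ) (C : ℝ) : Prop := Measurable m ∧ ∀ ξ, |m ξ| ≤ C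

lemma IsMult.memLp {m : ℝ → ℝ} {C : ℝ} (h : IsMult m C) (a : H) :
    MemLp (fun ξ ↦ m ξ • a ξ) 2 volume := by
  refine MemLp.of_le_mul (c := C) (Lp.memLp a) ?_ (ae_of_all _ fun ξ ↦ ?_)
  · exact (h.1.smul (measurable_coe a)).aestronglyMeasurable
  · rw [norm_smul]; exact mul_le_mul_of_nonneg_right (h.2 ξ) (norm_nonneg _)

/-- Multiplication by a bounded measurable real symbol `m` (zero for other `m`). -/
def mulOp (m : ℝ → ℝ) : H →L[ℂ] H :=
  open Classical in
  if h : ∃ C, IsMult m C then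
    LinearMap.mkContinuous
      { toFun := fun a ↦ (h.choose_spec.memLp a).toLp
        map_add' := fun a b ↦ by
          refine Lp.ext ?_
          filter_upwards [(h.choose_spec.memLp (a + b)).coeFn_toLp,
            (h.choose_spec.memLp a).coeFn_toLp, (h.choose_spec.memLp b).coeFn_toLp,
            Lp.coeFn_add a b, Lp.coeFn_add (h.choose_spec.memLp a).toLp
              (h.choose_spec.memLp b).toLp] with ξ h1 h2 h3 h4 h5
          rw [h1, h5, Pi.add_apply, h2, h3, h4, Pi.add_apply, smul_add]
        map_smul' := fun c a ↦ by
          refine Lp.ext ?_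
          filter_upwards [(h.choose_spec.memLp (c • a)).coeFn_toLp,
            (h.choose_spec.memLp a).coeFn_toLp, Lp.coeFn_smul c a,
            Lp.coeFn_smul c (h.choose_spec.memLp a).toLp] with ξ h1 h2 h3 h4
          rw [h1, RingHom.id_apply, h4, Pi.smul_apply, h2, h3, Pi.smul_apply, smul_comm] }
      h.choose fun a ↦ by
        refine Lp.norm_le_mul_norm_of_ae_le_mul ?_
        filter_upwards [(h.choose_spec.memLp a).coeFn_toLp] with ξ h1
        rw [LinearMap.coe_mk, AddHom.coe_mk, h1, norm_smul]
        exact mul_le_mul_of_nonneg_right (h.choose_spec.2 ξ) (norm_nonneg _)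
  else 0

lemma mulOp_ae {m : ℝ → ℝ} {C : ℝ} (h : IsMult m C) (a : H) :
    mulOp m a =ᵐ[volume] fun ξ ↦ m ξ • a ξ := by
  have h' : ∃ C, IsMult m C := ⟨C, h⟩
  rw [mulOp, dif_pos h']
  exact (h'.choose_spec.memLp a).coeFn_toLp

lemma enorm_mulOp {m : ℝ → ℝ} {C : ℝ} (h : IsMult m C) (a : H) : ‖mulOp m a‖ₑ = wnorm m a := by
  rw [Lp.enorm_def, wnorm]
  exact eLpNorm_congr_ae (mulOp_ae h a)

lemma norm_mulOp_le_norm_mulOp {m m' : ℝ → ℝ} {C C' : ℝ} (h : IsMult m C) (h' : IsMult m' C')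
    (hm : ∀ ξ, |m ξ| ≤ |m' ξ|) (a : H) : ‖mulOp m a‖ ≤ ‖mulOp m' a‖ := by
  refine Lp.norm_le_norm_of_ae_le ?_
  filter_upwards [mulOp_ae h a, mulOp_ae h' a] with ξ h1 h2
  rw [h1, h2, norm_smul, norm_smul]
  exact mul_le_mul_of_nonneg_right (hm ξ) (norm_nonneg _)

lemma norm_mulOp_le {m : ℝ → ℝ} {C : ℝ} (h : IsMult m C) (a : H) : ‖mulOp m a‖ ≤ C * ‖a‖ := by
  refine Lp.norm_le_mul_norm_of_ae_le_mul ?_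
  filter_upwards [mulOp_ae h a] with ξ h1
  rw [h1, norm_smul]
  exact mul_le_mul_of_nonneg_right (h.2 ξ) (norm_nonneg _)

lemma IsMult.mul {m m' : ℝ → ℝ} {C C' : ℝ} (h : IsMult m C) (h' : IsMult m' C') :
    IsMult (fun ξ ↦ m ξ * m' ξ) (C * C') := by
  refine ⟨h.1.mul h'.1, fun ξ ↦ ?_⟩
  rw [abs_mul]
  exact mul_le_mul (h.2 ξ) (h'.2 ξ) (abs_nonneg _) ((abs_nonneg _).trans (h.2 ξ))

lemma mulOp_mulOp {m m' : ℝ → ℝ} {C C' : ℝ} (h : IsMult m C) (h' : IsMult m' C') (a : H) :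
    mulOp m (mulOp m' a) = mulOp (fun ξ ↦ m ξ * m' ξ) a := by
  refine Lp.ext ?_
  filter_upwards [mulOp_ae h (mulOp m' a), mulOp_ae h' a, mulOp_ae (h.mul h') a] with ξ h1 h2 h3
  rw [h1, h2, h3, mul_smul]

lemma mulOp_comm {m m' : ℝ → ℝ} {C C' : ℝ} (h : IsMult m C) (h' : IsMult m' C') (a : H) :
    mulOp m (mulOp m' a) = mulOp m' (mulOp m a) := by
  rw [mulOp_mulOp h h', mulOp_mulOp h' h]; simp only [mul_comm]

/-- `J⁻¹`. -/
def invJap (ξ : ℝ) : ℝ := (jap ξ)⁻¹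

lemma isMult_invJap : IsMult invJap 1 := by
  refine ⟨measurable_jap.inv, fun ξ ↦ ?_⟩
  rw [invJap, abs_of_pos (inv_pos.2 (jap_pos ξ))]
  exact inv_le_one_of_one_le₀ (one_le_jap ξ)

/-- The symbol `k J^{-j}`, `k` being the frequency. -/
def freqSymb (j : ℕ) (ξ : ℝ) : ℝ := freq ξ / jap ξ ^ j

lemma isMult_freqSymb {j : ℕ} (hj : 1 ≤ j) : IsMult (freqSymb j) 1 := by
  refine ⟨continuous_freq.measurable.div (measurable_jap.pow_const j), fun ξ ↦ ?_⟩
  rw [freqSymb, abs_div, abs_of_pos (pow_pos (jap_pos ξ) j), div_le_one (pow_pos (jap_pos ξ) j)]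
  exact (abs_freq_le_jap ξ).trans (le_self_pow₀ (one_le_jap ξ) (by omega))

lemma isMult_ramp {N : ℝ} (hN : 1 ≤ N) : IsMult (ramp N) 1 :=
  ⟨measurable_ramp N, fun ξ ↦ by rw [abs_of_pos (ramp_pos hN ξ)]; exact ramp_le_one N ξ⟩

/-- The symbol of the projection to the frequencies with `J ≤ n`. -/
def cutoff (n ξ : ℝ) : ℝ := open Classical in if jap ξ ≤ n then 1 else 0

lemma isMult_cutoff (n : ℝ) : IsMult (cutoff n) 1 := by
  refine ⟨Measurable.ite (measurableSet_le measurable_jap measurable_const) measurable_const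
    measurable_const, fun ξ ↦ ?_⟩
  unfold cutoff; split_ifs <;> simp

lemma cutoff_mul_self (n ξ : ℝ) : cutoff n ξ * cutoff n ξ = cutoff n ξ := by
  unfold cutoff; split_ifs <;> simp

lemma mulOp_cutoff_idem (n : ℝ) (a : H) :
    mulOp (cutoff n) (mulOp (cutoff n) a) = mulOp (cutoff n) a := by
  rw [mulOp_mulOp (isMult_cutoff n) (isMult_cutoff n)]; simp only [cutoff_mul_self]

/-- The symbol `J` restricted to the frequencies with `J ≤ n`. -/
def cutJap (n ξ : ℝ) : ℝ := cutoff n ξ * jap ξ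

lemma isMult_cutJap (n : ℝ) : IsMult (cutJap n) |n| := by
  refine ⟨(isMult_cutoff n).1.mul measurable_jap, fun ξ ↦ ?_⟩
  unfold cutJap cutoff
  split_ifs with h
  · rw [one_mul, abs_of_pos (jap_pos ξ)]; exact h.trans (le_abs_self n)
  · simp

lemma cutJap_mul_invJap (n ξ : ℝ) : cutJap n ξ * invJap ξ = cutoff n ξ := by
  rw [cutJap, invJap, mul_assoc, mul_inv_cancel₀ (jap_pos ξ).ne', mul_one]

/-! ### The product as a bilinear operator -/

/-- The function `J^{-τ} a`. -/
def low (τ : ℝ) (a : ℝ → ℂ) (ξ : ℝ) : ℂ := jap ξ ^ (-τ) • a ξ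

lemma measurable_low (τ : ℝ) {a : ℝ → ℂ} (ha : Measurable a) : Measurable (low τ a) :=
  (measurable_jap_rpow _).smul ha

lemma smul_low (c τ : ℝ) (a : ℝ → ℂ) (ξ : ℝ) :
    c • low τ a ξ = (c * jap ξ ^ (-τ)) • a ξ := by rw [low, mul_smul]

lemma wnorm_low (τ : ℝ) (a : H) : wnorm (fun ξ ↦ jap ξ ^ τ) (low τ a) = ‖a‖ₑ := by
  rw [Lp.enorm_def, wnorm]
  congr 1; ext ξ
  rw [smul_low, ← Real.rpow_add (jap_pos ξ)]; simp

lemma isMult_jap_rpow_neg {τ : ℝ} (hτ : 0 ≤ τ) : IsMult (fun ξ ↦ jap ξ ^ (-τ)) 1 :=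
  ⟨measurable_jap_rpow _, fun ξ ↦ by
    rw [abs_of_pos (jap_rpow_pos _ _)]
    exact Real.rpow_le_one_of_one_le_of_nonpos (one_le_jap ξ) (by linarith)⟩

lemma memLp_low {τ : ℝ} (hτ : 0 ≤ τ) (a : H) : MemLp (low τ a) 2 volume :=
  (isMult_jap_rpow_neg hτ).memLp a

/-- The norm of the product in `H^τ`. -/
def algConst (τ : ℝ) : ℝ := 2 ^ τ * (2 * embConst τ)

lemma algConst_nonneg (τ : ℝ) : 0 ≤ algConst τ := by unfold algConst; positivity

lemma eLpNorm_alg_le {τ : ℝ} (hτ : 1 / 2 < τ) (a b : H) :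
    eLpNorm (fun ξ ↦ jap ξ ^ τ • conv (low τ a) (low τ b) ξ) 2 volume ≤
      ENNReal.ofReal (algConst τ * ‖a‖ * ‖b‖) := by
  have h := wnorm_conv_le hτ (measurable_low τ (measurable_coe a))
    (measurable_low τ (measurable_coe b))
  rw [wnorm_low, wnorm_low] at h
  refine h.trans_eq ?_
  rw [algConst, mul_assoc _ ‖a‖, ENNReal.ofReal_mul (by positivity),
    ENNReal.ofReal_mul (by positivity), ENNReal.ofReal_mul (by positivity),
    ENNReal.ofReal_mul (by positivity), ofReal_norm, ofReal_norm]
  simp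

lemma memLp_alg {τ : ℝ} (hτ : 1 / 2 < τ) (a b : H) :
    MemLp (fun ξ ↦ jap ξ ^ τ • conv (low τ a) (low τ b) ξ) 2 volume :=
  ⟨((measurable_jap_rpow τ).smul (measurable_conv (measurable_low τ (measurable_coe a))
    (measurable_low τ (measurable_coe b)))).aestronglyMeasurable,
    (eLpNorm_alg_le hτ a b).trans_lt ENNReal.ofReal_lt_top⟩

lemma low_congr {τ : ℝ} {a b : ℝ → ℂ} (h : a =ᵐ[volume] b) : low τ a =ᵐ[volume] low τ b :=
  h.mono fun ξ hξ ↦ by simp only [low, hξ]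

lemma conv_add {f g g' : ℝ → ℂ} (hf : MemLp f 2 volume) (hg : MemLp g 2 volume)
    (hg' : MemLp g' 2 volume) (ξ : ℝ) : conv f (g + g') ξ = conv f g ξ + conv f g' ξ := by
  unfold conv
  rw [← integral_add (integrable_conv hf hg ξ) (integrable_conv hf hg' ξ)]
  simp only [Pi.add_apply, mul_add]

lemma conv_smul (f g : ℝ → ℂ) (c : ℂ) (ξ : ℝ) : conv f (c • g) ξ = c * conv f g ξ := by
  unfold conv
  rw [← integral_const_mul]
  congr 1; ext ζ
  simp only [Pi.smul_apply, smul_eq_mul]; ring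

lemma conv_low_add {τ : ℝ} (hτ : 1 / 2 < τ) (a b b' : H) (ξ : ℝ) :
    conv (low τ a) (low τ (b + b' : H)) ξ =
      conv (low τ a) (low τ b) ξ + conv (low τ a) (low τ b') ξ := by
  have h0 : 0 ≤ τ := by linarith
  rw [← conv_add (memLp_low h0 a) (memLp_low h0 b) (memLp_low h0 b')]
  refine conv_congr .rfl ?_ ξ
  filter_upwards [Lp.coeFn_add b b'] with ζ h
  simp only [low, h, Pi.add_apply, smul_add]

lemma conv_low_smul {τ : ℝ} (a b : H) (c : ℂ) (ξ : ℝ) :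
    conv (low τ a) (low τ (c • b : H)) ξ = c * conv (low τ a) (low τ b) ξ := by
  rw [← conv_smul]
  refine conv_congr .rfl ?_ ξ
  filter_upwards [Lp.coeFn_smul c b] with ζ h
  simp only [low, h, Pi.smul_apply]
  rw [smul_comm]

lemma toLp_alg_add {τ : ℝ} (hτ : 1 / 2 < τ) (a b b' : H) :
    (memLp_alg hτ a (b + b')).toLp = (memLp_alg hτ a b).toLp + (memLp_alg hτ a b').toLp := by
  rw [← MemLp.toLp_add]
  refine MemLp.toLp_congr _ _ (ae_of_all _ fun ξ ↦ ?_)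
  simp only [Pi.add_apply, conv_low_add hτ, smul_add]

lemma toLp_alg_smul {τ : ℝ} (hτ : 1 / 2 < τ) (a b : H) (c : ℂ) :
    (memLp_alg hτ a (c • b)).toLp = c • (memLp_alg hτ a b).toLp := by
  rw [← MemLp.toLp_const_smul]
  refine MemLp.toLp_congr _ _ (ae_of_all _ fun ξ ↦ ?_)
  simp only [Pi.smul_apply, conv_low_smul, smul_eq_mul, Complex.real_smul]
  ring

lemma toLp_alg_comm {τ : ℝ} (hτ : 1 / 2 < τ) (a b : H) :
    (memLp_alg hτ a b).toLp = (memLp_alg hτ b a).toLp :=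
  MemLp.toLp_congr _ _ (ae_of_all _ fun ξ ↦ by simp only [conv_comm])

/-- The product of `H^τ`, `τ > 1/2`, in terms of `J^τ` times the Fourier transforms. -/
def algOp (τ : ℝ) (hτ : 1 / 2 < τ) : H →L[ℂ] H →L[ℂ] H :=
  LinearMap.mkContinuous₂
    (LinearMap.mk₂ ℂ (fun a b : H ↦ ((memLp_alg hτ a b).toLp : H))
      (fun a a' b ↦ by
        rw [toLp_alg_comm hτ, toLp_alg_add hτ, toLp_alg_comm hτ b a, toLp_alg_comm hτ b a'])
      (fun c a b ↦ by rw [toLp_alg_comm hτ, toLp_alg_smul hτ, toLp_alg_comm hτ b a])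
      (fun a b b' ↦ toLp_alg_add hτ a b b')
      (fun c a b ↦ toLp_alg_smul hτ a b c))
    (algConst τ) fun a b ↦ by
      rw [LinearMap.mk₂_apply, Lp.norm_toLp]
      exact ENNReal.toReal_le_of_le_ofReal
        (by have := algConst_nonneg τ; positivity) (eLpNorm_alg_le hτ a b)

lemma algOp_ae {τ : ℝ} (hτ : 1 / 2 < τ) (a b : H) :
    algOp τ hτ a b =ᵐ[volume] fun ξ ↦ jap ξ ^ τ • conv (low τ a) (low τ b) ξ :=
  (memLp_alg hτ a b).coeFn_toLp

lemma algOp_comm {τ : ℝ} (hτ : 1 / 2 < τ) (a b : H) : algOp τ hτ a b = algOp τ hτ b a :=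
  toLp_alg_comm hτ a b

lemma norm_algOp_le {τ : ℝ} (hτ : 1 / 2 < τ) (a b : H) :
    ‖algOp τ hτ a b‖ ≤ algConst τ * ‖a‖ * ‖b‖ := by
  change ‖(memLp_alg hτ a b).toLp‖ ≤ _
  rw [Lp.norm_toLp]
  exact ENNReal.toReal_le_of_le_ofReal
    (by have := algConst_nonneg τ; positivity) (eLpNorm_alg_le hτ a b)

/-! ### Hermitian symmetry -/

lemma IsHerm.congr {f g : ℝ → ℂ} (hf : IsHerm f) (h : f =ᵐ[volume] g) : IsHerm g := by
  filter_upwards [hf, h, (Measure.measurePreserving_neg (volume : Measure ℝ)).quasiMeasurePreserving.ae h]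
    with ξ h1 h2 h3
  rw [← h3, h1, h2]

lemma IsHerm.add {a b : H} (ha : IsHerm a) (hb : IsHerm b) : IsHerm (a + b : H) := by
  refine IsHerm.congr (f := fun ξ ↦ a ξ + b ξ) ?_ (Lp.coeFn_add a b).symm
  filter_upwards [ha, hb] with ξ h1 h2
  rw [h1, h2, map_add]

lemma IsHerm.smul_real {a : H} (c : ℝ) (ha : IsHerm a) : IsHerm (c • a : H) := by
  refine IsHerm.congr (f := fun ξ ↦ c • a ξ) ?_ (Lp.coeFn_smul c a).symm
  filter_upwards [ha] with ξ h1
  rw [h1, Complex.real_smul, Complex.real_smul, map_mul, Complex.conj_ofReal]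

lemma IsHerm.sub {a b : H} (ha : IsHerm a) (hb : IsHerm b) : IsHerm (a - b : H) := by
  have := ha.add (hb.smul_real (-1))
  simpa [sub_eq_add_neg] using this

lemma IsHerm.mulOp {m : ℝ → ℝ} {C : ℝ} (h : IsMult m C) (he : ∀ ξ, m (-ξ) = m ξ) {a : H}
    (ha : IsHerm a) : IsHerm (mulOp m a) := by
  refine IsHerm.congr (f := fun ξ ↦ m ξ • a ξ) ?_ (mulOp_ae h a).symm
  filter_upwards [ha] with ξ h1
  rw [h1, he, Complex.real_smul, Complex.real_smul, map_mul, Complex.conj_ofReal]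

lemma IsHerm.I_mulOp {m : ℝ → ℝ} {C : ℝ} (h : IsMult m C) (he : ∀ ξ, m (-ξ) = -m ξ) {a : H}
    (ha : IsHerm a) : IsHerm (Complex.I • FornbergWhitham.mulOp m a : H) := by
  refine IsHerm.congr (f := fun ξ ↦ Complex.I • (m ξ • a ξ)) ?_ ?_
  · filter_upwards [ha] with ξ h1
    rw [h1, he]
    simp
  · filter_upwards [mulOp_ae h a, Lp.coeFn_smul Complex.I (FornbergWhitham.mulOp m a)] with ξ h1 h2
    rw [h2, Pi.smul_apply, h1]

lemma IsHerm.low {f : ℝ → ℂ} (hf : IsHerm f) (τ : ℝ) : IsHerm (low τ f) := by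
  filter_upwards [hf] with ξ h1
  rw [FornbergWhitham.low, FornbergWhitham.low, h1, jap_neg, Complex.real_smul, Complex.real_smul,
    map_mul, Complex.conj_ofReal]

lemma IsHerm.conv {f g : ℝ → ℂ} (hf : IsHerm f) (hg : IsHerm g) : IsHerm (conv f g) := by
  refine ae_of_all _ fun ξ ↦ ?_
  unfold FornbergWhitham.conv
  rw [← integral_conj, ← integral_neg_eq_self]
  refine integral_congr_ae ?_
  filter_upwards [hg, (Measure.measurePreserving_sub_left volume ξ).quasiMeasurePreserving.ae hf]
    with ζ h1 h2
  rw [map_mul, h1, ← h2]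
  congr 2; ring

lemma IsHerm.algOp {τ : ℝ} (hτ : 1 / 2 < τ) {a b : H} (ha : IsHerm a) (hb : IsHerm b) :
    IsHerm (algOp τ hτ a b) := by
  refine IsHerm.congr ?_ (algOp_ae hτ a b).symm
  filter_upwards [(ha.low τ).conv (hb.low τ)] with ξ h1
  rw [h1, jap_neg, Complex.real_smul, Complex.real_smul, map_mul, Complex.conj_ofReal]

lemma memLp_reflect (a : H) : MemLp (fun ξ ↦ (starRingEnd ℂ) (a (-ξ))) 2 volume :=
  (((Lp.memLp a).comp_measurePreserving (Measure.measurePreserving_neg volume))).star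

/-- The reflection `a ↦ conj a(-·)`. -/
def reflect : H →L[ℝ] H :=
  LinearMap.mkContinuous
    { toFun := fun a ↦ (memLp_reflect a).toLp
      map_add' := fun a b ↦ by
        rw [← MemLp.toLp_add]
        refine MemLp.toLp_congr _ _ ?_
        filter_upwards [(Measure.measurePreserving_neg (volume : Measure ℝ)).quasiMeasurePreserving.ae
          (Lp.coeFn_add a b)] with ξ h
        rw [h, Pi.add_apply, Pi.add_apply, map_add]
      map_smul' := fun c a ↦ by
        rw [RingHom.id_apply, ← MemLp.toLp_const_smul]
        refine MemLp.toLp_congr _ _ ?_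
        filter_upwards [(Measure.measurePreserving_neg (volume : Measure ℝ)).quasiMeasurePreserving.ae
          (Lp.coeFn_smul c a)] with ξ h
        rw [h, Pi.smul_apply, Pi.smul_apply, Complex.real_smul, Complex.real_smul, map_mul,
          Complex.conj_ofReal] }
    1 fun a ↦ by
      rw [LinearMap.coe_mk, AddHom.coe_mk, Lp.norm_toLp, one_mul, Lp.norm_def]
      refine le_of_eq (congrArg ENNReal.toReal ?_)
      rw [← eLpNorm_comp_measurePreserving (Lp.aestronglyMeasurable a)
        (Measure.measurePreserving_neg volume)]
      exact eLpNorm_congr_norm_ae (ae_of_all _ fun ξ ↦ by simp)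

lemma reflect_ae (a : H) : reflect a =ᵐ[volume] fun ξ ↦ (starRingEnd ℂ) (a (-ξ)) :=
  (memLp_reflect a).coeFn_toLp

lemma isHerm_iff_reflect_eq (a : H) : IsHerm a ↔ reflect a = a := by
  constructor
  · intro h
    refine Lp.ext ?_
    filter_upwards [reflect_ae a, h] with ξ h1 h2
    rw [h1, h2, Complex.conj_conj]
  · intro h
    have := reflect_ae a
    rw [h] at this
    filter_upwards [this] with ξ h1
    rw [h1, Complex.conj_conj]

lemma reflect_reflect (a : H) : reflect (reflect a) = a := by
  refine Lp.ext ?_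
  filter_upwards [reflect_ae (reflect a),
    (Measure.measurePreserving_neg (volume : Measure ℝ)).quasiMeasurePreserving.ae (reflect_ae a)]
    with ξ h1 h2
  rw [h1, h2, neg_neg, Complex.conj_conj]

/-- The projection to the Hermitian functions. -/
def hermProj : H →L[ℝ] H := (1 / 2 : ℝ) • (ContinuousLinearMap.id ℝ H + reflect)

lemma hermProj_apply (a : H) : hermProj a = (1 / 2 : ℝ) • (a + reflect a) := rfl

lemma isHerm_hermProj (a : H) : IsHerm (hermProj a) := by
  rw [isHerm_iff_reflect_eq, hermProj_apply, map_smul, map_add, reflect_reflect, add_comm]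

lemma hermProj_eq {a : H} (ha : IsHerm a) : hermProj a = a := by
  rw [hermProj_apply, (isHerm_iff_reflect_eq a).1 ha, ← two_smul ℝ a, smul_smul]
  norm_num

lemma isClosed_isHerm : IsClosed {a : H | IsHerm a} := by
  simp only [isHerm_iff_reflect_eq]
  exact isClosed_eq reflect.continuous continuous_id

/-! ### The system on the frequency side -/

/-- The right-hand side of the equation of `u`, multiplied by `J^{s-1}`, on the frequency side;
`a` stands for `J^s û` and `b` for `J^{s-1} η̂`. -/
def fieldU {s : ℝ} (hs : 3 / 2 < s) (a b : H) : H :=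
  -(Complex.I / 2) • mulOp (freqSymb 1) (algOp s (by linarith) a a) +
    -- The multiplier of the linear terms is i k J⁻². In an equation at level J^{s-1}, the variable
    -- b already carries J^{s-1} while a carries J^s, hence the powers 2 and 3.
    (Complex.I • mulOp (freqSymb 2) b - Complex.I • mulOp (freqSymb 3) a)

/-- The right-hand side of the equation of `η`, multiplied by `J^{s-2}`, on the frequency side. -/
def fieldEta {s : ℝ} (hs : 3 / 2 < s) (a b : H) : H :=
  -Complex.I • mulOp (freqSymb 1) (algOp (s - 1) (by linarith) b (mulOp invJap a))

lemma exists_transport_bound {s σ : ℝ} (hs : 3 / 2 < s) (hσ : -1 / 2 < σ) (hσs : σ ≤ s - 1) :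
    ∃ C : ℝ, 0 ≤ C ∧ ∀ N : ℝ, 1 ≤ N → ∀ f y : ℝ → ℂ, Measurable f → Measurable y → IsHerm f →
      wnorm (fun ξ ↦ jap ξ ^ (σ + 1)) f < ∞ → wnorm (fun ξ ↦ jap ξ ^ (σ + 1)) y < ∞ →
      ∀ A B p r : ℝ, 0 ≤ A → 0 ≤ B → 0 ≤ p → 0 ≤ r →
      wnorm (fun ξ ↦ jap ξ ^ s) f ≤ ENNReal.ofReal A → wnorm (weight s N) f ≤ ENNReal.ofReal B →
      wnorm (weight σ N) y ≤ ENNReal.ofReal p →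
      wnorm (fun ξ ↦ jap ξ ^ σ) y ≤ ENNReal.ofReal r →
      |(∫ ξ, ((freq ξ * weight σ N ξ ^ 2 : ℝ) : ℂ) * conv f y ξ * (starRingEnd ℂ) (y ξ)).im| ≤
        C * (A * p + B * r) * p := by
  obtain ⟨C, hC⟩ := exists_transport_estimate hs hσ hσs
  refine ⟨C, C.coe_nonneg, fun N hN f y hf hy hh hf1 hy1 A B p r hA hB hp hr h1 h2 h3 h4 ↦ ?_⟩
  have h := hC N hN f y hf hy hh hf1 hy1
  rw [← Real.norm_eq_abs, ← ENNReal.ofReal_le_ofReal_iff (by positivity), ofReal_norm]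
  refine h.trans ?_
  rw [ENNReal.ofReal_mul (by positivity), ENNReal.ofReal_mul (by positivity),
    ENNReal.ofReal_add (by positivity) (by positivity), ENNReal.ofReal_mul hA,
    ENNReal.ofReal_mul hB, ENNReal.ofReal_coe_nnreal]
  gcongr

lemma real_inner_eq (x y : H) : inner ℝ x y = (∫ ξ, y ξ * (starRingEnd ℂ) (x ξ)).re := by
  have h : Integrable fun ξ ↦ y ξ * (starRingEnd ℂ) (x ξ) := L2.integrable_inner (𝕜 := ℂ) x y
  have h2 := integral_re h
  rw [L2.inner_def]
  simpa [Complex.inner] using h2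

/-- The factor -i coming from the derivative turns the real part of the pairing into the imaginary
part, which is the quantity controlled by symmetrization. -/
lemma real_inner_eq_of_ae {x y : H} {g : ℝ → ℂ} {c : ℝ}
    (h : ∀ᵐ ξ, y ξ * (starRingEnd ℂ) (x ξ) = (-Complex.I * c) * g ξ) :
    inner ℝ x y = c * (∫ ξ, g ξ).im := by
  rw [real_inner_eq, integral_congr_ae h, integral_const_mul]
  simp [Complex.mul_re, Complex.mul_im]

lemma low_invJap_ae (s : ℝ) (a : H) : low (s - 1) (mulOp invJap a) =ᵐ[volume] low s a := by
  filter_upwards [mulOp_ae isMult_invJap a] with ξ h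
  rw [low, h, low, smul_smul, invJap, ← Real.rpow_neg_one, ← Real.rpow_add (jap_pos ξ)]
  congr 2; ring

lemma wnorm_weight_low {N : ℝ} (hN : 1 ≤ N) (σ : ℝ) (a : H) :
    wnorm (weight σ N) (low σ a) = ENNReal.ofReal ‖mulOp (ramp N) a‖ := by
  rw [ofReal_norm, enorm_mulOp (isMult_ramp hN), wnorm, wnorm]
  congr 1; ext ξ
  rw [smul_low, weight, mul_right_comm, ← Real.rpow_add (jap_pos ξ)]; simp

lemma wnorm_jap_low (σ : ℝ) (a : H) :
    wnorm (fun ξ ↦ jap ξ ^ σ) (low σ a) = ENNReal.ofReal ‖a‖ := by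
  rw [ofReal_norm, wnorm_low]

lemma wnorm_jap_low_invJap (s : ℝ) (a : H) :
    wnorm (fun ξ ↦ jap ξ ^ (s - 1)) (low s a) = ENNReal.ofReal ‖mulOp invJap a‖ := by
  rw [← wnorm_congr (low_invJap_ae s a), wnorm_jap_low]

/-- `a` is supported in the frequencies with `J ≤ n`. -/
def IsBand (n : ℝ) (a : H) : Prop := mulOp (cutoff n) a = a

lemma IsBand.ae {n : ℝ} {a : H} (h : IsBand n a) : ∀ᵐ ξ, n < jap ξ → a ξ = 0 := by
  have := mulOp_ae (isMult_cutoff n) a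
  rw [h] at this
  filter_upwards [this] with ξ h1 h2
  rw [h1, cutoff, if_neg (not_le.2 h2), zero_smul]

lemma isBand_mulOp_cutoff (n : ℝ) (a : H) : IsBand n (mulOp (cutoff n) a) :=
  mulOp_cutoff_idem n a

/-- On the band J ≤ n an additional factor J is bounded. This supplies the qualitative finiteness
hypotheses of the transport estimate for truncated functions; n does not enter the resulting
constants. -/
lemma IsBand.wnorm_lt_top {n : ℝ} {a : H} (h : IsBand n a) {w : ℝ → ℝ}
    {f : ℝ → ℂ} (hw : ∀ ξ, ‖w ξ • f ξ‖ ≤ jap ξ * ‖a ξ‖) : wnorm w f < ∞ := by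
  have h1 : eLpNorm (fun ξ ↦ w ξ • f ξ) 2 volume ≤ eLpNorm (mulOp (cutJap n) a) 2 volume := by
    refine eLpNorm_mono_ae ?_
    filter_upwards [h.ae, mulOp_ae (isMult_cutJap n) a] with ξ h1 h2
    refine (hw ξ).trans ?_
    rw [h2, norm_smul]
    rcases lt_or_ge n (jap ξ) with h3 | h3
    · rw [h1 h3]; simp
    · rw [cutJap, cutoff, if_pos h3, one_mul, Real.norm_of_nonneg (jap_pos ξ).le]
  exact h1.trans_lt (Lp.memLp _).2

/-- Energy estimate for the transport term of the second equation. -/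
lemma exists_energy_eta {s : ℝ} (hs : 3 / 2 < s) :
    ∃ C : ℝ, 0 ≤ C ∧ ∀ (N n : ℝ) (a b : H), 1 ≤ N → IsHerm a → IsBand n b →
      |inner ℝ (mulOp (ramp N) b) (mulOp (ramp N) (mulOp (cutJap n) (fieldEta hs a b)))| ≤
        C * (‖a‖ * ‖mulOp (ramp N) b‖ + ‖mulOp (ramp N) a‖ * ‖b‖) * ‖mulOp (ramp N) b‖ := by
  obtain ⟨C, hC0, hC⟩ := exists_transport_bound (s := s) (σ := s - 1) hs (by linarith) le_rfl
  refine ⟨C, hC0, fun N n a b hN ha hb ↦ ?_⟩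
  have h1 := hC N hN (low s a) (low (s - 1) b) (measurable_low _ (measurable_coe a))
    (measurable_low _ (measurable_coe b)) (ha.low s)
    (by rw [sub_add_cancel, wnorm_low]; exact enorm_lt_top)
    (hb.wnorm_lt_top fun ξ ↦ by
      rw [smul_low, ← Real.rpow_add (jap_pos ξ), norm_smul,
        Real.norm_of_nonneg (jap_rpow_pos _ _).le]
      refine le_of_eq ?_
      congr 1
      rw [show s - 1 + 1 + -(s - 1) = 1 by ring, Real.rpow_one])
    ‖a‖ ‖mulOp (ramp N) a‖ ‖mulOp (ramp N) b‖ ‖b‖ (norm_nonneg _) (norm_nonneg _) (norm_nonneg _)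
    (norm_nonneg _) (wnorm_jap_low s a).le (wnorm_weight_low hN s a).le
    (wnorm_weight_low hN _ b).le (wnorm_jap_low _ b).le
  rw [real_inner_eq_of_ae (c := 1), one_mul]
  · exact h1
  · set X := algOp (s - 1) (by linarith) b (mulOp invJap a) with hX
    filter_upwards [hb.ae, mulOp_ae (isMult_ramp hN) b,
      mulOp_ae (isMult_ramp hN) (mulOp (cutJap n) (fieldEta hs a b)),
      mulOp_ae (isMult_cutJap n) (fieldEta hs a b),
      Lp.coeFn_smul (-Complex.I) (mulOp (freqSymb 1) X),
      mulOp_ae (isMult_freqSymb (j := 1) le_rfl) X,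
      algOp_ae (τ := s - 1) (by linarith) b (mulOp invJap a)] with ξ e0 e1 e2 e3 e4 e5 e6
    have e3' : fieldEta hs a b ξ = -Complex.I • (freqSymb 1 ξ • X ξ) := by
      rw [← e5]; exact e4
    rw [e1, e2, e3, e3', e6, conv_comm, conv_congr (low_invJap_ae s a) .rfl]
    have eb : b ξ = jap ξ ^ (s - 1) • low (s - 1) b ξ := by
      rw [smul_low, ← Real.rpow_add (jap_pos ξ)]; simp
    -- Above the band b vanishes and so do both sides; on the band the cutoff equals 1. Truncation
    -- therefore disappears from the pairing, and the estimate is uniform in n.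
    rcases lt_or_ge n (jap ξ) with h3 | h3
    · have : low (s - 1) b ξ = 0 := by rw [low, e0 h3, smul_zero]
      rw [e0 h3, this]; simp
    · rw [cutJap, cutoff, if_pos h3, freqSymb, eb, weight]
      have hj : (jap ξ : ℂ) ≠ 0 := Complex.ofReal_ne_zero.2 (jap_pos ξ).ne'
      simp only [Complex.real_smul, smul_eq_mul, map_mul, Complex.conj_ofReal]
      push_cast
      field_simp

/-- Energy estimate for the transport term of the first equation. -/
lemma exists_energy_u {s : ℝ} (hs : 3 / 2 < s) :
    ∃ C : ℝ, 0 ≤ C ∧ ∀ (N n : ℝ) (a : H), 1 ≤ N → IsHerm a → IsBand n a →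
      |inner ℝ (mulOp (ramp N) a) (mulOp (ramp N) (mulOp (cutJap n)
        (-(Complex.I / 2) • mulOp (freqSymb 1) (algOp s (by linarith) a a))))| ≤
        C * ‖a‖ * ‖mulOp (ramp N) a‖ ^ 2 := by
  obtain ⟨C, hC0, hC⟩ := exists_transport_bound (s := s) (σ := s - 1) hs (by linarith) le_rfl
  refine ⟨3 * C, by positivity, fun N n a hN ha hb ↦ ?_⟩
  -- The transport estimate stops at σ = s - 1, while the energy of u is of order s. Writing J² = 1
  -- + k² splits it into energies of order s - 1 for f and for its derivative q = k f. The Leibniz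
  -- rule k (f ⋆ f) = 2 f ⋆ q, proved in `hconv`, makes the second one a transport term for q.
  set f := low s a with hf
  set q : ℝ → ℂ := fun ξ ↦ freq ξ • f ξ with hq
  have mf : Measurable f := measurable_low _ (measurable_coe a)
  have mq : Measurable q := continuous_freq.measurable.smul mf
  have f1 : wnorm (fun ξ ↦ jap ξ ^ (s - 1 + 1)) f < ∞ := by
    rw [sub_add_cancel, wnorm_low]; exact enorm_lt_top
  have q1 : wnorm (fun ξ ↦ jap ξ ^ (s - 1 + 1)) q < ∞ := hb.wnorm_lt_top fun ξ ↦ by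
    simp only [hq]
    rw [smul_comm, hf, smul_low, ← Real.rpow_add (jap_pos ξ), norm_smul]
    simp only [sub_add_cancel, add_neg_cancel, Real.rpow_zero, one_smul]
    exact mul_le_mul_of_nonneg_right (abs_freq_le_jap ξ) (norm_nonneg _)
  have q2 : ∀ N : ℝ, 1 ≤ N → wnorm (weight (s - 1) N) q ≤ wnorm (weight s N) f := fun N hN ↦ by
    refine eLpNorm_mono fun ξ ↦ ?_
    simp only [hq]
    rw [← mul_smul, norm_smul, norm_smul, norm_mul, Real.norm_of_nonneg (weight_pos hN _ _).le,
      Real.norm_of_nonneg (weight_pos hN _ _).le]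
    refine mul_le_mul_of_nonneg_right ?_ (norm_nonneg _)
    calc weight (s - 1) N ξ * |freq ξ| ≤ weight (s - 1) N ξ * jap ξ :=
          mul_le_mul_of_nonneg_left (abs_freq_le_jap ξ) (weight_pos hN _ _).le
      _ = weight s N ξ := by
          rw [weight, weight, mul_right_comm, ← Real.rpow_add_one (jap_pos ξ).ne', sub_add_cancel]
  have f2 : ∀ N : ℝ, 1 ≤ N → wnorm (weight (s - 1) N) f ≤ wnorm (weight s N) f := fun N hN ↦ by
    refine wnorm_mono (fun ξ ↦ (weight_pos hN _ _).le) (fun ξ ↦ ?_) f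
    unfold weight
    gcongr
    · exact (ramp_pos hN ξ).le
    · exact one_le_jap ξ
    · linarith
  have w1 : wnorm (weight s 1) f = ENNReal.ofReal ‖a‖ := by rw [weight_one, wnorm_jap_low]
  have hA := (wnorm_jap_low s a).le
  have hB := (wnorm_weight_low hN s a).le
  have T1 := hC N hN f f mf mf (ha.low s) f1 f1 ‖a‖ ‖mulOp (ramp N) a‖ ‖mulOp (ramp N) a‖ ‖a‖
    (norm_nonneg _) (norm_nonneg _) (norm_nonneg _) (norm_nonneg _) hA hB ((f2 N hN).trans hB)
    (by have := f2 1 le_rfl; rwa [w1, weight_one] at this)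
  have T2 := hC N hN f q mf mq (ha.low s) f1 q1 ‖a‖ ‖mulOp (ramp N) a‖ ‖mulOp (ramp N) a‖ ‖a‖
    (norm_nonneg _) (norm_nonneg _) (norm_nonneg _) (norm_nonneg _) hA hB ((q2 N hN).trans hB)
    (by have := q2 1 le_rfl; rwa [w1, weight_one] at this)
  have hm : Measurable fun ξ ↦ freq ξ * weight (s - 1) N ξ ^ 2 :=
    continuous_freq.measurable.mul ((measurable_weight _ N).pow_const 2)
  have hmb : ∀ ξ, |freq ξ * weight (s - 1) N ξ ^ 2| ≤
      jap ξ ^ (s - 1 + 1) * jap ξ ^ (s - 1 + 1) := fun ξ ↦ by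
    have h1 := weight_le (σ := s - 1) (N := N) ξ
    have h2 := (weight_pos hN (s - 1) ξ).le
    have h3 := one_le_jap ξ
    have h4 := jap_rpow_pos (s - 1) ξ
    rw [abs_mul, abs_of_nonneg (sq_nonneg (weight (s - 1) N ξ)), Real.rpow_add_one (jap_pos ξ).ne']
    calc |freq ξ| * weight (s - 1) N ξ ^ 2 ≤ jap ξ * (jap ξ ^ (s - 1)) ^ 2 := by
          gcongr; exact abs_freq_le_jap ξ
      _ ≤ jap ξ * (jap ξ ^ (s - 1)) ^ 2 * jap ξ := le_mul_of_one_le_right (by positivity) h3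
      _ = _ := by ring
  have i1 := integrable_conv_mul_conj (integrable_transportKernel (by linarith) hm mf mf hmb f1 f1)
  have i2 := integrable_conv_mul_conj (integrable_transportKernel (by linarith) hm mf mq hmb f1 q1)
  have hfL : MemLp f 2 volume := memLp_low (by linarith) a
  have hqL : MemLp q 2 volume := by
    refine ⟨mq.aestronglyMeasurable, lt_of_le_of_lt (eLpNorm_mono fun ξ ↦ ?_) q1⟩
    change ‖q ξ‖ ≤ ‖jap ξ ^ (s - 1 + 1) • q ξ‖
    rw [norm_smul (jap ξ ^ (s - 1 + 1)), Real.norm_of_nonneg (jap_rpow_pos _ _).le]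
    exact le_mul_of_one_le_left (norm_nonneg _)
      (Real.one_le_rpow (one_le_jap ξ) (by linarith))
  have hconv : ∀ ξ, (freq ξ : ℂ) * conv f f ξ = 2 * conv f q ξ := fun ξ ↦ by
    have e1 : conv f q ξ = conv q f ξ := conv_comm _ _ _
    have e2 : (freq ξ : ℂ) * conv f f ξ = conv f q ξ + conv q f ξ := by
      unfold conv
      rw [← integral_add (integrable_conv hfL hqL ξ) (integrable_conv hqL hfL ξ),
        ← integral_const_mul]
      congr 1; ext ζ
      simp only [hq, Complex.real_smul, freq_sub]
      push_cast; ring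
    rw [e2, ← e1]; ring
  rw [real_inner_eq_of_ae (c := 1 / 2) (g := fun ξ ↦
    ((freq ξ * weight (s - 1) N ξ ^ 2 : ℝ) : ℂ) * conv f f ξ * (starRingEnd ℂ) (f ξ) +
      2 * (((freq ξ * weight (s - 1) N ξ ^ 2 : ℝ) : ℂ) * conv f q ξ * (starRingEnd ℂ) (q ξ)))]
  · rw [integral_add i1 (i2.const_mul 2), integral_const_mul, Complex.add_im]
    have e : ∀ z : ℂ, (2 * z).im = 2 * z.im := fun z ↦ by simp
    rw [e]
    rw [abs_le] at T1 T2 ⊢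
    constructor <;> nlinarith [T1.1, T1.2, T2.1, T2.2]
  · set X := algOp s (by linarith) a a with hX
    filter_upwards [hb.ae, mulOp_ae (isMult_ramp hN) a,
      mulOp_ae (isMult_ramp hN) (mulOp (cutJap n) (-(Complex.I / 2) • mulOp (freqSymb 1) X)),
      mulOp_ae (isMult_cutJap n) (-(Complex.I / 2) • mulOp (freqSymb 1) X),
      Lp.coeFn_smul (-(Complex.I / 2)) (mulOp (freqSymb 1) X),
      mulOp_ae (isMult_freqSymb (j := 1) le_rfl) X,
      algOp_ae (τ := s) (by linarith) a a] with ξ e0 e1 e2 e3 e4 e5 e6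
    rw [e1, e2, e3, e4, Pi.smul_apply, e5, e6]
    have eb : a ξ = jap ξ ^ s • f ξ := by
      rw [hf, smul_low, ← Real.rpow_add (jap_pos ξ)]; simp
    rcases lt_or_ge n (jap ξ) with h3 | h3
    · have h4 : f ξ = 0 := by rw [hf, low, e0 h3, smul_zero]
      have h5 : q ξ = 0 := by simp only [hq, h4, smul_zero]
      rw [e0 h3, h4, h5]; simp
    · have hj : (jap ξ : ℂ) ≠ 0 := Complex.ofReal_ne_zero.2 (jap_pos ξ).ne'
      have hJ : (jap ξ : ℂ) ^ 2 = 1 + (freq ξ : ℂ) ^ 2 := by exact_mod_cast jap_sq ξ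
      have hs' : jap ξ ^ s = jap ξ ^ (s - 1) * jap ξ := by
        rw [← Real.rpow_add_one (jap_pos ξ).ne', sub_add_cancel]
      have hc := hconv ξ
      rw [cutJap, cutoff, if_pos h3, freqSymb, eb, weight, hs']
      simp only [hq, Complex.real_smul, smul_eq_mul, map_mul, Complex.conj_ofReal]
      push_cast
      have hc' : 2 * conv f (fun ξ ↦ (freq ξ : ℂ) * f ξ) ξ = freq ξ * conv f f ξ := by
        rw [hc]; simp only [hq, Complex.real_smul]
      field_simp
      linear_combination (-((jap ξ ^ (s - 1) : ℝ) : ℂ) ^ 2 * (ramp N ξ : ℂ) ^ 2 * freq ξ *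
        (starRingEnd ℂ) (f ξ)) * (conv f f ξ * hJ - freq ξ * hc')

/-- Energy estimate for the linear terms of the first equation. -/
lemma norm_ramp_cutJap_le {N : ℝ} (hN : 1 ≤ N) (n : ℝ) {j : ℕ} (hj : 2 ≤ j) (a : H) :
    ‖mulOp (ramp N) (mulOp (cutJap n) (mulOp (freqSymb j) a))‖ ≤ ‖mulOp (ramp N) a‖ := by
  have hr := isMult_ramp hN
  have hc := isMult_cutJap n
  have hf := isMult_freqSymb (j := j) (by omega)
  rw [mulOp_mulOp hc hf, mulOp_mulOp hr (hc.mul hf)]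
  refine norm_mulOp_le_norm_mulOp (hr.mul (hc.mul hf)) hr (fun ξ ↦ ?_) a
  rw [abs_mul]
  refine mul_le_of_le_one_right (abs_nonneg _) ?_
  have h1 : |freqSymb j ξ| ≤ (jap ξ)⁻¹ := by
    rw [freqSymb, abs_div, abs_of_pos (pow_pos (jap_pos ξ) j), ← one_div,
      div_le_div_iff₀ (pow_pos (jap_pos ξ) j) (jap_pos ξ), one_mul]
    calc |freq ξ| * jap ξ ≤ jap ξ * jap ξ := by
          gcongr
          · exact (jap_pos ξ).le
          · exact abs_freq_le_jap ξ
      _ = jap ξ ^ 2 := (sq _).symm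
      _ ≤ jap ξ ^ j := pow_le_pow_right₀ (one_le_jap ξ) hj
  have h2 : |cutJap n ξ| ≤ jap ξ := by
    unfold cutJap cutoff
    split_ifs
    · rw [one_mul, abs_of_pos (jap_pos ξ)]
    · simpa using (jap_pos ξ).le
  rw [abs_mul]
  calc _ ≤ jap ξ * (jap ξ)⁻¹ := mul_le_mul h2 h1 (abs_nonneg _) (jap_pos ξ).le
    _ = 1 := mul_inv_cancel₀ (jap_pos ξ).ne'

/-- The weighted energy estimate for the truncated system, uniform in the truncation and in the
weight. -/
theorem exists_energy_top {s : ℝ} (hs : 3 / 2 < s) :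
    ∃ C : ℝ, 0 < C ∧ ∀ (N n : ℝ) (a b : H), 1 ≤ N → IsHerm a → IsBand n a → IsBand n b →
      |inner ℝ (mulOp (ramp N) a) (mulOp (ramp N) (mulOp (cutJap n) (fieldU hs a b)))| +
      |inner ℝ (mulOp (ramp N) b) (mulOp (ramp N) (mulOp (cutJap n) (fieldEta hs a b)))| ≤
        C * (1 + ‖a‖ + ‖b‖) * (‖mulOp (ramp N) a‖ ^ 2 + ‖mulOp (ramp N) b‖ ^ 2) := by
  obtain ⟨C₁, h1, H1⟩ := exists_energy_u hs
  obtain ⟨C₂, h2, H2⟩ := exists_energy_eta hs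
  refine ⟨C₁ + 2 * C₂ + 2, by positivity, fun N n a b hN ha hba hbb ↦ ?_⟩
  have e1 := H1 N n a hN ha hba
  have e2 := H2 N n a b hN ha hbb
  have l1 := norm_ramp_cutJap_le hN n (j := 2) le_rfl b
  have l2 := norm_ramp_cutJap_le hN n (j := 3) (by norm_num) a
  set A := mulOp (ramp N) a with hA
  set B := mulOp (ramp N) b with hB
  have l3 : |inner ℝ A (mulOp (ramp N) (mulOp (cutJap n)
      (Complex.I • mulOp (freqSymb 2) b)))| ≤ ‖A‖ * ‖B‖ := by
    refine (abs_real_inner_le_norm _ _).trans ?_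
    rw [map_smul, map_smul, norm_smul, Complex.norm_I, one_mul]
    gcongr
  have l4 : |inner ℝ A (mulOp (ramp N) (mulOp (cutJap n)
      (Complex.I • mulOp (freqSymb 3) a)))| ≤ ‖A‖ * ‖A‖ := by
    refine (abs_real_inner_le_norm _ _).trans ?_
    rw [map_smul, map_smul, norm_smul, Complex.norm_I, one_mul]
    gcongr
  have e3 : |inner ℝ A (mulOp (ramp N) (mulOp (cutJap n) (fieldU hs a b)))| ≤
      C₁ * ‖a‖ * ‖A‖ ^ 2 + (‖A‖ * ‖B‖ + ‖A‖ * ‖A‖) := by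
    rw [fieldU, map_add, map_add, map_sub, map_sub, inner_add_right, inner_sub_right]
    exact (abs_add_le _ _).trans (add_le_add e1 ((abs_sub _ _).trans (add_le_add l3 l4)))
  refine (add_le_add e3 e2).trans ?_
  have na := norm_nonneg a
  have nb := norm_nonneg b
  have nA := norm_nonneg A
  have nB := norm_nonneg B
  have q1 : ‖A‖ * ‖B‖ ≤ ‖A‖ ^ 2 + ‖B‖ ^ 2 := by nlinarith [sq_nonneg (‖A‖ - ‖B‖)]
  set S := ‖A‖ ^ 2 + ‖B‖ ^ 2 with hS
  have q2 : ‖A‖ ^ 2 ≤ S := by rw [hS]; nlinarith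
  have q3 : ‖B‖ ^ 2 ≤ S := by rw [hS]; nlinarith
  have q0 : 0 ≤ S := by positivity
  calc _ = C₁ * (‖a‖ * ‖A‖ ^ 2) + (‖A‖ * ‖B‖ + ‖A‖ ^ 2) +
        C₂ * (‖a‖ * ‖B‖ ^ 2 + ‖b‖ * (‖A‖ * ‖B‖)) := by ring
    _ ≤ C₁ * (‖a‖ * S) + (S + S) + C₂ * (‖a‖ * S + ‖b‖ * S) := by gcongr
    _ ≤ _ := by
      have t : 0 ≤ C₁ * S * (1 + ‖b‖) + C₂ * S * (2 + ‖a‖ + ‖b‖) + 2 * S * (‖a‖ + ‖b‖) := by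
        positivity
      linarith

/-! ### The difference of two solutions -/

/-- Since u² - u'² = (u + u')(u - u'), the difference d is transported by a sum f. Its energy is
taken at order s - 1, so the transport estimate applies directly; N = 1 makes the ramp identically
1. -/
lemma exists_energy_diff_u {s : ℝ} (hs : 3 / 2 < s) :
    ∃ C : ℝ, 0 ≤ C ∧ ∀ f d : H, IsHerm f →
      |inner ℝ (mulOp invJap d) (-(Complex.I / 2) •
        mulOp (freqSymb 1) (algOp s (by linarith) f d))| ≤ C * ‖f‖ * ‖mulOp invJap d‖ ^ 2 := by
  obtain ⟨C, hC0, hC⟩ := exists_transport_bound (s := s) (σ := s - 1) hs (by linarith) le_rfl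
  refine ⟨C, hC0, fun f d hf ↦ ?_⟩
  have h1 := hC 1 le_rfl (low s f) (low s d) (measurable_low _ (measurable_coe f))
    (measurable_low _ (measurable_coe d)) (hf.low s)
    (by rw [sub_add_cancel, wnorm_low]; exact enorm_lt_top)
    (by rw [sub_add_cancel, wnorm_low]; exact enorm_lt_top)
    ‖f‖ ‖f‖ ‖mulOp invJap d‖ ‖mulOp invJap d‖ (norm_nonneg _) (norm_nonneg _) (norm_nonneg _)
    (norm_nonneg _) (wnorm_jap_low s f).le (by rw [weight_one]; exact (wnorm_jap_low s f).le)
    (by rw [weight_one]; exact (wnorm_jap_low_invJap s d).le) (wnorm_jap_low_invJap s d).le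
  rw [real_inner_eq_of_ae (c := 1 / 2), abs_mul]
  · rw [abs_of_pos (by norm_num : (0 : ℝ) < 1 / 2)]
    refine (mul_le_mul_of_nonneg_left h1 (by norm_num)).trans (le_of_eq ?_)
    ring
  · set X := algOp s (by linarith) f d with hX
    filter_upwards [mulOp_ae isMult_invJap d,
      Lp.coeFn_smul (-(Complex.I / 2)) (mulOp (freqSymb 1) X),
      mulOp_ae (isMult_freqSymb (j := 1) le_rfl) X,
      algOp_ae (τ := s) (by linarith) f d] with ξ e1 e4 e5 e6
    rw [e1, e4, Pi.smul_apply, e5, e6, weight_one]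
    have eb : d ξ = jap ξ ^ s • low s d ξ := by
      rw [smul_low, ← Real.rpow_add (jap_pos ξ)]; simp
    have hj : (jap ξ : ℂ) ≠ 0 := Complex.ofReal_ne_zero.2 (jap_pos ξ).ne'
    have hs' : jap ξ ^ s = jap ξ ^ (s - 1) * jap ξ := by
      rw [← Real.rpow_add_one (jap_pos ξ).ne', sub_add_cancel]
    rw [eb, freqSymb, invJap, hs']
    simp only [Complex.real_smul, smul_eq_mul, map_mul, Complex.conj_ofReal]
    push_cast
    field_simp

/-- The difference of the η components is measured at order s - 2, so the transport estimate is used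
with σ = s - 2. Its condition σ > -1/2 is s > 3/2. -/
lemma exists_energy_diff_eta {s : ℝ} (hs : 3 / 2 < s) :
    ∃ C : ℝ, 0 ≤ C ∧ ∀ a d : H, IsHerm a →
      |inner ℝ (mulOp invJap d) (-Complex.I •
        mulOp (freqSymb 1) (algOp (s - 1) (by linarith) d (mulOp invJap a)))| ≤
        C * ‖a‖ * ‖mulOp invJap d‖ ^ 2 := by
  obtain ⟨C, hC0, hC⟩ := exists_transport_bound (s := s) (σ := s - 2) hs (by linarith)
    (by linarith)
  refine ⟨2 * C, by positivity, fun a d ha ↦ ?_⟩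
  have es : s - 2 + 1 = s - 1 := by ring
  have hd : wnorm (fun ξ ↦ jap ξ ^ (s - 2)) (low (s - 1) d) = ENNReal.ofReal ‖mulOp invJap d‖ := by
    have := wnorm_jap_low_invJap (s - 1) d
    rwa [show s - 1 - 1 = s - 2 by ring] at this
  have h1 := hC 1 le_rfl (low s a) (low (s - 1) d) (measurable_low _ (measurable_coe a))
    (measurable_low _ (measurable_coe d)) (ha.low s)
    (by rw [es, wnorm_jap_low_invJap]; exact ENNReal.ofReal_lt_top)
    (by rw [es, wnorm_low]; exact enorm_lt_top)
    ‖a‖ ‖a‖ ‖mulOp invJap d‖ ‖mulOp invJap d‖ (norm_nonneg _) (norm_nonneg _) (norm_nonneg _)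
    (norm_nonneg _) (wnorm_jap_low s a).le (by rw [weight_one]; exact (wnorm_jap_low s a).le)
    (by rw [weight_one]; exact hd.le) hd.le
  rw [real_inner_eq_of_ae (c := 1), one_mul]
  · refine h1.trans (le_of_eq ?_)
    ring
  · set X := algOp (s - 1) (by linarith) d (mulOp invJap a) with hX
    filter_upwards [mulOp_ae isMult_invJap d,
      Lp.coeFn_smul (-Complex.I) (mulOp (freqSymb 1) X),
      mulOp_ae (isMult_freqSymb (j := 1) le_rfl) X,
      algOp_ae (τ := s - 1) (by linarith) d (mulOp invJap a)] with ξ e1 e4 e5 e6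
    rw [e1, e4, Pi.smul_apply, e5, e6, weight_one, conv_comm, conv_congr (low_invJap_ae s a) .rfl]
    have eb : d ξ = jap ξ ^ (s - 1) • low (s - 1) d ξ := by
      rw [smul_low, ← Real.rpow_add (jap_pos ξ)]; simp
    have hj : (jap ξ : ℂ) ≠ 0 := Complex.ofReal_ne_zero.2 (jap_pos ξ).ne'
    have hs' : jap ξ ^ (s - 1) = jap ξ ^ (s - 2) * jap ξ := by
      rw [← Real.rpow_add_one (jap_pos ξ).ne', es]
    rw [eb, freqSymb, invJap, hs']
    simp only [Complex.real_smul, smul_eq_mul, map_mul, Complex.conj_ofReal]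
    push_cast
    field_simp

lemma norm_freqSymb_le_invJap {j : ℕ} (hj : 2 ≤ j) (a : H) :
    ‖mulOp (freqSymb j) a‖ ≤ ‖mulOp invJap a‖ := by
  refine norm_mulOp_le_norm_mulOp (isMult_freqSymb (by omega)) isMult_invJap (fun ξ ↦ ?_) a
  rw [invJap, abs_of_pos (inv_pos.2 (jap_pos ξ)), freqSymb, abs_div,
    abs_of_pos (pow_pos (jap_pos ξ) j), ← one_div,
    div_le_div_iff₀ (pow_pos (jap_pos ξ) j) (jap_pos ξ), one_mul]
  calc |freq ξ| * jap ξ ≤ jap ξ * jap ξ := by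
        gcongr
        · exact (jap_pos ξ).le
        · exact abs_freq_le_jap ξ
    _ = jap ξ ^ 2 := (sq _).symm
    _ ≤ jap ξ ^ j := pow_le_pow_right₀ (one_le_jap ξ) hj

lemma fieldU_sub {s : ℝ} (hs : 3 / 2 < s) (a b a' b' : H) :
    fieldU hs a b - fieldU hs a' b' =
      -(Complex.I / 2) • mulOp (freqSymb 1) (algOp s (by linarith) (a + a') (a - a')) +
      (Complex.I • mulOp (freqSymb 2) (b - b') - Complex.I • mulOp (freqSymb 3) (a - a')) := by
  have h : algOp s (by linarith) (a + a') (a - a') =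
      algOp s (by linarith) a a - algOp s (by linarith) a' a' := by
    simp only [map_add, map_sub, add_apply, algOp_comm _ a' a]
    abel
  rw [h]
  simp only [fieldU, map_sub, smul_sub]
  abel

lemma fieldEta_sub {s : ℝ} (hs : 3 / 2 < s) (a b a' b' : H) :
    fieldEta hs a b - fieldEta hs a' b' =
      -Complex.I • mulOp (freqSymb 1) (algOp (s - 1) (by linarith) (b - b') (mulOp invJap a)) +
      -Complex.I • mulOp (freqSymb 1)
        (algOp (s - 1) (by linarith) b' (mulOp invJap (a - a'))) := by
  simp only [fieldEta, map_sub, smul_sub, sub_apply]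
  abel

/-- The energy estimate for the difference of two states, one derivative below the regularity of
the states. -/
theorem exists_energy_diff {s : ℝ} (hs : 3 / 2 < s) :
    ∃ C : ℝ, 0 < C ∧ ∀ a b a' b' : H, IsHerm a → IsHerm a' →
      |inner ℝ (mulOp invJap (a - a')) (fieldU hs a b - fieldU hs a' b')| +
      |inner ℝ (mulOp invJap (b - b')) (fieldEta hs a b - fieldEta hs a' b')| ≤
        C * (1 + ‖a‖ + ‖a'‖ + ‖b'‖) *
          (‖mulOp invJap (a - a')‖ ^ 2 + ‖mulOp invJap (b - b')‖ ^ 2) := by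
  obtain ⟨C₁, h1, H1⟩ := exists_energy_diff_u hs
  obtain ⟨C₂, h2, H2⟩ := exists_energy_diff_eta hs
  set C₃ := algConst (s - 1)
  have h3 : 0 ≤ C₃ := algConst_nonneg _
  refine ⟨C₁ + C₂ + C₃ + 2, by positivity, fun a b a' b' ha ha' ↦ ?_⟩
  have e1 := H1 (a + a') (a - a') (ha.add ha')
  have e2 := H2 a (b - b') ha
  have l1 := norm_freqSymb_le_invJap (j := 2) le_rfl (b - b')
  have l2 := norm_freqSymb_le_invJap (j := 3) (by norm_num) (a - a')
  rw [fieldU_sub, fieldEta_sub]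
  set A := mulOp invJap (a - a') with hA
  set B := mulOp invJap (b - b') with hB
  have l3 : |inner ℝ A (Complex.I • mulOp (freqSymb 2) (b - b'))| ≤ ‖A‖ * ‖B‖ := by
    refine (abs_real_inner_le_norm _ _).trans ?_
    rw [norm_smul, Complex.norm_I, one_mul]
    gcongr
  have l4 : |inner ℝ A (Complex.I • mulOp (freqSymb 3) (a - a'))| ≤ ‖A‖ * ‖A‖ := by
    refine (abs_real_inner_le_norm _ _).trans ?_
    rw [norm_smul, Complex.norm_I, one_mul]
    gcongr
  -- The term (η'(u - u'))_x needs no cancellation: at order s - 2 it is controlled by the product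
  -- in H^{s-1}, and u - u' is measured in exactly that space. Splitting the difference this way
  -- leaves only b', not b, in the bound.
  have l5 : |inner ℝ B (-Complex.I • mulOp (freqSymb 1) (algOp (s - 1) (by linarith) b' A))| ≤
      ‖B‖ * (C₃ * ‖b'‖ * ‖A‖) := by
    refine (abs_real_inner_le_norm _ _).trans ?_
    rw [norm_smul, norm_neg, Complex.norm_I, one_mul]
    gcongr
    refine (norm_mulOp_le (isMult_freqSymb le_rfl) _).trans ?_
    rw [one_mul]
    exact norm_algOp_le _ _ _
  rw [inner_add_right, inner_sub_right, inner_add_right]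
  refine (add_le_add ((abs_add_le _ _).trans (add_le_add e1 ((abs_sub _ _).trans
    (add_le_add l3 l4)))) ((abs_add_le _ _).trans (add_le_add e2 l5))).trans ?_
  have naa := norm_add_le a a'
  have na := norm_nonneg a
  have na' := norm_nonneg a'
  have nb := norm_nonneg b'
  have nA := norm_nonneg A
  have nB := norm_nonneg B
  have q1 : ‖A‖ * ‖B‖ ≤ ‖A‖ ^ 2 + ‖B‖ ^ 2 := by nlinarith [sq_nonneg (‖A‖ - ‖B‖)]
  set S := ‖A‖ ^ 2 + ‖B‖ ^ 2 with hS
  have q2 : ‖A‖ ^ 2 ≤ S := by rw [hS]; nlinarith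
  have q3 : ‖B‖ ^ 2 ≤ S := by rw [hS]; nlinarith
  have q0 : 0 ≤ S := by positivity
  calc _ = C₁ * ‖a + a'‖ * ‖A‖ ^ 2 + (‖A‖ * ‖B‖ + ‖A‖ ^ 2) +
        (C₂ * ‖a‖ * ‖B‖ ^ 2 + C₃ * ‖b'‖ * (‖A‖ * ‖B‖)) := by ring
    _ ≤ C₁ * (‖a‖ + ‖a'‖) * S + (S + S) + (C₂ * ‖a‖ * S + C₃ * ‖b'‖ * S) := by gcongr
    _ ≤ _ := by
      have t : 0 ≤ C₁ * S * (1 + ‖b'‖) + C₂ * S * (1 + ‖a'‖ + ‖b'‖) + C₃ * S * (1 + ‖a‖ + ‖a'‖) +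
        2 * S * (‖a‖ + ‖a'‖ + ‖b'‖) := by positivity
      linarith

/-! ### Calculus on a closed interval -/

section Calculus

variable {E : Type*} [NormedAddCommGroup E] [NormedSpace ℝ E]

lemma hasDerivWithinAt_Ici_of_Icc {f : ℝ → E} {f' : E} {T t : ℝ} (ht : t ∈ Ico 0 T)
    (h : HasDerivWithinAt f f' (Icc 0 T) t) : HasDerivWithinAt f f' (Ici t) t :=
  h.mono_of_mem_nhdsWithin (mem_of_superset (Icc_mem_nhdsGE ht.2) (Icc_subset_Icc_left ht.1))

lemma le_exp_of_abs_deriv_le {f f' : ℝ → ℝ} {T L δ : ℝ} (hL : 1 ≤ L) (hδ : 0 ≤ δ)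
    (hf : ∀ t ∈ Icc 0 T, HasDerivWithinAt f (f' t) (Icc 0 T) t) (h0 : ∀ t ∈ Icc 0 T, 0 ≤ f t)
    (hb : ∀ t ∈ Icc 0 T, |f' t| ≤ L * f t + δ) :
    ∀ t ∈ Icc 0 T, f t ≤ (f 0 + δ) * Real.exp (L * t) := by
  intro t ht
  have hT : (0 : ℝ) ∈ Icc 0 T := ⟨le_rfl, ht.1.trans ht.2⟩
  have h := norm_le_gronwallBound_of_norm_deriv_right_le (f := f) (f' := f') (δ := f 0) (K := L)
    (ε := δ) (a := 0) (b := T) (fun t ht ↦ (hf t ht).continuousWithinAt)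
    (fun t ht ↦ hasDerivWithinAt_Ici_of_Icc ht (hf t ⟨ht.1, ht.2.le⟩))
    (by rw [Real.norm_of_nonneg (h0 0 hT)])
    (fun t ht ↦ by
      rw [Real.norm_of_nonneg (h0 t ⟨ht.1, ht.2.le⟩)]; exact hb t ⟨ht.1, ht.2.le⟩) t ht
  rw [Real.norm_of_nonneg (h0 t ht), gronwallBound_of_K_ne_0 (by linarith), sub_zero] at h
  have he : 1 ≤ Real.exp (L * t) := Real.one_le_exp (mul_nonneg (by linarith) ht.1)
  -- Here L ≥ 1 removes the division by L in the inhomogeneous Grönwall bound.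
  have h1 : δ / L ≤ δ := div_le_self hδ hL
  have h2 : δ / L * (Real.exp (L * t) - 1) ≤ δ * Real.exp (L * t) :=
    mul_le_mul h1 (by linarith) (by linarith) hδ
  linarith

variable [CompleteSpace E]

lemma eq_add_integral_of_hasDerivWithinAt {f F : ℝ → E} {T : ℝ} (hF : ContinuousOn F (Icc 0 T))
    (h : ∀ t ∈ Icc 0 T, HasDerivWithinAt f (F t) (Icc 0 T) t) :
    ∀ t ∈ Icc 0 T, f t = f 0 + ∫ τ in (0 : ℝ)..t, F τ := by
  intro t ht
  have hsub : Icc 0 t ⊆ Icc 0 T := Icc_subset_Icc_right ht.2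
  rw [intervalIntegral.integral_eq_sub_of_hasDeriv_right_of_le ht.1
    (fun x hx ↦ ((h x (hsub hx)).continuousWithinAt.mono hsub))
    (fun x hx ↦ (hasDerivWithinAt_Ici_of_Icc ⟨hx.1.le, hx.2.trans_le ht.2⟩
      (h x ⟨hx.1.le, hx.2.le.trans ht.2⟩)).mono Ioi_subset_Ici_self)
    ((hF.mono hsub).intervalIntegrable_of_Icc ht.1)]
  abel

lemma hasDerivWithinAt_of_eq_add_integral {f F : ℝ → E} {T : ℝ} (hF : ContinuousOn F (Icc 0 T))
    (h : ∀ t ∈ Icc 0 T, f t = f 0 + ∫ τ in (0 : ℝ)..t, F τ) :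
    ∀ t ∈ Icc 0 T, HasDerivWithinAt f (F t) (Icc 0 T) t := by
  intro t ht
  have hT : (0 : ℝ) ≤ T := ht.1.trans ht.2
  -- F is continuous only on [0, T]. Extending it by constants makes the two-sided fundamental
  -- theorem of calculus available at the end points as well.
  set G : ℝ → E := IccExtend hT (fun x : Icc (0 : ℝ) T ↦ F x) with hG
  have hGc : Continuous G := (continuousOn_iff_continuous_domRestrict.1 hF).Icc_extend'
  have hGF : ∀ x ∈ Icc 0 T, G x = F x := fun x hx ↦ IccExtend_of_mem hT _ hx
  have h1 : HasDerivAt (fun x ↦ f 0 + ∫ τ in (0 : ℝ)..x, G τ) (G t) t :=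
    (intervalIntegral.integral_hasDerivAt_right (hGc.intervalIntegrable _ _)
      hGc.stronglyMeasurable.stronglyMeasurableAtFilter hGc.continuousAt).const_add (f 0)
  rw [hGF t ht] at h1
  have h2 : ∀ x ∈ Icc 0 T, f x = f 0 + ∫ τ in (0 : ℝ)..x, G τ := fun x hx ↦ by
    rw [h x hx]
    congr 1
    refine intervalIntegral.integral_congr fun y hy ↦ ?_
    rw [uIcc_of_le hx.1] at hy
    exact (hGF y ⟨hy.1, hy.2.trans hx.2⟩).symm
  exact h1.hasDerivWithinAt.congr h2 (h2 t ht)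

end Calculus

/-! ### The radial retraction -/

section Radial

variable {E : Type*} [NormedAddCommGroup E] [NormedSpace ℝ E]

/-- The radial retraction to the closed ball of radius `M`. -/
def radial (M : ℝ) (x : E) : E := (max 1 (‖x‖ / M))⁻¹ • x

lemma norm_radial_le {M : ℝ} (hM : 0 < M) (x : E) : ‖radial M x‖ ≤ M := by
  have h : 0 < max 1 (‖x‖ / M) := lt_max_of_lt_left one_pos
  rw [radial, norm_smul, Real.norm_of_nonneg (inv_pos.2 h).le, inv_mul_le_iff₀ h]
  calc ‖x‖ = ‖x‖ / M * M := (div_mul_cancel₀ _ hM.ne').symm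
    _ ≤ _ := by gcongr; exact le_max_right _ _

lemma radial_eq {M : ℝ} (hM : 0 < M) {x : E} (hx : ‖x‖ ≤ M) : radial M x = x := by
  rw [radial, max_eq_left ((div_le_one hM).2 hx), inv_one, one_smul]

/-- The retraction is a positive scaling by at most 1, so it preserves Hermitian symmetry and band
limitation, and it does not harm the energy estimate. -/
lemma exists_radial_eq (M : ℝ) (x : E) : ∃ r : ℝ, 0 < r ∧ r ≤ 1 ∧ radial M x = r • x :=
  ⟨_, inv_pos.2 (lt_max_of_lt_left one_pos), inv_le_one_of_one_le₀ (le_max_left _ _), rfl⟩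

lemma norm_radial_sub_le {M : ℝ} (hM : 0 < M) (x y : E) :
    ‖radial M x - radial M y‖ ≤ 2 * ‖x - y‖ := by
  wlog hxy : ‖x‖ ≤ ‖y‖ generalizing x y
  · rw [norm_sub_rev, norm_sub_rev x]; exact this y x (le_of_not_ge hxy)
  set p := max 1 (‖x‖ / M) with hp
  set q := max 1 (‖y‖ / M) with hq
  have hp0 : 1 ≤ p := le_max_left _ _
  have hq0 : 1 ≤ q := le_max_left _ _
  have hpq : p ≤ q := max_le_max le_rfl (by gcongr)
  -- The second term vanishes unless y lies outside the ball, where q M = ‖y‖ exactly. Each term is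
  -- bounded by ‖x - y‖, which gives the Lipschitz constant 2.
  have e : radial M x - radial M y = p⁻¹ • (x - y) + (p⁻¹ - q⁻¹) • y := by
    rw [radial, radial, smul_sub, sub_smul]; abel
  have h1 : ‖p⁻¹ • (x - y)‖ ≤ ‖x - y‖ := by
    rw [norm_smul, Real.norm_of_nonneg (by positivity)]
    exact mul_le_of_le_one_left (norm_nonneg _) (inv_le_one_of_one_le₀ hp0)
  have h2 : ‖(p⁻¹ - q⁻¹) • y‖ ≤ ‖x - y‖ := by
    have h3 : q - p ≤ ‖x - y‖ / M := by
      have h4 : ‖y‖ / M ≤ ‖x‖ / M + ‖x - y‖ / M := by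
        rw [← add_div]; gcongr
        have := norm_sub_norm_le y x
        rw [norm_sub_rev] at this; linarith
      have h5 : 0 ≤ ‖x - y‖ / M := by positivity
      rw [hq, sub_le_iff_le_add]
      exact max_le (by linarith) (by linarith [le_max_right 1 (‖x‖ / M)])
    have h6 : (q - p) * M ≤ ‖x - y‖ := (le_div_iff₀ hM).1 h3
    rw [norm_smul, Real.norm_of_nonneg (sub_nonneg.2 (inv_anti₀ (by linarith) hpq))]
    rcases le_total (‖y‖ / M) 1 with h7 | h7
    · have : q = p := le_antisymm (by rw [hq, max_eq_left h7]; exact hp0) hpq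
      rw [this]; simp
    · have hqe : q * M = ‖y‖ := by rw [hq, max_eq_right h7, div_mul_cancel₀ _ hM.ne']
      rw [← hqe]
      calc (p⁻¹ - q⁻¹) * (q * M) = ((q - p) * M) / p := by
            field_simp
        _ ≤ (q - p) * M := div_le_self (mul_nonneg (by linarith) hM.le) hp0
        _ ≤ _ := h6
  rw [e]
  linarith [norm_add_le (p⁻¹ • (x - y)) ((p⁻¹ - q⁻¹) • y)]

end Radial

/-! ### Curves and their stability -/

/-- Strong solutions on the frequency side. -/
structure IsCurve {s : ℝ} (hs : 3 / 2 < s) (T : ℝ) (a b : ℝ → H) : Prop where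
  herm_a : ∀ t ∈ Icc 0 T, IsHerm (a t)
  herm_b : ∀ t ∈ Icc 0 T, IsHerm (b t)
  cont_a : ContinuousOn a (Icc 0 T)
  cont_b : ContinuousOn b (Icc 0 T)
  deriv_a : ∀ t ∈ Icc 0 T,
    HasDerivWithinAt (fun τ ↦ mulOp invJap (a τ)) (fieldU hs (a t) (b t)) (Icc 0 T) t
  deriv_b : ∀ t ∈ Icc 0 T,
    HasDerivWithinAt (fun τ ↦ mulOp invJap (b τ)) (fieldEta hs (a t) (b t)) (Icc 0 T) t

lemma two_mul_inner_add_le {x y e e' : H} {ε : ℝ} (he : ‖e‖ ≤ ε) (he' : ‖e'‖ ≤ ε) :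
    |2 * inner ℝ x (y + (e - e'))| ≤ 2 * |inner ℝ x y| + 2 * ‖x‖ ^ 2 + 2 * ε ^ 2 := by
  have h1 : |inner ℝ x (e - e')| ≤ ‖x‖ * (2 * ε) := by
    refine (abs_real_inner_le_norm _ _).trans ?_
    gcongr
    linarith [norm_sub_le e e']
  rw [inner_add_right, abs_mul, abs_two]
  have h2 := abs_add_le (inner ℝ x y) (inner ℝ x (e - e'))
  nlinarith [sq_nonneg (‖x‖ - ε)]

/-- Stability of approximate solutions, one derivative below their regularity. -/
theorem exists_stability {s : ℝ} (hs : 3 / 2 < s) (M : ℝ) :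
    ∃ L : ℝ, 1 ≤ L ∧ ∀ (T ε : ℝ) (a b a' b' eU eE eU' eE' : ℝ → H),
      (∀ t ∈ Icc 0 T, IsHerm (a t)) → (∀ t ∈ Icc 0 T, IsHerm (a' t)) →
      (∀ t ∈ Icc 0 T, ‖a t‖ ≤ M) → (∀ t ∈ Icc 0 T, ‖a' t‖ ≤ M) → (∀ t ∈ Icc 0 T, ‖b' t‖ ≤ M) →
      (∀ t ∈ Icc 0 T, ‖eU t‖ ≤ ε) → (∀ t ∈ Icc 0 T, ‖eE t‖ ≤ ε) →
      (∀ t ∈ Icc 0 T, ‖eU' t‖ ≤ ε) → (∀ t ∈ Icc 0 T, ‖eE' t‖ ≤ ε) →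
      (∀ t ∈ Icc 0 T, HasDerivWithinAt (fun τ ↦ mulOp invJap (a τ))
        (fieldU hs (a t) (b t) + eU t) (Icc 0 T) t) →
      (∀ t ∈ Icc 0 T, HasDerivWithinAt (fun τ ↦ mulOp invJap (b τ))
        (fieldEta hs (a t) (b t) + eE t) (Icc 0 T) t) →
      (∀ t ∈ Icc 0 T, HasDerivWithinAt (fun τ ↦ mulOp invJap (a' τ))
        (fieldU hs (a' t) (b' t) + eU' t) (Icc 0 T) t) →
      (∀ t ∈ Icc 0 T, HasDerivWithinAt (fun τ ↦ mulOp invJap (b' τ))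
        (fieldEta hs (a' t) (b' t) + eE' t) (Icc 0 T) t) →
      ∀ t ∈ Icc 0 T, ‖mulOp invJap (a t - a' t)‖ ^ 2 + ‖mulOp invJap (b t - b' t)‖ ^ 2 ≤
        (‖mulOp invJap (a 0 - a' 0)‖ ^ 2 + ‖mulOp invJap (b 0 - b' 0)‖ ^ 2 + 4 * ε ^ 2) *
          Real.exp (L * t) := by
  obtain ⟨C, hC0, hC⟩ := exists_energy_diff hs
  refine ⟨2 * C * (1 + 3 * |M|) + 2, by
    have : 0 ≤ 2 * C * (1 + 3 * |M|) := by positivity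
    linarith, ?_⟩
  intro T ε a b a' b' eU eE eU' eE' ha ha' na na' nb' hU hE hU' hE' da db da' db'
  have hL : 1 ≤ 2 * C * (1 + 3 * |M|) + 2 := by
    have : 0 ≤ 2 * C * (1 + 3 * |M|) := by positivity
    linarith
  refine le_exp_of_abs_deriv_le (f := fun t ↦
    ‖mulOp invJap (a t - a' t)‖ ^ 2 + ‖mulOp invJap (b t - b' t)‖ ^ 2)
    (f' := fun t ↦ 2 * inner ℝ (mulOp invJap (a t - a' t))
      ((fieldU hs (a t) (b t) - fieldU hs (a' t) (b' t)) + (eU t - eU' t)) +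
      2 * inner ℝ (mulOp invJap (b t - b' t))
      ((fieldEta hs (a t) (b t) - fieldEta hs (a' t) (b' t)) + (eE t - eE' t)))
    hL (by positivity) (fun t ht ↦ ?_) (fun t ht ↦ by positivity) (fun t ht ↦ ?_)
  · have h1 := ((da t ht).sub (da' t ht)).norm_sq
    have h2 := ((db t ht).sub (db' t ht)).norm_sq
    have h3 := h1.add h2
    simp only [map_sub]
    refine h3.congr_deriv ?_
    congr 3 <;> abel
  · have h1 := two_mul_inner_add_le (x := mulOp invJap (a t - a' t))
      (y := fieldU hs (a t) (b t) - fieldU hs (a' t) (b' t)) (hU t ht) (hU' t ht)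
    have h2 := two_mul_inner_add_le (x := mulOp invJap (b t - b' t))
      (y := fieldEta hs (a t) (b t) - fieldEta hs (a' t) (b' t)) (hE t ht) (hE' t ht)
    have h3 := hC (a t) (b t) (a' t) (b' t) (ha t ht) (ha' t ht)
    have h4 := le_abs_self M
    set S := ‖mulOp invJap (a t - a' t)‖ ^ 2 + ‖mulOp invJap (b t - b' t)‖ ^ 2 with hS
    have h5 : C * (1 + ‖a t‖ + ‖a' t‖ + ‖b' t‖) * S ≤ C * (1 + 3 * |M|) * S := by
      have := na t ht
      have := na' t ht
      have := nb' t ht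
      have hS0 : 0 ≤ S := by positivity
      have h6 : 1 + ‖a t‖ + ‖a' t‖ + ‖b' t‖ ≤ 1 + 3 * |M| := by linarith
      gcongr
    refine (abs_add_le _ _).trans ?_
    have : (2 * C * (1 + 3 * |M|) + 2) * S = 2 * (C * (1 + 3 * |M|) * S) + 2 * S := by ring
    linarith

/-! ### The truncated system -/

lemma norm_fieldU_sub_le {s : ℝ} (hs : 3 / 2 < s) (a b a' b' : H) :
    ‖fieldU hs a b - fieldU hs a' b'‖ ≤
      algConst s * (‖a‖ + ‖a'‖) * ‖a - a'‖ + (‖b - b'‖ + ‖a - a'‖) := by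
  rw [fieldU_sub]
  have hI : ‖-(Complex.I / 2)‖ ≤ 1 := by rw [norm_neg, norm_div, Complex.norm_I]; norm_num
  have h1 : ‖-(Complex.I / 2) • mulOp (freqSymb 1) (algOp s (by linarith) (a + a') (a - a'))‖ ≤
      algConst s * (‖a‖ + ‖a'‖) * ‖a - a'‖ := by
    rw [norm_smul]
    refine (mul_le_of_le_one_left (norm_nonneg _) hI).trans ?_
    refine (norm_mulOp_le (isMult_freqSymb le_rfl) _).trans ?_
    rw [one_mul]
    refine (norm_algOp_le _ _ _).trans ?_
    have := algConst_nonneg s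
    gcongr
    exact norm_add_le _ _
  have h2 : ‖Complex.I • mulOp (freqSymb 2) (b - b')‖ ≤ ‖b - b'‖ := by
    rw [norm_smul, Complex.norm_I, one_mul]
    simpa using norm_mulOp_le (isMult_freqSymb (j := 2) (by norm_num)) (b - b')
  have h3 : ‖Complex.I • mulOp (freqSymb 3) (a - a')‖ ≤ ‖a - a'‖ := by
    rw [norm_smul, Complex.norm_I, one_mul]
    simpa using norm_mulOp_le (isMult_freqSymb (j := 3) (by norm_num)) (a - a')
  exact (norm_add_le _ _).trans (add_le_add h1 ((norm_sub_le _ _).trans (add_le_add h2 h3)))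

lemma norm_fieldEta_sub_le {s : ℝ} (hs : 3 / 2 < s) (a b a' b' : H) :
    ‖fieldEta hs a b - fieldEta hs a' b'‖ ≤
      algConst (s - 1) * ‖b - b'‖ * ‖a‖ + algConst (s - 1) * ‖b'‖ * ‖a - a'‖ := by
  rw [fieldEta_sub]
  have hc := algConst_nonneg (s - 1)
  have key : ∀ x y : H, ‖-Complex.I • mulOp (freqSymb 1)
      (algOp (s - 1) (by linarith) x (mulOp invJap y))‖ ≤ algConst (s - 1) * ‖x‖ * ‖y‖ := by
    intro x y
    rw [norm_smul, norm_neg, Complex.norm_I, one_mul]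
    refine (norm_mulOp_le (isMult_freqSymb le_rfl) _).trans ?_
    rw [one_mul]
    refine (norm_algOp_le _ _ _).trans ?_
    gcongr
    simpa using norm_mulOp_le isMult_invJap y
  exact (norm_add_le _ _).trans (add_le_add (key _ _) (key _ _))

lemma cutoff_neg (n ξ : ℝ) : cutoff n (-ξ) = cutoff n ξ := by unfold cutoff; rw [jap_neg]

lemma cutJap_neg (n ξ : ℝ) : cutJap n (-ξ) = cutJap n ξ := by
  unfold cutJap; rw [jap_neg, cutoff_neg]

lemma invJap_neg (ξ : ℝ) : invJap (-ξ) = invJap ξ := by unfold invJap; rw [jap_neg]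

lemma freqSymb_neg (j : ℕ) (ξ : ℝ) : freqSymb j (-ξ) = -freqSymb j ξ := by
  unfold freqSymb freq; rw [jap_neg]; ring

lemma IsHerm.I_freqSymb {a : H} (ha : IsHerm a) {j : ℕ} (hj : 1 ≤ j) :
    IsHerm (Complex.I • FornbergWhitham.mulOp (freqSymb j) a : H) :=
  ha.I_mulOp (isMult_freqSymb hj) (freqSymb_neg j)

lemma IsHerm.fieldU {s : ℝ} (hs : 3 / 2 < s) {a b : H} (ha : IsHerm a) (hb : IsHerm b) :
    IsHerm (fieldU hs a b) := by
  have h1 := ((ha.algOp (τ := s) (by linarith) ha).I_freqSymb (j := 1) le_rfl).smul_real (-(1 / 2))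
  have e : ((-(1 / 2) : ℝ) • (Complex.I • FornbergWhitham.mulOp (freqSymb 1)
      (FornbergWhitham.algOp s (by linarith) a a)) : H) =
      -(Complex.I / 2) • FornbergWhitham.mulOp (freqSymb 1)
        (FornbergWhitham.algOp s (by linarith) a a) := by
    rw [← algebraMap_smul ℂ (-(1 / 2) : ℝ), smul_smul]
    congr 1
    rw [Complex.coe_algebraMap]; push_cast; ring
  rw [e] at h1
  exact h1.add ((hb.I_freqSymb (j := 2) (by norm_num)).sub (ha.I_freqSymb (j := 3) (by norm_num)))

lemma IsHerm.fieldEta {s : ℝ} (hs : 3 / 2 < s) {a b : H} (ha : IsHerm a) (hb : IsHerm b) :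
    IsHerm (fieldEta hs a b) := by
  have h1 := ((hb.algOp (τ := s - 1) (by linarith)
    (ha.mulOp isMult_invJap invJap_neg)).I_freqSymb (j := 1) le_rfl).smul_real (-1)
  have e : ((-1 : ℝ) • (Complex.I • FornbergWhitham.mulOp (freqSymb 1)
      (FornbergWhitham.algOp (s - 1) (by linarith) b (FornbergWhitham.mulOp invJap a))) : H) =
      FornbergWhitham.fieldEta hs a b := by
    rw [neg_one_smul, FornbergWhitham.fieldEta, neg_smul]
  rwa [e] at h1

/-- The vector field of the truncated system. -/
def truncField {s : ℝ} (hs : 3 / 2 < s) (n : ℝ) (x : H × H) : H × H :=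
  (mulOp (cutJap n) (fieldU hs x.1 x.2), mulOp (cutJap n) (fieldEta hs x.1 x.2))

/-- The fields are locally Lipschitz from H × H to H, and undoing J⁻¹ on the band costs at most |n|.
The constant depends on n, which is harmless: it serves only to solve the truncated equation. -/
lemma exists_truncField_sub_le {s : ℝ} (hs : 3 / 2 < s) (n M : ℝ) :
    ∃ K : ℝ≥0, ∀ x y : H × H, ‖x‖ ≤ M → ‖y‖ ≤ M →
      ‖truncField hs n x - truncField hs n y‖ ≤ K * ‖x - y‖ := by
  have c1 := algConst_nonneg s
  have c2 := algConst_nonneg (s - 1)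
  refine ⟨⟨|n| * ((algConst s + algConst (s - 1)) * (|M| + |M|) + 2), by positivity⟩,
    fun x y hx hy ↦ ?_⟩
  have hM := le_abs_self M
  have x1 := (norm_fst_le x).trans hx
  have y1 := (norm_fst_le y).trans hy
  have y2 := (norm_snd_le y).trans hy
  have d1 := norm_fst_le (x - y)
  have d2 := norm_snd_le (x - y)
  rw [Prod.fst_sub] at d1
  rw [Prod.snd_sub] at d2
  have e1 := norm_fieldU_sub_le hs x.1 x.2 y.1 y.2
  have e2 := norm_fieldEta_sub_le hs x.1 x.2 y.1 y.2
  have m1 : algConst s * (‖x.1‖ + ‖y.1‖) * ‖x.1 - y.1‖ + (‖x.2 - y.2‖ + ‖x.1 - y.1‖) ≤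
      algConst s * (|M| + |M|) * ‖x - y‖ + (‖x - y‖ + ‖x - y‖) := by
    have h1 := x1.trans hM
    have h2 := y1.trans hM
    gcongr
  have m2 : algConst (s - 1) * ‖x.2 - y.2‖ * ‖x.1‖ + algConst (s - 1) * ‖y.2‖ * ‖x.1 - y.1‖ ≤
      algConst (s - 1) * ‖x - y‖ * |M| + algConst (s - 1) * |M| * ‖x - y‖ := by
    have h1 := x1.trans hM
    have h2 := y2.trans hM
    gcongr
  have t1 : 0 ≤ algConst s * (|M| + |M|) * ‖x - y‖ := by positivity
  have t2 : 0 ≤ algConst (s - 1) * (|M| + |M|) * ‖x - y‖ := by positivity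
  have t3 := norm_nonneg (x - y)
  change _ ≤ |n| * ((algConst s + algConst (s - 1)) * (|M| + |M|) + 2) * ‖x - y‖
  rw [Prod.norm_def, truncField, truncField, Prod.mk_sub_mk, ← map_sub, ← map_sub, mul_assoc]
  refine max_le ((norm_mulOp_le (isMult_cutJap n) _).trans ?_)
    ((norm_mulOp_le (isMult_cutJap n) _).trans ?_)
  · exact mul_le_mul_of_nonneg_left (by linarith) (abs_nonneg n)
  · exact mul_le_mul_of_nonneg_left (by linarith) (abs_nonneg n)

/-- The projection to the pairs of Hermitian functions with frequencies in `J ≤ n`. -/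
def pairProj (n : ℝ) : H × H →L[ℝ] H × H :=
  (((mulOp (cutoff n)).restrictScalars ℝ).comp hermProj).prodMap
    (((mulOp (cutoff n)).restrictScalars ℝ).comp hermProj)

lemma pairProj_apply (n : ℝ) (x : H × H) :
    pairProj n x = (mulOp (cutoff n) (hermProj x.1), mulOp (cutoff n) (hermProj x.2)) := rfl

lemma pairProj_eq {n : ℝ} {x : H × H} (h1 : IsHerm x.1) (h2 : IsHerm x.2) (b1 : IsBand n x.1)
    (b2 : IsBand n x.2) : pairProj n x = x := by
  rw [pairProj_apply, hermProj_eq h1, hermProj_eq h2]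
  exact Prod.ext b1 b2

lemma isHerm_cutoff {n : ℝ} {a : H} (ha : IsHerm a) : IsHerm (mulOp (cutoff n) a) :=
  ha.mulOp (isMult_cutoff n) (cutoff_neg n)

lemma isBand_cutJap (n : ℝ) (a : H) : IsBand n (mulOp (cutJap n) a) := by
  rw [IsBand, mulOp_mulOp (isMult_cutoff n) (isMult_cutJap n)]
  simp only [cutJap, ← mul_assoc, cutoff_mul_self]
  rfl

lemma IsBand.smul_real {n : ℝ} {a : H} (c : ℝ) (ha : IsBand n a) : IsBand n (c • a) := by
  have : mulOp (cutoff n) (c • a) = c • mulOp (cutoff n) a :=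
    ((mulOp (cutoff n)).restrictScalars ℝ).map_smul c a
  rw [IsBand, this, ha]

lemma mulOp_smul_real (m : ℝ → ℝ) (c : ℝ) (a : H) : mulOp m (c • a) = c • mulOp m a :=
  ((mulOp m).restrictScalars ℝ).map_smul c a

lemma ramp_one_eq : mulOp (ramp 1) = ContinuousLinearMap.id ℂ H := by
  ext1 a
  refine Lp.ext ?_
  filter_upwards [mulOp_ae (isMult_ramp le_rfl) a] with ξ h
  rw [h, ramp_one, one_smul, ContinuousLinearMap.id_apply]

/-- The energy inequality for a curve which solves the truncated system up to a retraction. -/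
lemma energy_le_of_truncated {s : ℝ} (hs : 3 / 2 < s) {C M N n T : ℝ} (hC0 : 0 < C)
    (hC : ∀ a b : H, IsHerm a → IsBand n a → IsBand n b →
      |inner ℝ (mulOp (ramp N) a) (mulOp (ramp N) (mulOp (cutJap n) (fieldU hs a b)))| +
      |inner ℝ (mulOp (ramp N) b) (mulOp (ramp N) (mulOp (cutJap n) (fieldEta hs a b)))| ≤
        C * (1 + ‖a‖ + ‖b‖) * (‖mulOp (ramp N) a‖ ^ 2 + ‖mulOp (ramp N) b‖ ^ 2))
    (hM : 0 < M) {V : ℝ → H × H} (hh : ∀ t, IsHerm (V t).1) (hb1 : ∀ t, IsBand n (V t).1)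
    (hb2 : ∀ t, IsBand n (V t).2)
    (hV : ∀ t ∈ Icc 0 T, HasDerivWithinAt V (truncField hs n (radial M (V t))) (Icc 0 T) t) :
    ∀ t ∈ Icc 0 T, ‖mulOp (ramp N) (V t).1‖ ^ 2 + ‖mulOp (ramp N) (V t).2‖ ^ 2 ≤
      (‖mulOp (ramp N) (V 0).1‖ ^ 2 + ‖mulOp (ramp N) (V 0).2‖ ^ 2) *
        Real.exp ((2 * C * (1 + 2 * M) ) * t) := by
  set G : H →L[ℝ] H := (mulOp (ramp N)).restrictScalars ℝ with hG
  set f' : ℝ → ℝ := fun t ↦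
    2 * inner ℝ (G (V t).1) (G (truncField hs n (radial M (V t))).1) +
    2 * inner ℝ (G (V t).2) (G (truncField hs n (radial M (V t))).2) with hf'
  have hd : ∀ t ∈ Icc 0 T, HasDerivWithinAt (fun t ↦ ‖G (V t).1‖ ^ 2 + ‖G (V t).2‖ ^ 2) (f' t)
      (Icc 0 T) t := fun t ht ↦ by
    have h1 : HasDerivWithinAt (fun τ ↦ (V τ).1) (truncField hs n (radial M (V t))).1
        (Icc 0 T) t :=
      (ContinuousLinearMap.fst ℝ H H).hasFDerivAt.comp_hasDerivWithinAt t (hV t ht)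
    have h2 : HasDerivWithinAt (fun τ ↦ (V τ).2) (truncField hs n (radial M (V t))).2
        (Icc 0 T) t :=
      (ContinuousLinearMap.snd ℝ H H).hasFDerivAt.comp_hasDerivWithinAt t (hV t ht)
    exact (G.hasFDerivAt.comp_hasDerivWithinAt t h1).norm_sq.add
      (G.hasFDerivAt.comp_hasDerivWithinAt t h2).norm_sq
  have hb : ∀ t ∈ Icc 0 T, |f' t| ≤ 2 * C * (1 + 2 * M) * (‖G (V t).1‖ ^ 2 + ‖G (V t).2‖ ^ 2) := by
    intro t _
    -- The energy pairs V with the field at r V, whereas the estimate pairs r V with that field. The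
    -- left side scales like r and the right side like r² ≤ r, so one factor r cancels. The
    -- coefficient only sees r V, whose components are bounded by M, so the growth rate is constant.
    obtain ⟨r, hr0, hr1, hr⟩ := exists_radial_eq M (V t)
    have hn := norm_radial_le hM (V t)
    have n1 := (norm_fst_le (radial M (V t))).trans hn
    have n2 := (norm_snd_le (radial M (V t))).trans hn
    have e1 : (radial M (V t)).1 = r • (V t).1 := by rw [hr]; rfl
    have e2 : (radial M (V t)).2 = r • (V t).2 := by rw [hr]; rfl
    have h := hC (radial M (V t)).1 (radial M (V t)).2 (by rw [e1]; exact (hh t).smul_real r)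
      (by rw [e1]; exact (hb1 t).smul_real r) (by rw [e2]; exact (hb2 t).smul_real r)
    have e3 : mulOp (ramp N) (radial M (V t)).1 = r • G (V t).1 := by
      rw [e1, mulOp_smul_real]; rfl
    have e4 : mulOp (ramp N) (radial M (V t)).2 = r • G (V t).2 := by
      rw [e2, mulOp_smul_real]; rfl
    rw [e3, e4, real_inner_smul_left, real_inner_smul_left, abs_mul, abs_mul, abs_of_pos hr0,
      norm_smul, norm_smul, Real.norm_of_nonneg hr0.le] at h
    set X := inner ℝ (G (V t).1) (G (truncField hs n (radial M (V t))).1) with hX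
    set Y := inner ℝ (G (V t).2) (G (truncField hs n (radial M (V t))).2) with hY
    set S := ‖G (V t).1‖ ^ 2 + ‖G (V t).2‖ ^ 2 with hS
    have hS0 : 0 ≤ S := by positivity
    have h' : r * (|X| + |Y|) ≤ r * (C * (1 + 2 * M) * S) := by
      calc r * (|X| + |Y|) = r * |X| + r * |Y| := by ring
        _ ≤ C * (1 + ‖(radial M (V t)).1‖ + ‖(radial M (V t)).2‖) *
          ((r * ‖G (V t).1‖) ^ 2 + (r * ‖G (V t).2‖) ^ 2) := h
        _ = C * (1 + ‖(radial M (V t)).1‖ + ‖(radial M (V t)).2‖) * (r * r * S) := by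
          rw [hS]; ring
        _ ≤ C * (1 + 2 * M) * (r * 1 * S) := by
          have : 1 + ‖(radial M (V t)).1‖ + ‖(radial M (V t)).2‖ ≤ 1 + 2 * M := by linarith
          gcongr
        _ = _ := by ring
    have h'' := le_of_mul_le_mul_left h' hr0
    refine (abs_add_le _ _).trans ?_
    rw [abs_mul, abs_mul, abs_two]
    linarith
  intro t ht
  have hT : (0 : ℝ) ∈ Icc 0 T := ⟨le_rfl, ht.1.trans ht.2⟩
  set f : ℝ → ℝ := fun t ↦ ‖G (V t).1‖ ^ 2 + ‖G (V t).2‖ ^ 2 with hf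
  have hf0 : ∀ t, 0 ≤ f t := fun t ↦ by simp only [hf]; positivity
  have h := norm_le_gronwallBound_of_norm_deriv_right_le (f := f) (f' := f') (δ := f 0)
    (K := 2 * C * (1 + 2 * M)) (ε := 0) (a := 0) (b := T) (fun t ht ↦ (hd t ht).continuousWithinAt)
    (fun t ht ↦ hasDerivWithinAt_Ici_of_Icc ht (hd t ⟨ht.1, ht.2.le⟩))
    (by rw [Real.norm_of_nonneg (hf0 0)])
    (fun t ht ↦ by
      rw [Real.norm_of_nonneg (hf0 t), add_zero]; exact hb t ⟨ht.1, ht.2.le⟩) t ht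
  rwa [gronwallBound_ε0, sub_zero, Real.norm_of_nonneg (hf0 t)] at h

/-- Solutions of the truncated system, with bounds uniform in the truncation. -/
theorem exists_truncated {s : ℝ} (hs : 3 / 2 < s) {C : ℝ} (hC0 : 0 < C)
    (hC : ∀ (N n : ℝ) (a b : H), 1 ≤ N → IsHerm a → IsBand n a → IsBand n b →
      |inner ℝ (mulOp (ramp N) a) (mulOp (ramp N) (mulOp (cutJap n) (fieldU hs a b)))| +
      |inner ℝ (mulOp (ramp N) b) (mulOp (ramp N) (mulOp (cutJap n) (fieldEta hs a b)))| ≤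
        C * (1 + ‖a‖ + ‖b‖) * (‖mulOp (ramp N) a‖ ^ 2 + ‖mulOp (ramp N) b‖ ^ 2))
    {m M T : ℝ} (hT : 0 ≤ T) (hM : 0 < M)
    (hmM : Real.exp (C * (1 + 2 * M) * T) * m ≤ M) (n : ℝ) {a₀ b₀ : H} (ha₀ : IsHerm a₀)
    (hb₀ : IsHerm b₀) (h0 : ‖a₀‖ + ‖b₀‖ ≤ m) :
    ∃ a b : ℝ → H, a 0 = mulOp (cutoff n) a₀ ∧ b 0 = mulOp (cutoff n) b₀ ∧
      (∀ t, IsHerm (a t) ∧ IsHerm (b t) ∧ IsBand n (a t) ∧ IsBand n (b t)) ∧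
      (∀ t ∈ Icc 0 T, ‖a t‖ ≤ M ∧ ‖b t‖ ≤ M) ∧
      (∀ t ∈ Icc 0 T,
        HasDerivWithinAt a (mulOp (cutJap n) (fieldU hs (a t) (b t))) (Icc 0 T) t ∧
        HasDerivWithinAt b (mulOp (cutJap n) (fieldEta hs (a t) (b t))) (Icc 0 T) t) ∧
      ∀ N : ℝ, 1 ≤ N → ∀ t ∈ Icc 0 T, ‖mulOp (ramp N) (a t)‖ ^ 2 + ‖mulOp (ramp N) (b t)‖ ^ 2 ≤
        (‖mulOp (ramp N) a₀‖ ^ 2 + ‖mulOp (ramp N) b₀‖ ^ 2) *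
          Real.exp (2 * C * (1 + 2 * M) * T) := by
  obtain ⟨K, hK⟩ := exists_truncField_sub_le hs n M
  -- The retraction makes the field globally Lipschitz and bounded, so the solution exists on all of
  -- [0, T] without a continuation argument. The projection forces Hermitian symmetry and band
  -- limitation, which the energy estimate presupposes.
  set Φ : H × H → H × H := fun x ↦ pairProj n (truncField hs n (radial M (pairProj n x))) with hΦ
  have hΦ_sub : ∀ x y, ‖Φ x - Φ y‖ ≤
      ‖pairProj n‖₊ * (K * (2 * ‖pairProj n‖₊)) * ‖x - y‖ := fun x y ↦ by
    simp only [hΦ]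
    rw [← map_sub]
    refine ((pairProj n).le_opNorm _).trans ?_
    rw [mul_assoc]
    refine mul_le_mul_of_nonneg_left ?_ (norm_nonneg _)
    refine (hK _ _ (norm_radial_le hM _) (norm_radial_le hM _)).trans ?_
    rw [mul_assoc]
    refine mul_le_mul_of_nonneg_left ?_ K.coe_nonneg
    refine (norm_radial_sub_le hM _ _).trans ?_
    rw [mul_assoc, ← map_sub]
    exact mul_le_mul_of_nonneg_left ((pairProj n).le_opNorm _) (by norm_num)
  have hΦ0 : truncField hs n 0 = 0 := by
    simp [truncField, fieldU, fieldEta]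
  have hΦ_le : ∀ x, ‖Φ x‖ ≤ ‖pairProj n‖₊ * (K * ⟨M, hM.le⟩ : ℝ≥0) := fun x ↦ by
    refine ((pairProj n).le_opNorm _).trans (mul_le_mul_of_nonneg_left ?_ (norm_nonneg _))
    have h := hK (radial M (pairProj n x)) 0 (norm_radial_le hM _) (by simpa using hM.le)
    rw [hΦ0, sub_zero, sub_zero] at h
    exact h.trans (mul_le_mul_of_nonneg_left (norm_radial_le hM _) K.coe_nonneg)
  set L : ℝ≥0 := ‖pairProj n‖₊ * (K * ⟨M, hM.le⟩) with hL
  -- As Φ is bounded by L everywhere, a ball of radius L T contains the solution up to time T.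
  have hPL : IsPicardLindelof (fun _ ↦ Φ) (tmin := 0) (tmax := T) ⟨0, le_rfl, hT⟩ (a₀, b₀)
      (L * ⟨T, hT⟩) 0 L (‖pairProj n‖₊ * (K * (2 * ‖pairProj n‖₊))) :=
    { lipschitzOnWith := fun t _ ↦ LipschitzOnWith.of_dist_le_mul fun x _ y _ ↦ by
        rw [dist_eq_norm, dist_eq_norm]; exact_mod_cast hΦ_sub x y
      continuousOn := fun x _ ↦ continuousOn_const
      norm_le := fun t _ x _ ↦ by rw [hL]; exact_mod_cast hΦ_le x
      mul_max_le := by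
        simp only [sub_zero, NNReal.coe_zero, sub_self]
        rw [max_eq_left hT]
        exact (NNReal.coe_mul L ⟨T, hT⟩).ge }
  obtain ⟨U, hU0, hU⟩ := hPL.exists_eq_forall_mem_Icc_hasDerivWithinAt₀
  set V : ℝ → H × H := fun t ↦ pairProj n (U t) with hV
  have hh1 : ∀ t, IsHerm (V t).1 := fun t ↦ isHerm_cutoff (isHerm_hermProj _)
  have hh2 : ∀ t, IsHerm (V t).2 := fun t ↦ isHerm_cutoff (isHerm_hermProj _)
  have hb1 : ∀ t, IsBand n (V t).1 := fun t ↦ isBand_mulOp_cutoff _ _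
  have hb2 : ∀ t, IsBand n (V t).2 := fun t ↦ isBand_mulOp_cutoff _ _
  have hrh : ∀ t, IsHerm (radial M (V t)).1 ∧ IsHerm (radial M (V t)).2 := fun t ↦ by
    obtain ⟨r, _, _, hr⟩ := exists_radial_eq M (V t)
    rw [hr]
    exact ⟨(hh1 t).smul_real r, (hh2 t).smul_real r⟩
  -- The truncated field already maps Hermitian band-limited pairs to such pairs, so the projected
  -- curve V solves the equation without the projection.
  have hfix : ∀ t, pairProj n (truncField hs n (radial M (V t))) =
      truncField hs n (radial M (V t)) := fun t ↦
    pairProj_eq (((hrh t).1.fieldU hs (hrh t).2).mulOp (isMult_cutJap n) (cutJap_neg n))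
      (((hrh t).1.fieldEta hs (hrh t).2).mulOp (isMult_cutJap n) (cutJap_neg n))
      (isBand_cutJap _ _) (isBand_cutJap _ _)
  have hVd : ∀ t ∈ Icc 0 T,
      HasDerivWithinAt V (truncField hs n (radial M (V t))) (Icc 0 T) t := fun t ht ↦ by
    have h := (pairProj n).hasFDerivAt.comp_hasDerivWithinAt t (hU t ht)
    have e : pairProj n (Φ (U t)) = truncField hs n (radial M (V t)) := by
      simp only [hΦ]
      rw [hfix t, hfix t]
    rw [e] at h
    exact h
  have hV0 : V 0 = (mulOp (cutoff n) a₀, mulOp (cutoff n) b₀) := by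
    simp only [hV]
    rw [hU0, pairProj_apply, hermProj_eq ha₀, hermProj_eq hb₀]
  have hcut : ∀ N : ℝ, 1 ≤ N → ∀ x : H, ‖mulOp (ramp N) (mulOp (cutoff n) x)‖ ≤
      ‖mulOp (ramp N) x‖ := fun N hN x ↦ by
    rw [mulOp_comm (isMult_ramp hN) (isMult_cutoff n)]
    simpa using norm_mulOp_le (isMult_cutoff n) (mulOp (ramp N) x)
  have key : ∀ N : ℝ, 1 ≤ N → ∀ t ∈ Icc 0 T,
      ‖mulOp (ramp N) (V t).1‖ ^ 2 + ‖mulOp (ramp N) (V t).2‖ ^ 2 ≤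
        (‖mulOp (ramp N) a₀‖ ^ 2 + ‖mulOp (ramp N) b₀‖ ^ 2) *
          Real.exp (2 * C * (1 + 2 * M) * T) := fun N hN t ht ↦ by
    refine (energy_le_of_truncated hs hC0 (fun a b ↦ hC N n a b hN) hM hh1 hb1 hb2 hVd t
      ht).trans ?_
    rw [hV0]
    have h1 := hcut N hN a₀
    have h2 := hcut N hN b₀
    have h3 := ht.2
    gcongr
  -- With N = 1 the weighted estimate is the plain one, and the hypothesis relating m, M and T keeps
  -- both components below M. The retraction is then inactive along the curve and can be dropped.
  have hVM : ∀ t ∈ Icc 0 T, ‖(V t).1‖ ≤ M ∧ ‖(V t).2‖ ≤ M := fun t ht ↦ by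
    have h := key 1 le_rfl t ht
    simp only [ramp_one_eq, ContinuousLinearMap.id_apply] at h
    have e : Real.exp (2 * C * (1 + 2 * M) * T) = Real.exp (C * (1 + 2 * M) * T) ^ 2 := by
      rw [← Real.exp_nat_mul]; congr 1; push_cast; ring
    have na := norm_nonneg a₀
    have nb := norm_nonneg b₀
    have h1 : ‖a₀‖ ^ 2 + ‖b₀‖ ^ 2 ≤ m ^ 2 := by nlinarith
    have h2 : ‖(V t).1‖ ^ 2 + ‖(V t).2‖ ^ 2 ≤ M ^ 2 := by
      refine h.trans ?_
      rw [e]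
      calc _ ≤ m ^ 2 * Real.exp (C * (1 + 2 * M) * T) ^ 2 := by gcongr
        _ = (Real.exp (C * (1 + 2 * M) * T) * m) ^ 2 := by ring
        _ ≤ M ^ 2 := by
          have : 0 ≤ m := by linarith
          gcongr
    constructor
    · exact abs_le_of_sq_le_sq (by nlinarith [sq_nonneg ‖(V t).2‖]) hM.le |>.trans' (le_abs_self _)
    · exact abs_le_of_sq_le_sq (by nlinarith [sq_nonneg ‖(V t).1‖]) hM.le |>.trans' (le_abs_self _)
  refine ⟨fun t ↦ (V t).1, fun t ↦ (V t).2, congrArg Prod.fst hV0, congrArg Prod.snd hV0,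
    fun t ↦ ⟨hh1 t, hh2 t, hb1 t, hb2 t⟩, hVM, fun t ht ↦ ?_, key⟩
  have h := hVd t ht
  rw [radial_eq hM (max_le (hVM t ht).1 (hVM t ht).2)] at h
  exact ⟨(ContinuousLinearMap.fst ℝ H H).hasFDerivAt.comp_hasDerivWithinAt t h,
    (ContinuousLinearMap.snd ℝ H H).hasFDerivAt.comp_hasDerivWithinAt t h⟩

/-! ### High frequencies -/

lemma norm_sub_cutoff_le {N n : ℝ} (hN : 1 ≤ N) (hn : N ≤ n) (x : H) :
    ‖x - mulOp (cutoff n) x‖ ≤ ‖mulOp (ramp N) x‖ := by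
  refine Lp.norm_le_norm_of_ae_le ?_
  filter_upwards [Lp.coeFn_sub x (mulOp (cutoff n) x), mulOp_ae (isMult_cutoff n) x,
    mulOp_ae (isMult_ramp hN) x] with ξ h1 h2 h3
  rw [h1, Pi.sub_apply, h2, h3, cutoff]
  split_ifs with h
  · rw [one_smul, sub_self, norm_zero]; positivity
  · have h4 : N ≤ jap ξ := hn.trans (not_le.1 h).le
    have : ramp N ξ = 1 := by
      rw [ramp, rampFun, min_eq_left]
      rwa [one_le_div (by linarith)]
    simp [this]

lemma norm_sub_cutoff_le_norm (n : ℝ) (x : H) : ‖x - mulOp (cutoff n) x‖ ≤ ‖x‖ := by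
  refine Lp.norm_le_norm_of_ae_le ?_
  filter_upwards [Lp.coeFn_sub x (mulOp (cutoff n) x), mulOp_ae (isMult_cutoff n) x] with ξ h1 h2
  rw [h1, Pi.sub_apply, h2, cutoff]
  split_ifs <;> simp

lemma norm_cutoff_le (n : ℝ) (x : H) : ‖mulOp (cutoff n) x‖ ≤ ‖x‖ := by
  simpa using norm_mulOp_le (isMult_cutoff n) x

lemma norm_invJap_le (x : H) : ‖mulOp invJap x‖ ≤ ‖x‖ := by
  simpa using norm_mulOp_le isMult_invJap x

lemma norm_cutoff_le_mul {N : ℝ} (hN : 0 ≤ N) (x : H) : ‖mulOp (cutoff N) x‖ ≤ N * ‖mulOp invJap x‖ := by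
  refine Lp.norm_le_mul_norm_of_ae_le_mul ?_
  filter_upwards [mulOp_ae (isMult_cutoff N) x, mulOp_ae isMult_invJap x] with ξ h1 h2
  rw [h1, h2, norm_smul, norm_smul, ← mul_assoc]
  refine mul_le_mul_of_nonneg_right ?_ (norm_nonneg _)
  have h3 := jap_pos ξ
  rw [invJap, norm_inv, Real.norm_of_nonneg h3.le, ← div_eq_mul_inv, cutoff]
  split_ifs with h
  · rw [norm_one, one_le_div h3]; exact h
  · rw [norm_zero]
    positivity

/-- Frequencies with J > N are seen in full by the ramp, those with J ≤ N lose at most a factor N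
against J⁻¹. A bound one derivative lower together with a tail bound thus controls the norm of H;
this upgrades weak convergence of the approximations to convergence at full regularity. -/
lemma norm_le_tail_add {N : ℝ} (hN : 1 ≤ N) (x : H) :
    ‖x‖ ≤ ‖mulOp (ramp N) x‖ + N * ‖mulOp invJap x‖ := by
  have h1 := norm_sub_cutoff_le hN le_rfl x
  have h2 := norm_cutoff_le_mul (zero_le_one.trans hN) x
  have h3 := norm_le_norm_sub_add x (mulOp (cutoff N) x)
  linarith

/-- For one fixed function the ramped norms tend to zero by dominated convergence. Applied to the
initial data only, it makes the tails of all approximations uniformly small. -/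
lemma tendsto_norm_ramp (x : H) :
    Tendsto (fun i : ℕ ↦ ‖mulOp (ramp ((i : ℝ) + 1)) x‖) atTop (𝓝 0) := by
  have hN : ∀ i : ℕ, (1 : ℝ) ≤ (i : ℝ) + 1 := fun i ↦ by
    have : (0 : ℝ) ≤ i := i.cast_nonneg
    linarith
  have hsq : ∀ i : ℕ, ‖mulOp (ramp ((i : ℝ) + 1)) x‖ ^ 2 =
      ∫ ξ, ramp ((i : ℝ) + 1) ξ ^ 2 * ‖x ξ‖ ^ 2 := fun i ↦ by
    have h : ‖mulOp (ramp ((i : ℝ) + 1)) x‖ ^ 2 = inner ℝ (mulOp (ramp ((i : ℝ) + 1)) x)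
      (mulOp (ramp ((i : ℝ) + 1)) x) := (real_inner_self_eq_norm_sq _).symm
    rw [h, L2.inner_def]
    refine integral_congr_ae ?_
    filter_upwards [mulOp_ae (isMult_ramp (hN i)) x] with ξ h
    rw [real_inner_self_eq_norm_sq, h, norm_smul, mul_pow, Real.norm_eq_abs, sq_abs]
  have hlim : Tendsto (fun i : ℕ ↦ ∫ ξ, ramp ((i : ℝ) + 1) ξ ^ 2 * ‖x ξ‖ ^ 2) atTop
      (𝓝 (∫ _ : ℝ, (0 : ℝ))) := by
    refine tendsto_integral_of_dominated_convergence (fun ξ ↦ ‖x ξ‖ ^ 2) (fun i ↦ ?_)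
      ((memLp_two_iff_integrable_sq_norm (Lp.aestronglyMeasurable x)).1 (Lp.memLp x))
      (fun i ↦ ae_of_all _ fun ξ ↦ ?_) (ae_of_all _ fun ξ ↦ ?_)
    · exact (((measurable_ramp _).pow_const 2).mul
        ((measurable_coe x).norm.pow_const 2)).aestronglyMeasurable
    · rw [Real.norm_of_nonneg (by positivity)]
      refine mul_le_of_le_one_left (by positivity) ?_
      exact pow_le_one₀ (ramp_pos (hN i) ξ).le (ramp_le_one _ _)
    · have h1 : Tendsto (fun i : ℕ ↦ ramp ((i : ℝ) + 1) ξ) atTop (𝓝 0) := by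
        refine squeeze_zero (fun i ↦ (ramp_pos (hN i) ξ).le) (fun i ↦ min_le_right _ _) ?_
        exact tendsto_const_nhds.div_atTop (tendsto_atTop_add_const_right _ _
          tendsto_natCast_atTop_atTop)
      simpa using (h1.pow 2).mul_const (‖x ξ‖ ^ 2)
  rw [integral_zero] at hlim
  have h := hlim.sqrt
  rw [Real.sqrt_zero] at h
  refine h.congr fun i ↦ ?_
  rw [← hsq, Real.sqrt_sq (norm_nonneg _)]

/-- Two factors supported in J ≤ N have a convolution supported in J ≤ 2N, by subadditivity of the
bracket. -/
lemma cutoff_algOp {τ N n : ℝ} (hτ : 1 / 2 < τ) (hn : 2 * N ≤ n) (x y : H) :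
    mulOp (cutoff n) (algOp τ hτ (mulOp (cutoff N) x) (mulOp (cutoff N) y)) =
      algOp τ hτ (mulOp (cutoff N) x) (mulOp (cutoff N) y) := by
  refine Lp.ext ?_
  filter_upwards [mulOp_ae (isMult_cutoff n) (algOp τ hτ (mulOp (cutoff N) x)
    (mulOp (cutoff N) y)), algOp_ae hτ (mulOp (cutoff N) x) (mulOp (cutoff N) y)] with ξ h1 h2
  rw [h1, cutoff]
  split_ifs with h
  · rw [one_smul]
  · have : conv (low τ (mulOp (cutoff N) x)) (low τ (mulOp (cutoff N) y)) ξ = 0 := by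
      rw [conv_congr (low_congr (mulOp_ae (isMult_cutoff N) x))
        (low_congr (mulOp_ae (isMult_cutoff N) y))]
      refine integral_eq_zero_of_ae (ae_of_all _ fun ζ ↦ ?_)
      have h3 := jap_le_add ξ ζ
      simp only [low, cutoff, Pi.zero_apply]
      rcases lt_or_ge N (jap ζ) with h4 | h4
      · rw [if_neg (not_le.2 h4)]; simp
      · rw [if_neg (c := jap (ξ - ζ) ≤ N) (by linarith [not_le.1 h])]; simp
    rw [h2, this]; simp

/-- The product of the low-frequency parts is untouched by the cutoff. What remains contains a
high-frequency factor, bounded by its ramped norm. -/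
lemma norm_algOp_sub_cutoff_le {τ N n : ℝ} (hτ : 1 / 2 < τ) (hN : 1 ≤ N) (hn : 2 * N ≤ n)
    (x y : H) :
    ‖algOp τ hτ x y - mulOp (cutoff n) (algOp τ hτ x y)‖ ≤
      algConst τ * (‖mulOp (ramp N) x‖ * ‖y‖ + ‖x‖ * ‖mulOp (ramp N) y‖) := by
  set z := algOp τ hτ (x - mulOp (cutoff N) x) y +
    algOp τ hτ (mulOp (cutoff N) x) (y - mulOp (cutoff N) y) with hz
  have e : algOp τ hτ x y = z + algOp τ hτ (mulOp (cutoff N) x) (mulOp (cutoff N) y) := by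
    rw [hz]; simp only [map_sub, sub_apply]; abel
  have hc := algConst_nonneg τ
  rw [e, map_add, cutoff_algOp hτ hn, add_sub_add_right_eq_sub]
  refine (norm_sub_cutoff_le_norm n z).trans ((norm_add_le _ _).trans ?_)
  have h1 := norm_algOp_le hτ (x - mulOp (cutoff N) x) y
  have h2 := norm_algOp_le hτ (mulOp (cutoff N) x) (y - mulOp (cutoff N) y)
  have h3 := norm_sub_cutoff_le hN le_rfl x
  have h4 := norm_sub_cutoff_le hN le_rfl y
  have h5 := norm_cutoff_le N x
  calc _ ≤ algConst τ * ‖mulOp (ramp N) x‖ * ‖y‖ + algConst τ * ‖x‖ * ‖mulOp (ramp N) y‖ := by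
        refine add_le_add (h1.trans ?_) (h2.trans ?_) <;> gcongr
    _ = _ := by ring

lemma freqSymb_sub_cutoff {j : ℕ} (hj : 1 ≤ j) (n : ℝ) (x : H) :
    mulOp (freqSymb j) x - mulOp (cutoff n) (mulOp (freqSymb j) x) =
      mulOp (freqSymb j) (x - mulOp (cutoff n) x) := by
  rw [map_sub, mulOp_comm (isMult_cutoff n) (isMult_freqSymb hj)]

/-- The consistency error of the truncation. The linear terms contribute nothing, since multipliers
commute with the cutoff and a, b are band limited; the quadratic term is small with the tail of a.
-/
lemma norm_fieldU_sub_cutoff_le {s N n : ℝ} (hs : 3 / 2 < s) (hN : 1 ≤ N) (hn : 2 * N ≤ n)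
    {a b : H} (ha : IsBand n a) (hb : IsBand n b) :
    ‖mulOp (cutoff n) (fieldU hs a b) - fieldU hs a b‖ ≤
      algConst s * (‖mulOp (ramp N) a‖ * ‖a‖) := by
  have e : fieldU hs a b - mulOp (cutoff n) (fieldU hs a b) = -(Complex.I / 2) •
      mulOp (freqSymb 1) (algOp s (by linarith) a a -
        mulOp (cutoff n) (algOp s (by linarith) a a)) := by
    rw [← freqSymb_sub_cutoff le_rfl]
    have h2 := freqSymb_sub_cutoff (j := 2) (by norm_num) n b
    have h3 := freqSymb_sub_cutoff (j := 3) (by norm_num) n a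
    rw [hb, sub_self, map_zero, sub_eq_zero] at h2
    rw [ha, sub_self, map_zero, sub_eq_zero] at h3
    simp only [fieldU, map_add, map_sub, map_smul]
    rw [← h2, ← h3, smul_sub]
    abel
  rw [norm_sub_rev, e, norm_smul, norm_neg, norm_div, Complex.norm_I]
  have h1 := norm_mulOp_le (isMult_freqSymb (j := 1) le_rfl) (algOp s (by linarith) a a -
        mulOp (cutoff n) (algOp s (by linarith) a a))
  have h2 := norm_algOp_sub_cutoff_le (τ := s) (by linarith) hN hn a a
  norm_num at h1 ⊢
  linarith

lemma norm_fieldEta_sub_cutoff_le {s N n : ℝ} (hs : 3 / 2 < s) (hN : 1 ≤ N) (hn : 2 * N ≤ n)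
    (a b : H) :
    ‖mulOp (cutoff n) (fieldEta hs a b) - fieldEta hs a b‖ ≤
      algConst (s - 1) * (‖mulOp (ramp N) b‖ * ‖a‖ + ‖b‖ * ‖mulOp (ramp N) a‖) := by
  have e : fieldEta hs a b - mulOp (cutoff n) (fieldEta hs a b) = -Complex.I •
      mulOp (freqSymb 1) (algOp (s - 1) (by linarith) b (mulOp invJap a) -
        mulOp (cutoff n) (algOp (s - 1) (by linarith) b (mulOp invJap a))) := by
    rw [← freqSymb_sub_cutoff le_rfl]
    simp only [fieldEta, map_smul]
    rw [smul_sub]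
  rw [norm_sub_rev, e, norm_smul, norm_neg, Complex.norm_I, one_mul]
  have h1 := norm_mulOp_le (isMult_freqSymb (j := 1) le_rfl)
    (algOp (s - 1) (by linarith) b (mulOp invJap a) -
        mulOp (cutoff n) (algOp (s - 1) (by linarith) b (mulOp invJap a)))
  have h2 := norm_algOp_sub_cutoff_le (τ := s - 1) (by linarith) hN hn b (mulOp invJap a)
  refine (h1.trans_eq (one_mul _)).trans (h2.trans ?_)
  have hc := algConst_nonneg (s - 1)
  rw [mulOp_comm (isMult_ramp hN) isMult_invJap]
  have h3 := norm_invJap_le a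
  have h4 := norm_invJap_le (mulOp (ramp N) a)
  gcongr

lemma invJap_cutJap (n : ℝ) (x : H) : mulOp invJap (mulOp (cutJap n) x) = mulOp (cutoff n) x := by
  rw [mulOp_comm isMult_invJap (isMult_cutJap n), mulOp_mulOp (isMult_cutJap n) isMult_invJap]
  simp only [cutJap_mul_invJap]

lemma continuous_fieldU {s : ℝ} (hs : 3 / 2 < s) : Continuous fun x : H × H ↦ fieldU hs x.1 x.2 := by
  unfold fieldU; fun_prop

lemma continuous_fieldEta {s : ℝ} (hs : 3 / 2 < s) :
    Continuous fun x : H × H ↦ fieldEta hs x.1 x.2 := by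
  unfold fieldEta; fun_prop

/-! ### Existence -/

/-- N is fixed first, to make the tail term small; then i and j are taken large to beat the factor N
+ 1. The sequence is uniformly Cauchy, so the limit is continuous. -/
lemma exists_continuousOn_limit {T R : ℝ} (hR : 0 ≤ R) {q : ℕ → ℝ}
    (hq0 : ∀ i, 0 ≤ q i) (hq : Tendsto q atTop (𝓝 0)) {f : ℕ → ℝ → H}
    (hf : ∀ i, ContinuousOn (f i) (Icc 0 T))
    (h : ∀ N i j : ℕ, ∀ t ∈ Icc 0 T, ‖f i t - f j t‖ ≤ 2 * q N + (N + 1) * (R * (q i + q j))) :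
    ∃ g : ℝ → H, ContinuousOn g (Icc 0 T) ∧
      ∀ t ∈ Icc 0 T, Tendsto (fun i ↦ f i t) atTop (𝓝 (g t)) := by
  have hu : UniformCauchySeqOn f atTop (Icc 0 T) := by
    rw [Metric.uniformCauchySeqOn_iff]
    intro ε hε
    obtain ⟨N, hN⟩ := (hq.eventually (gt_mem_nhds (show 0 < ε / 4 by positivity))).exists
    have hd : 0 < ε / (4 * ((N + 1) * (R + 1))) := by positivity
    obtain ⟨I, hI⟩ := eventually_atTop.1 (hq.eventually (gt_mem_nhds hd))
    refine ⟨I, fun i hi j hj t ht ↦ ?_⟩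
    rw [dist_eq_norm]
    refine (h N i j t ht).trans_lt ?_
    have h1 := hI i hi
    have h2 := hI j hj
    rw [lt_div_iff₀ (by positivity)] at h1 h2
    have h3 : (N + 1) * (R * (q i + q j)) ≤ (N + 1) * ((R + 1) * (q i + q j)) := by
      have := hq0 i
      have := hq0 j
      gcongr
      linarith
    have h4 : (N + 1) * ((R + 1) * (q i + q j)) * 4 =
      q i * (4 * ((N + 1) * (R + 1))) + q j * (4 * ((N + 1) * (R + 1))) := by ring
    linarith
  have hc : ∀ t, ∃ x : H, t ∈ Icc 0 T → Tendsto (fun i ↦ f i t) atTop (𝓝 x) := fun t ↦ by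
    by_cases ht : t ∈ Icc 0 T
    · obtain ⟨x, hx⟩ := cauchySeq_tendsto_of_complete (hu.cauchySeq ht)
      exact ⟨x, fun _ ↦ hx⟩
    · exact ⟨0, fun h ↦ absurd h ht⟩
  choose g hg using hc
  refine ⟨g, ?_, hg⟩
  exact (hu.tendstoUniformlyOn_of_tendsto hg).continuousOn (Eventually.frequently
    (Eventually.of_forall hf))

/-- The equations are passed to the limit in integral form, by dominated convergence; no uniform
convergence of the derivatives is needed. -/
lemma hasDerivWithinAt_of_tendsto {T B : ℝ} {f F : ℕ → ℝ → H} {g G : ℝ → H}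
    (hF : ∀ i, ContinuousOn (F i) (Icc 0 T)) (hG : ContinuousOn G (Icc 0 T))
    (hB : ∀ i, ∀ t ∈ Icc 0 T, ‖F i t‖ ≤ B)
    (hd : ∀ i, ∀ t ∈ Icc 0 T, HasDerivWithinAt (f i) (F i t) (Icc 0 T) t)
    (hf : ∀ t ∈ Icc 0 T, Tendsto (fun i ↦ f i t) atTop (𝓝 (g t)))
    (hFG : ∀ t ∈ Icc 0 T, Tendsto (fun i ↦ F i t) atTop (𝓝 (G t))) :
    ∀ t ∈ Icc 0 T, HasDerivWithinAt g (G t) (Icc 0 T) t := by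
  refine hasDerivWithinAt_of_eq_add_integral hG fun t ht ↦ ?_
  have hT : (0 : ℝ) ∈ Icc 0 T := ⟨le_rfl, ht.1.trans ht.2⟩
  have hsub : uIoc 0 t ⊆ Icc 0 T := by
    rw [uIoc_of_le ht.1]
    exact fun x hx ↦ ⟨hx.1.le, hx.2.trans ht.2⟩
  have h1 : Tendsto (fun i ↦ f i 0 + ∫ τ in (0 : ℝ)..t, F i τ) atTop
      (𝓝 (g 0 + ∫ τ in (0 : ℝ)..t, G τ)) := by
    refine (hf 0 hT).add (intervalIntegral.tendsto_integral_filter_of_dominated_convergence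
      (fun _ ↦ B) (Eventually.of_forall fun i ↦ ?_) (Eventually.of_forall fun i ↦
        ae_of_all _ fun x hx ↦ hB i x (hsub hx)) intervalIntegrable_const
      (ae_of_all _ fun x hx ↦ hFG x (hsub hx)))
    exact ((hF i).mono hsub).aestronglyMeasurable measurableSet_uIoc
  refine tendsto_nhds_unique (hf t ht) (h1.congr fun i ↦ ?_)
  exact (eq_add_integral_of_hasDerivWithinAt (hF i) (hd i) t ht).symm

lemma norm_fieldU_le {s : ℝ} (hs : 3 / 2 < s) {a b : H} {M : ℝ} (ha : ‖a‖ ≤ M) (hb : ‖b‖ ≤ M) :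
    ‖fieldU hs a b‖ ≤ algConst s * M * M + (M + M) := by
  have h := norm_fieldU_sub_le hs a b 0 0
  have e : fieldU hs 0 0 = 0 := by simp [fieldU]
  have hc := algConst_nonneg s
  have hM : 0 ≤ M := (norm_nonneg a).trans ha
  simp only [e, sub_zero, norm_zero, add_zero] at h
  exact h.trans (by gcongr)

lemma norm_fieldEta_le {s : ℝ} (hs : 3 / 2 < s) {a b : H} {M : ℝ} (ha : ‖a‖ ≤ M) (hb : ‖b‖ ≤ M) :
    ‖fieldEta hs a b‖ ≤ algConst (s - 1) * M * M := by
  have h := norm_fieldEta_sub_le hs a b 0 0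
  have e : fieldEta hs 0 0 = 0 := by simp [fieldEta]
  have hc := algConst_nonneg (s - 1)
  have hM : 0 ≤ M := (norm_nonneg a).trans ha
  simp only [e, sub_zero, norm_zero, add_zero, mul_zero, zero_mul] at h
  exact h.trans (by gcongr)

lemma continuousOn_fieldU {s : ℝ} (hs : 3 / 2 < s) {a b : ℝ → H} {S : Set ℝ}
    (ha : ContinuousOn a S) (hb : ContinuousOn b S) :
    ContinuousOn (fun t ↦ fieldU hs (a t) (b t)) S :=
  (continuous_fieldU hs).comp_continuousOn (f := fun t ↦ (a t, b t)) (ha.prodMk hb)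

lemma continuousOn_fieldEta {s : ℝ} (hs : 3 / 2 < s) {a b : ℝ → H} {S : Set ℝ}
    (ha : ContinuousOn a S) (hb : ContinuousOn b S) :
    ContinuousOn (fun t ↦ fieldEta hs (a t) (b t)) S :=
  (continuous_fieldEta hs).comp_continuousOn (f := fun t ↦ (a t, b t)) (ha.prodMk hb)

lemma tendsto_of_sub_fieldU {s : ℝ} (hs : 3 / 2 < s) {a b F : ℕ → H} {A B : H} {δ : ℕ → ℝ}
    (hδ : Tendsto δ atTop (𝓝 0)) (hF : ∀ i, ‖F i - fieldU hs (a i) (b i)‖ ≤ δ i)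
    (ha : Tendsto a atTop (𝓝 A)) (hb : Tendsto b atTop (𝓝 B)) :
    Tendsto F atTop (𝓝 (fieldU hs A B)) := by
  have h0 : Tendsto (fun i ↦ (a i, b i)) atTop (𝓝 (A, B)) := ha.prodMk_nhds hb
  have h1 := ((continuous_fieldU hs).tendsto (A, B)).comp h0
  simp only [Function.comp_def] at h1
  have h3 := (squeeze_zero_norm hF hδ).add h1
  rw [zero_add] at h3
  exact h3.congr fun i ↦ sub_add_cancel _ _

lemma tendsto_of_sub_fieldEta {s : ℝ} (hs : 3 / 2 < s) {a b F : ℕ → H} {A B : H} {δ : ℕ → ℝ}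
    (hδ : Tendsto δ atTop (𝓝 0)) (hF : ∀ i, ‖F i - fieldEta hs (a i) (b i)‖ ≤ δ i)
    (ha : Tendsto a atTop (𝓝 A)) (hb : Tendsto b atTop (𝓝 B)) :
    Tendsto F atTop (𝓝 (fieldEta hs A B)) := by
  have h0 : Tendsto (fun i ↦ (a i, b i)) atTop (𝓝 (A, B)) := ha.prodMk_nhds hb
  have h1 := ((continuous_fieldEta hs).tendsto (A, B)).comp h0
  simp only [Function.comp_def] at h1
  have h3 := (squeeze_zero_norm hF hδ).add h1
  rw [zero_add] at h3
  exact h3.congr fun i ↦ sub_add_cancel _ _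

/-- The limit of approximate solutions is a solution. -/
lemma isCurve_of_tendsto {s : ℝ} (hs : 3 / 2 < s) {T B₁ B₂ : ℝ} {δ : ℕ → ℝ}
    (hδ : Tendsto δ atTop (𝓝 0)) {a b FU FE : ℕ → ℝ → H} {A B : ℝ → H}
    (hh : ∀ i, ∀ t ∈ Icc 0 T, IsHerm (a i t) ∧ IsHerm (b i t))
    (hFU : ∀ i, ContinuousOn (FU i) (Icc 0 T)) (hFE : ∀ i, ContinuousOn (FE i) (Icc 0 T))
    (hFUb : ∀ i, ∀ t ∈ Icc 0 T, ‖FU i t‖ ≤ B₁) (hFEb : ∀ i, ∀ t ∈ Icc 0 T, ‖FE i t‖ ≤ B₂)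
    (hdU : ∀ i, ∀ t ∈ Icc 0 T,
      HasDerivWithinAt (fun τ ↦ mulOp invJap (a i τ)) (FU i t) (Icc 0 T) t)
    (hdE : ∀ i, ∀ t ∈ Icc 0 T,
      HasDerivWithinAt (fun τ ↦ mulOp invJap (b i τ)) (FE i t) (Icc 0 T) t)
    (heU : ∀ i, ∀ t ∈ Icc 0 T, ‖FU i t - fieldU hs (a i t) (b i t)‖ ≤ δ i)
    (heE : ∀ i, ∀ t ∈ Icc 0 T, ‖FE i t - fieldEta hs (a i t) (b i t)‖ ≤ δ i)
    (hAc : ContinuousOn A (Icc 0 T)) (hBc : ContinuousOn B (Icc 0 T))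
    (hA : ∀ t ∈ Icc 0 T, Tendsto (fun i ↦ a i t) atTop (𝓝 (A t)))
    (hB : ∀ t ∈ Icc 0 T, Tendsto (fun i ↦ b i t) atTop (𝓝 (B t))) : IsCurve hs T A B := by
  refine ⟨fun t ht ↦ ?_, fun t ht ↦ ?_, hAc, hBc, ?_, ?_⟩
  · exact isClosed_isHerm.mem_of_tendsto (hA t ht) (Eventually.of_forall fun i ↦ (hh i t ht).1)
  · exact isClosed_isHerm.mem_of_tendsto (hB t ht) (Eventually.of_forall fun i ↦ (hh i t ht).2)
  · exact hasDerivWithinAt_of_tendsto hFU (continuousOn_fieldU hs hAc hBc) hFUb hdU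
      (fun t ht ↦ ((mulOp invJap).continuous.tendsto _).comp (hA t ht))
      (fun t ht ↦ tendsto_of_sub_fieldU hs hδ (fun i ↦ heU i t ht) (hA t ht) (hB t ht))
  · exact hasDerivWithinAt_of_tendsto hFE (continuousOn_fieldEta hs hAc hBc) hFEb hdE
      (fun t ht ↦ ((mulOp invJap).continuous.tendsto _).comp (hB t ht))
      (fun t ht ↦ tendsto_of_sub_fieldEta hs hδ (fun i ↦ heE i t ht) (hA t ht) (hB t ht))

-- Truncated solutions form a Cauchy sequence: their initial data and consistency errors differ by
-- tails of the initial data, so stability makes them close one derivative lower, and the uniform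
-- tail bounds lift this to H.
set_option maxHeartbeats 800000 in
lemma exists_isCurve_of_exp_le {s : ℝ} (hs : 3 / 2 < s) :
    ∃ C : ℝ, 0 < C ∧ ∀ m M T : ℝ, 0 ≤ T → 0 < M → Real.exp (C * (1 + 2 * M) * T) * m ≤ M →
      ∀ a₀ b₀ : H, IsHerm a₀ → IsHerm b₀ → ‖a₀‖ + ‖b₀‖ ≤ m →
        ∃ a b : ℝ → H, IsCurve hs T a b ∧ a 0 = a₀ ∧ b 0 = b₀ ∧
          ∀ t ∈ Icc 0 T, ‖a t‖ ≤ M ∧ ‖b t‖ ≤ M := by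
  obtain ⟨C, hC0, hC⟩ := exists_energy_top hs
  refine ⟨C, hC0, fun m M T hT hM hmM a₀ b₀ ha₀ hb₀ h0 ↦ ?_⟩
  have hN : ∀ i : ℕ, (1 : ℝ) ≤ (i : ℝ) + 1 := fun i ↦ by
    have : (0 : ℝ) ≤ i := i.cast_nonneg
    linarith
  have hNn : ∀ i : ℕ, (i : ℝ) + 1 ≤ 2 * ((i : ℝ) + 1) := fun i ↦ by linarith [hN i]
  -- The cutoff of the i-th approximation is twice the tail threshold i + 1, so products of
  -- frequencies below the threshold are not cut off.
  choose a b ha0 hb0 hprop hbd hderiv htail using fun i : ℕ ↦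
    exists_truncated hs hC0 hC hT hM hmM (2 * ((i : ℝ) + 1)) ha₀ hb₀ h0
  set X := Real.exp (C * (1 + 2 * M) * T) with hX
  have hX1 : 1 ≤ X := Real.one_le_exp (by positivity)
  -- The tail of the initial data times the growth factor X of the energy. It bounds the tails of
  -- every approximation at every time in [0, T].
  set q : ℕ → ℝ := fun i ↦ (‖mulOp (ramp ((i : ℝ) + 1)) a₀‖ + ‖mulOp (ramp ((i : ℝ) + 1)) b₀‖) * X
    with hq
  have hq0 : ∀ i, 0 ≤ q i := fun i ↦ by simp only [hq]; positivity
  have hqlim : Tendsto q atTop (𝓝 0) := by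
    simpa using ((tendsto_norm_ramp a₀).add (tendsto_norm_ramp b₀)).mul_const X
  have htail' : ∀ i N : ℕ, ∀ t ∈ Icc 0 T, ‖mulOp (ramp ((N : ℝ) + 1)) (a i t)‖ ≤ q N ∧
      ‖mulOp (ramp ((N : ℝ) + 1)) (b i t)‖ ≤ q N := fun i N t ht ↦ by
    have h := htail i _ (hN N) t ht
    have e : Real.exp (2 * C * (1 + 2 * M) * T) = X ^ 2 := by
      rw [hX, ← Real.exp_nat_mul]; congr 1; push_cast; ring
    have h1 : (‖mulOp (ramp ((N : ℝ) + 1)) a₀‖ ^ 2 + ‖mulOp (ramp ((N : ℝ) + 1)) b₀‖ ^ 2) * X ^ 2 ≤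
        q N ^ 2 := by
      simp only [hq]
      rw [mul_pow]
      gcongr
      nlinarith [norm_nonneg (mulOp (ramp ((N : ℝ) + 1)) a₀),
        norm_nonneg (mulOp (ramp ((N : ℝ) + 1)) b₀)]
    rw [e] at h
    have h2 := h.trans h1
    constructor
    · exact le_of_sq_le_sq (by linarith [sq_nonneg ‖mulOp (ramp ((N : ℝ) + 1)) (b i t)‖]) (hq0 N)
    · exact le_of_sq_le_sq (by linarith [sq_nonneg ‖mulOp (ramp ((N : ℝ) + 1)) (a i t)‖]) (hq0 N)
  -- Applying J⁻¹ to the truncated equation turns `cutJap` into `cutoff`. This is therefore the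
  -- derivative of J⁻¹ a, and it differs from the exact field by at most R₁ q i.
  set FU : ℕ → ℝ → H := fun i t ↦ mulOp (cutoff (2 * ((i : ℝ) + 1))) (fieldU hs (a i t) (b i t))
    with hFU
  set FE : ℕ → ℝ → H := fun i t ↦ mulOp (cutoff (2 * ((i : ℝ) + 1))) (fieldEta hs (a i t) (b i t))
    with hFE
  have c1 := algConst_nonneg s
  have c2 := algConst_nonneg (s - 1)
  set R₁ := (algConst s + 2 * algConst (s - 1)) * M with hR₁
  have hR₁0 : 0 ≤ R₁ := by positivity
  have heU : ∀ i, ∀ t ∈ Icc 0 T, ‖FU i t - fieldU hs (a i t) (b i t)‖ ≤ R₁ * q i := fun i t ht ↦ by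
    have h := norm_fieldU_sub_cutoff_le hs (hN i) le_rfl (hprop i t).2.2.1 (hprop i t).2.2.2
    have h1 := (htail' i i t ht).1
    have h2 := (hbd i t ht).1
    have h3 := hq0 i
    refine h.trans ?_
    calc _ ≤ algConst s * (q i * M) := by gcongr
      _ ≤ algConst s * (q i * M) + 2 * algConst (s - 1) * (q i * M) :=
        le_add_of_nonneg_right (by positivity)
      _ = _ := by rw [hR₁]; ring
  have heE : ∀ i, ∀ t ∈ Icc 0 T, ‖FE i t - fieldEta hs (a i t) (b i t)‖ ≤ R₁ * q i :=
    fun i t ht ↦ by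
    have h := norm_fieldEta_sub_cutoff_le hs (hN i) le_rfl (a i t) (b i t)
    have h1 := htail' i i t ht
    have h2 := hbd i t ht
    have h3 := hq0 i
    refine h.trans ?_
    calc _ ≤ algConst (s - 1) * (q i * M + M * q i) := by
          have := h1.1
          have := h1.2
          have := h2.1
          have := h2.2
          gcongr
      _ ≤ algConst s * (q i * M) + algConst (s - 1) * (q i * M + M * q i) :=
        le_add_of_nonneg_left (by positivity)
      _ = _ := by rw [hR₁]; ring
  have hdU : ∀ i, ∀ t ∈ Icc 0 T,
      HasDerivWithinAt (fun τ ↦ mulOp invJap (a i τ)) (FU i t) (Icc 0 T) t := fun i t ht ↦ by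
    have h := ((mulOp invJap).restrictScalars ℝ).hasFDerivAt.comp_hasDerivWithinAt t
      (hderiv i t ht).1
    refine h.congr_deriv ?_
    exact invJap_cutJap _ _
  have hdE : ∀ i, ∀ t ∈ Icc 0 T,
      HasDerivWithinAt (fun τ ↦ mulOp invJap (b i τ)) (FE i t) (Icc 0 T) t := fun i t ht ↦ by
    have h := ((mulOp invJap).restrictScalars ℝ).hasFDerivAt.comp_hasDerivWithinAt t
      (hderiv i t ht).2
    refine h.congr_deriv ?_
    exact invJap_cutJap _ _
  have hca : ∀ i, ContinuousOn (a i) (Icc 0 T) := fun i t ht ↦ (hderiv i t ht).1.continuousWithinAt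
  have hcb : ∀ i, ContinuousOn (b i) (Icc 0 T) := fun i t ht ↦ (hderiv i t ht).2.continuousWithinAt
  obtain ⟨L, hL1, hL⟩ := exists_stability hs M
  -- The 2 comes from the initial differences of the two components, each at most q i + q j, and the
  -- 4 R₁² from the consistency errors in the stability estimate.
  set R := Real.sqrt ((2 + 4 * R₁ ^ 2) * Real.exp (L * T)) with hR
  have hinit : ∀ (i : ℕ) (x : H), ‖mulOp (ramp ((i : ℝ) + 1)) x‖ * X ≤ q i →
      ‖mulOp (cutoff (2 * ((i : ℝ) + 1))) x - x‖ ≤ q i := fun i x hx ↦ by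
    rw [norm_sub_rev]
    refine (norm_sub_cutoff_le (hN i) (hNn i) x).trans (le_trans ?_ hx)
    exact le_mul_of_one_le_right (norm_nonneg _) hX1
  have hinit' : ∀ (i j : ℕ) (x : H), (∀ i : ℕ, ‖mulOp (ramp ((i : ℝ) + 1)) x‖ * X ≤ q i) →
      ‖mulOp invJap (mulOp (cutoff (2 * ((i : ℝ) + 1))) x - mulOp (cutoff (2 * ((j : ℝ) + 1))) x)‖ ≤
        q i + q j := fun i j x hx ↦ by
    refine (norm_invJap_le _).trans ?_
    have h1 := hinit i x (hx i)
    have h2 := hinit j x (hx j)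
    rw [norm_sub_rev] at h2
    exact (norm_sub_le_norm_sub_add_norm_sub _ x _).trans (add_le_add h1 h2)
  have hKd : ∀ i j : ℕ, ∀ t ∈ Icc 0 T, ‖mulOp invJap (a i t - a j t)‖ ≤ R * (q i + q j) ∧
      ‖mulOp invJap (b i t - b j t)‖ ≤ R * (q i + q j) := fun i j t ht ↦ by
    have hi := hq0 i
    have hj := hq0 j
    have hi1 : R₁ * q i ≤ R₁ * (q i + q j) := by gcongr; linarith
    have hj1 : R₁ * q j ≤ R₁ * (q i + q j) := by gcongr; linarith
    have h := hL T (R₁ * (q i + q j)) (a i) (b i) (a j) (b j)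
      (fun t ↦ FU i t - fieldU hs (a i t) (b i t)) (fun t ↦ FE i t - fieldEta hs (a i t) (b i t))
      (fun t ↦ FU j t - fieldU hs (a j t) (b j t)) (fun t ↦ FE j t - fieldEta hs (a j t) (b j t))
      (fun t _ ↦ (hprop i t).1) (fun t _ ↦ (hprop j t).1) (fun t ht ↦ (hbd i t ht).1)
      (fun t ht ↦ (hbd j t ht).1) (fun t ht ↦ (hbd j t ht).2)
      (fun t ht ↦ (heU i t ht).trans hi1) (fun t ht ↦ (heE i t ht).trans hi1)
      (fun t ht ↦ (heU j t ht).trans hj1) (fun t ht ↦ (heE j t ht).trans hj1)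
      (fun t ht ↦ by rw [add_sub_cancel]; exact hdU i t ht)
      (fun t ht ↦ by rw [add_sub_cancel]; exact hdE i t ht)
      (fun t ht ↦ by rw [add_sub_cancel]; exact hdU j t ht)
      (fun t ht ↦ by rw [add_sub_cancel]; exact hdE j t ht) t ht
    rw [ha0, ha0, hb0, hb0] at h
    have i1 := hinit' i j a₀ fun i ↦ by
      simp only [hq]; gcongr; exact le_add_of_nonneg_right (norm_nonneg _)
    have i2 := hinit' i j b₀ fun i ↦ by
      simp only [hq]; gcongr; exact le_add_of_nonneg_left (norm_nonneg _)
    have hR2 : (R * (q i + q j)) ^ 2 =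
        ((q i + q j) ^ 2 + (q i + q j) ^ 2 + 4 * (R₁ * (q i + q j)) ^ 2) * Real.exp (L * T) := by
      rw [mul_pow, hR, Real.sq_sqrt (by positivity)]; ring
    have hmain := h.trans (b := _) (c := (R * (q i + q j)) ^ 2) (by
      rw [hR2]
      have := ht.2
      gcongr)
    have hR0 : 0 ≤ R * (q i + q j) := by positivity
    constructor
    · exact le_of_sq_le_sq (by linarith [sq_nonneg ‖mulOp invJap (b i t - b j t)‖]) hR0
    · exact le_of_sq_le_sq (by linarith [sq_nonneg ‖mulOp invJap (a i t - a j t)‖]) hR0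
  have hdiff : ∀ (N : ℕ) (x y : H) (z : ℝ), ‖mulOp (ramp ((N : ℝ) + 1)) x‖ ≤ q N →
      ‖mulOp (ramp ((N : ℝ) + 1)) y‖ ≤ q N → ‖mulOp invJap (x - y)‖ ≤ z →
      ‖x - y‖ ≤ 2 * q N + (N + 1) * z := fun N x y z hx hy hz ↦ by
    refine (norm_le_tail_add (hN N) (x - y)).trans (add_le_add ?_ ?_)
    · rw [map_sub]
      linarith [norm_sub_le (mulOp (ramp ((N : ℝ) + 1)) x) (mulOp (ramp ((N : ℝ) + 1)) y)]
    · have := hN N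
      gcongr
  have hR0 : 0 ≤ R := Real.sqrt_nonneg _
  obtain ⟨A, hAc, hA⟩ := exists_continuousOn_limit hR0 hq0 hqlim hca fun N i j t ht ↦
    hdiff N _ _ _ (htail' i N t ht).1 (htail' j N t ht).1 (hKd i j t ht).1
  obtain ⟨B, hBc, hB⟩ := exists_continuousOn_limit hR0 hq0 hqlim hcb fun N i j t ht ↦
    hdiff N _ _ _ (htail' i N t ht).2 (htail' j N t ht).2 (hKd i j t ht).2
  have hcut : ∀ x : H, Tendsto (fun i : ℕ ↦ mulOp (cutoff (2 * ((i : ℝ) + 1))) x) atTop (𝓝 x) :=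
    fun x ↦ by
    rw [tendsto_iff_norm_sub_tendsto_zero]
    refine squeeze_zero (fun i ↦ norm_nonneg _) (fun i ↦ ?_) (tendsto_norm_ramp x)
    rw [norm_sub_rev]
    exact norm_sub_cutoff_le (hN i) (hNn i) x
  have h0T : (0 : ℝ) ∈ Icc 0 T := ⟨le_rfl, hT⟩
  have hRq : Tendsto (fun i ↦ R₁ * q i) atTop (𝓝 0) := by simpa using hqlim.const_mul R₁
  have hFUc : ∀ i, ContinuousOn (FU i) (Icc 0 T) := fun i ↦ (mulOp _).continuous.comp_continuousOn
    (continuousOn_fieldU hs (hca i) (hcb i))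
  have hFEc : ∀ i, ContinuousOn (FE i) (Icc 0 T) := fun i ↦ (mulOp _).continuous.comp_continuousOn
    (continuousOn_fieldEta hs (hca i) (hcb i))
  have hFUb : ∀ i, ∀ t ∈ Icc 0 T, ‖FU i t‖ ≤ algConst s * M * M + (M + M) := fun i t ht ↦
    (norm_cutoff_le _ _).trans (norm_fieldU_le hs (hbd i t ht).1 (hbd i t ht).2)
  have hFEb : ∀ i, ∀ t ∈ Icc 0 T, ‖FE i t‖ ≤ algConst (s - 1) * M * M := fun i t ht ↦
    (norm_cutoff_le _ _).trans (norm_fieldEta_le hs (hbd i t ht).1 (hbd i t ht).2)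
  refine ⟨A, B, isCurve_of_tendsto hs hRq (fun i t _ ↦ ⟨(hprop i t).1, (hprop i t).2.1⟩)
    hFUc hFEc hFUb hFEb hdU hdE heU heE hAc hBc hA hB, ?_, ?_, fun t ht ↦ ⟨?_, ?_⟩⟩
  · exact tendsto_nhds_unique (hA 0 h0T) ((hcut a₀).congr fun i ↦ (ha0 i).symm)
  · exact tendsto_nhds_unique (hB 0 h0T) ((hcut b₀).congr fun i ↦ (hb0 i).symm)
  · exact le_of_tendsto (hA t ht).norm (Eventually.of_forall fun i ↦ (hbd i t ht).1)
  · exact le_of_tendsto (hB t ht).norm (Eventually.of_forall fun i ↦ (hbd i t ht).2)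

/-- Since m ln(1 + 1/m) ≤ 1 and ln(2 + 1/m) ≥ 1/2, the growing term 4m costs at most 8 ln(2 + 1/m);
the remaining 3 gives the total 11. -/
lemma add_mul_log_le {m : ℝ} (hm : 0 < m) :
    (3 + 4 * m) * Real.log (1 + 1 / m) ≤ 11 * Real.log (2 + 1 / m) := by
  have h0 : 0 < 1 / m := by positivity
  have h1 : Real.log (1 + 1 / m) ≤ Real.log (2 + 1 / m) :=
    Real.log_le_log (by positivity) (by linarith)
  have h2 : m * Real.log (1 + 1 / m) ≤ 1 := by
    have h3 := Real.log_le_sub_one_of_pos (show 0 < 1 + 1 / m by positivity)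
    calc m * Real.log (1 + 1 / m) ≤ m * (1 / m) := by gcongr; linarith
      _ = 1 := mul_one_div_cancel hm.ne'
  have h4 : 1 / 2 ≤ Real.log (2 + 1 / m) := by
    have := Real.log_two_gt_d9
    have := Real.log_le_log (by norm_num) (show (2 : ℝ) ≤ 2 + 1 / m by linarith)
    linarith
  linarith

/-- Existence on the frequency side, on the time interval of the theorem. -/
theorem exists_isCurve {s : ℝ} (hs : 3 / 2 < s) :
    ∃ c : ℝ, 0 < c ∧ ∀ m T : ℝ, 0 < m → 0 ≤ T → T ≤ Real.log (1 + 1 / m) / (2 * c) →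
      ∀ a₀ b₀ : H, IsHerm a₀ → IsHerm b₀ → ‖a₀‖ + ‖b₀‖ ≤ m →
        ∃ a b : ℝ → H, IsCurve hs T a b ∧ a 0 = a₀ ∧ b 0 = b₀ ∧
          ∀ t ∈ Icc 0 T, ‖a t‖ ≤ 2 * m + 1 ∧ ‖b t‖ ≤ 2 * m + 1 := by
  obtain ⟨C, hC0, hC⟩ := exists_isCurve_of_exp_le hs
  -- With M = 2m + 1 the rate is C(3 + 4m), and e^{C(3+4m)T} m ≤ M means C(3 + 4m)T ≤ ln(2 + 1/m).
  -- The choice c = 6C gives 12 in the denominator, which covers the 11 of `add_mul_log_le`.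
  refine ⟨6 * C, by positivity, fun m T hm hT hTm ↦ hC m (2 * m + 1) T hT (by positivity) ?_⟩
  have h1 : C * (1 + 2 * (2 * m + 1)) * T ≤ Real.log (2 + 1 / m) := by
    rw [le_div_iff₀ (by positivity)] at hTm
    have := add_mul_log_le hm
    have h2 : (3 + 4 * m) * (T * (2 * (6 * C))) ≤ (3 + 4 * m) * Real.log (1 + 1 / m) := by gcongr
    have h3 : 0 ≤ C * (1 + 2 * (2 * m + 1)) * T := by positivity
    have e : (3 + 4 * m) * (T * (2 * (6 * C))) = 12 * (C * (1 + 2 * (2 * m + 1)) * T) := by ring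
    linarith
  calc _ ≤ Real.exp (Real.log (2 + 1 / m)) * m := by gcongr
    _ = 2 * m + 1 := by rw [Real.exp_log (by positivity)]; field_simp

/-! ### Distributions on the frequency side -/

/-- The Fourier transform of a real `L²` function. -/
def hat (f : L2) : H := 𝓕 (toComplex f)

lemma hasTemperateGrowth_freq : Function.HasTemperateGrowth freq := by
  unfold freq
  exact (ContinuousLinearMap.lsmul ℝ ℝ (2 * Real.pi)).hasTemperateGrowth

lemma hasTemperateGrowth_jap_rpow (σ : ℝ) : Function.HasTemperateGrowth fun ξ ↦ jap ξ ^ σ := by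
  have h := (Function.hasTemperateGrowth_one_add_norm_sq_rpow ℝ (σ / 2)).comp
    hasTemperateGrowth_freq
  have e : (fun ξ ↦ jap ξ ^ σ) = (fun x : ℝ ↦ (1 + ‖x‖ ^ 2) ^ (σ / 2)) ∘ freq := by
    ext ξ
    simp only [Function.comp_apply, Real.norm_eq_abs, sq_abs]
    exact (jap_rpow σ ξ).symm
  rw [e]
  exact h

/-- Multiplication of Schwartz functions by a real symbol. -/
def symbMul (g : ℝ → ℝ) : 𝓢(ℝ, ℂ) →L[ℂ] 𝓢(ℝ, ℂ) :=
  SchwartzMap.smulLeftCLM ℂ fun ξ ↦ (g ξ : ℂ)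

lemma hasTemperateGrowth_coe {g : ℝ → ℝ} (hg : g.HasTemperateGrowth) :
    Function.HasTemperateGrowth fun ξ ↦ (g ξ : ℂ) :=
  Function.HasTemperateGrowth.comp (g := Complex.ofReal)
    Function.Complex.hasTemperateGrowth_ofReal hg

lemma symbMul_apply {g : ℝ → ℝ} (hg : g.HasTemperateGrowth) (ψ : 𝓢(ℝ, ℂ)) (ξ : ℝ) :
    symbMul g ψ ξ = g ξ * ψ ξ :=
  SchwartzMap.smulLeftCLM_apply_apply (hasTemperateGrowth_coe hg) ψ ξ

lemma coe_fourier (F : H) (ψ : 𝓢(ℝ, ℂ)) :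
    (F : 𝓢'(ℝ, ℂ)) (𝓕 ψ) = ∫ ξ, ψ ξ * (𝓕 F : H) ξ := by
  rw [← TemperedDistribution.fourier_apply, Lp.fourier_toTemperedDistribution_eq,
    Lp.toTemperedDistribution_apply]
  rfl

lemma toDist_fourier (f : L2) (ψ : 𝓢(ℝ, ℂ)) : toDist f (𝓕 ψ) = ∫ ξ, ψ ξ * hat f ξ :=
  coe_fourier _ ψ

lemma Lam_fourier (D : 𝓢'(ℝ, ℂ)) (ψ : 𝓢(ℝ, ℂ)) :
    Lam (-2) D (𝓕 ψ) = D (𝓕 (symbMul (fun ξ ↦ jap ξ ^ (-2 : ℝ)) ψ)) := by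
  rw [Lam, TemperedDistribution.fourierMultiplierCLM_apply_apply,
    FourierTransform.fourierInv_fourier_eq, symbMul]
  simp only [jap_rpow]

/-- Against a test function written as 𝓕 ψ, differentiation becomes multiplication of ψ by i k: the
minus sign of the distributional derivative cancels that of the derivative of the Fourier kernel. -/
lemma dx_fourier (D : 𝓢'(ℝ, ℂ)) (ψ : 𝓢(ℝ, ℂ)) :
    dx D (𝓕 ψ) = D (𝓕 (Complex.I • symbMul freq ψ)) := by
  rw [dx, TemperedDistribution.derivCLM_apply_apply]
  congr 1
  have h : SchwartzMap.derivCLM ℂ ℂ (𝓕 ψ) = LineDeriv.lineDerivOp (1 : ℝ) (𝓕 ψ) := by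
    ext x
    rw [SchwartzMap.derivCLM_apply, SchwartzMap.lineDerivOp_apply_eq_fderiv]
    rfl
  rw [h, SchwartzMap.lineDerivOp_fourier_eq, ← FourierTransform.fourier_neg]
  congr 1
  ext ξ
  have h2 : Function.HasTemperateGrowth (inner ℝ · (1 : ℝ)) := by fun_prop
  have h3 := SchwartzMap.smulLeftCLM_apply_apply h2 ψ ξ
  rw [neg_apply, smul_apply, h3, smul_apply,
    symbMul_apply hasTemperateGrowth_freq]
  simp [freq]
  ring

/-! ### The Fourier transform of a product -/

lemma enorm_integral_mul_conv_le (ψ : 𝓢(ℝ, ℂ)) (F G : H) :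
    ‖∫ ξ, ψ ξ * conv F G ξ‖ₑ ≤ (∫⁻ ξ, ‖ψ ξ‖ₑ) * (‖F‖ₑ * ‖G‖ₑ) := by
  refine (enorm_integral_le_lintegral_enorm _).trans ?_
  rw [← lintegral_mul_const _ ψ.continuous.measurable.enorm]
  refine lintegral_mono fun ξ ↦ ?_
  rw [enorm_mul]
  gcongr
  refine (enorm_conv_le _ _ ξ).trans ((lconv_le (measurable_coe F).enorm
    (measurable_coe G).enorm ξ).trans_eq ?_)
  rw [eLpNorm_enorm, eLpNorm_enorm, Lp.enorm_def, Lp.enorm_def]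

lemma integrable_mul_conv (ψ : 𝓢(ℝ, ℂ)) (F G : H) : Integrable fun ξ ↦ ψ ξ * conv F G ξ := by
  refine ⟨(ψ.continuous.measurable.mul
    (measurable_conv (measurable_coe F) (measurable_coe G))).aestronglyMeasurable, ?_⟩
  have h : ∫⁻ ξ, ‖ψ ξ * conv F G ξ‖ₑ ≤ (∫⁻ ξ, ‖ψ ξ‖ₑ) * (‖F‖ₑ * ‖G‖ₑ) := by
    rw [← lintegral_mul_const _ ψ.continuous.measurable.enorm]
    refine lintegral_mono fun ξ ↦ ?_
    rw [enorm_mul]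
    gcongr
    refine (enorm_conv_le _ _ ξ).trans ((lconv_le (measurable_coe F).enorm
      (measurable_coe G).enorm ξ).trans_eq ?_)
    rw [eLpNorm_enorm, eLpNorm_enorm, Lp.enorm_def, Lp.enorm_def]
  exact h.trans_lt (ENNReal.mul_lt_top ψ.integrable.2 (ENNReal.mul_lt_top enorm_lt_top
    enorm_lt_top))

/-- The functional `F ↦ ∫ ψ (F ⋆ G)`. -/
def convFunctional (ψ : 𝓢(ℝ, ℂ)) (G : H) : H →L[ℂ] ℂ :=
  LinearMap.mkContinuous
    { toFun := fun F ↦ ∫ ξ, ψ ξ * conv F G ξ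
      map_add' := fun F F' ↦ by
        rw [← integral_add (integrable_mul_conv ψ F G) (integrable_mul_conv ψ F' G)]
        congr 1; ext ξ
        rw [conv_congr (Lp.coeFn_add F F') .rfl, conv_comm, conv_add (Lp.memLp G) (Lp.memLp F)
          (Lp.memLp F'), mul_add, conv_comm G F, conv_comm G F']
      map_smul' := fun c F ↦ by
        rw [RingHom.id_apply, smul_eq_mul, ← integral_const_mul]
        congr 1; ext ξ
        rw [conv_congr (Lp.coeFn_smul c F) .rfl, conv_comm, conv_smul, conv_comm G F]
        ring }
    ((∫⁻ ξ, ‖ψ ξ‖ₑ).toReal * ‖G‖) fun F ↦ by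
      have h := enorm_integral_mul_conv_le ψ F G
      rw [← ofReal_norm, ← ofReal_norm, ← ofReal_norm,
        ← ENNReal.ofReal_toReal (a := ∫⁻ ξ, ‖ψ ξ‖ₑ) ψ.integrable.2.ne,
        ← ENNReal.ofReal_mul (norm_nonneg _), ← ENNReal.ofReal_mul ENNReal.toReal_nonneg,
        ENNReal.ofReal_le_ofReal_iff (by positivity)] at h
      refine h.trans_eq ?_
      ring

lemma integrable_conv_kernel {r f g : ℝ → ℂ} (hr : Measurable r) (hf : Measurable f)
    (hg : Measurable g) (hri : Integrable r) (hf2 : MemLp f 2 volume) (hg2 : MemLp g 2 volume) :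
    Integrable (fun p : ℝ × ℝ ↦ r p.1 * (f (p.1 - p.2) * g p.2)) (volume.prod volume) := by
  have hm : Measurable fun p : ℝ × ℝ ↦ r p.1 * (f (p.1 - p.2) * g p.2) :=
    (hr.comp measurable_fst).mul ((hf.comp (measurable_fst.sub measurable_snd)).mul
      (hg.comp measurable_snd))
  have hm' : AEMeasurable (fun p : ℝ × ℝ ↦ ‖r p.1 * (f (p.1 - p.2) * g p.2)‖ₑ)
    (volume.prod volume) := hm.enorm.aemeasurable
  refine ⟨hm.aestronglyMeasurable, ?_⟩
  rw [hasFiniteIntegral_iff_enorm, lintegral_prod _ hm']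
  have h : ∀ ξ, ∫⁻ ζ, ‖r ξ * (f (ξ - ζ) * g ζ)‖ₑ ≤
      ‖r ξ‖ₑ * (eLpNorm f 2 volume * eLpNorm g 2 volume) := fun ξ ↦ by
    simp only [enorm_mul]
    have hφ : Measurable fun ζ ↦ ‖f (ξ - ζ)‖ₑ :=
      (hf.comp (measurable_const.sub measurable_id)).enorm
    rw [lintegral_const_mul _ (f := fun ζ ↦ ‖f (ξ - ζ)‖ₑ * ‖g ζ‖ₑ) (hφ.mul hg.enorm)]
    gcongr
    refine (lconv_le hf.enorm hg.enorm ξ).trans_eq ?_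
    rw [eLpNorm_enorm, eLpNorm_enorm]
  refine (lintegral_mono h).trans_lt ?_
  rw [lintegral_mul_const _ hr.enorm]
  exact ENNReal.mul_lt_top hri.2 (ENNReal.mul_lt_top hf2.2 hg2.2)

/-- For Schwartz φ, the product of 𝓕 ψ and φ is the Fourier transform of κ = ψ ⋆ 𝓕⁻ φ. Moving the
transform to G and using 𝓕⁻ φ(ζ-ξ) = 𝓕 φ(ξ-ζ), Fubini produces the convolution. -/
lemma integral_fourier_mul_schwartz (ψ φ : 𝓢(ℝ, ℂ)) (G : H) :
    ∫ x, (𝓕 ψ) x * (φ x * G x) = ∫ ξ, ψ ξ * conv (𝓕 φ : 𝓢(ℝ, ℂ)) (𝓕 G : H) ξ := by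
  set κ : 𝓢(ℝ, ℂ) := SchwartzMap.convolution (ContinuousLinearMap.mul ℂ ℂ) ψ (𝓕⁻ φ) with hκ
  have h1 : ∀ x, (𝓕 κ) x = (𝓕 ψ) x * φ x := fun x ↦ by
    rw [hκ, SchwartzMap.fourier_convolution, SchwartzMap.pairing_apply_apply,
      FourierTransform.fourier_fourierInv_eq]
    rfl
  have h2 : ∀ ζ, κ ζ = ∫ ξ, ψ ξ * (𝓕 φ) (ξ - ζ) := fun ζ ↦ by
    rw [hκ, SchwartzMap.convolution_apply]
    refine integral_congr_ae (ae_of_all _ fun ξ ↦ ?_)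
    simp only [ContinuousLinearMap.mul_apply']
    rw [SchwartzMap.fourierInv_apply_eq]
    simp
  calc ∫ x, (𝓕 ψ) x * (φ x * G x) = ∫ x, (𝓕 κ) x • G x :=
        integral_congr_ae (ae_of_all _ fun x ↦ by simp only [h1, smul_eq_mul, mul_assoc])
    _ = ∫ ζ, κ ζ * (𝓕 G : H) ζ := by rw [← Lp.toTemperedDistribution_apply, coe_fourier]
    _ = ∫ ζ, ∫ ξ, ψ ξ * ((𝓕 φ) (ξ - ζ) * (𝓕 G : H) ζ) := by
        congr 1; ext ζ
        rw [h2, ← integral_mul_const]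
        simp only [mul_assoc]
    _ = ∫ ξ, ∫ ζ, ψ ξ * ((𝓕 φ) (ξ - ζ) * (𝓕 G : H) ζ) :=
        (integral_integral_swap (integrable_conv_kernel ψ.continuous.measurable
          (𝓕 φ : 𝓢(ℝ, ℂ)).continuous.measurable (measurable_coe (𝓕 G : H)) ψ.integrable
          ((𝓕 φ : 𝓢(ℝ, ℂ)).memLp 2) (Lp.memLp _))).symm
    _ = _ := by
        congr 1; ext ξ
        rw [integral_const_mul]
        rfl

/-- The Fourier transform takes products of `L²` functions to convolutions. -/
theorem integral_fourier_mul (ψ : 𝓢(ℝ, ℂ)) (F G : H) :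
    ∫ x, (𝓕 ψ) x * (F x * G x) = ∫ ξ, ψ ξ * conv (𝓕 F : H) (𝓕 G : H) ξ := by
  have hK : MemLp (fun x ↦ (𝓕 ψ) x * G x) 2 volume :=
    MemLp.mul' (p := ∞) (q := 2) (Lp.memLp G) ((𝓕 ψ).memLp ∞)
  have hl : ∀ F : H, (ContinuousLinearMap.mul ℂ ℂ).lpPairing volume 2 2 hK.toLp F =
      ∫ x, (𝓕 ψ) x * (F x * G x) := fun F ↦ by
    rw [ContinuousLinearMap.lpPairing_eq_integral]
    refine integral_congr_ae ?_
    filter_upwards [hK.coeFn_toLp] with x h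
    rw [h, ContinuousLinearMap.mul_apply']
    ring
  have hr : ∀ F : H, convFunctional ψ (𝓕 G : H) (𝓕 F : H) =
      ∫ ξ, ψ ξ * conv (𝓕 F : H) (𝓕 G : H) ξ := fun F ↦ rfl
  rw [← hl, ← hr]
  -- For fixed ψ and G both sides are continuous linear functionals of F on L², so the Schwartz case
  -- suffices by density.
  refine DenseRange.induction_on (p := fun F : H ↦
    (ContinuousLinearMap.mul ℂ ℂ).lpPairing volume 2 2 hK.toLp F =
      convFunctional ψ (𝓕 G : H) (𝓕 F : H))
    (SchwartzMap.denseRange_toLpCLM (p := 2) ENNReal.ofNat_ne_top) F ?_ fun φ ↦ ?_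
  · exact isClosed_eq (ContinuousLinearMap.continuous _)
      ((ContinuousLinearMap.continuous _).comp (Lp.fourierTransformₗᵢ ℝ ℂ).continuous)
  · rw [hl, hr, SchwartzMap.toLpCLM_apply, SchwartzMap.toLp_fourier_eq]
    have h1 : ∫ x, (𝓕 ψ) x * ((φ.toLp 2 : H) x * G x) = ∫ x, (𝓕 ψ) x * (φ x * G x) := by
      refine integral_congr_ae ?_
      filter_upwards [φ.coeFn_toLp 2] with x h
      rw [h]
    rw [h1, integral_fourier_mul_schwartz]
    congr 1; ext ξ
    rw [conv_congr ((𝓕 φ).coeFn_toLp 2).symm .rfl]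

lemma prodDist_fourier (f g : L2) (ψ : 𝓢(ℝ, ℂ)) :
    prodDist f g (𝓕 ψ) = ∫ ξ, ψ ξ * conv (hat f) (hat g) ξ := by
  rw [prodDist, Lp.toTemperedDistribution_apply, hat, hat, ← integral_fourier_mul]
  refine integral_congr_ae ?_
  filter_upwards [Lp.coeFn_lpSMul (r := 1) (toComplex f) (toComplex g)] with x h
  rw [h]
  rfl

/-! ### Testing against Schwartz functions -/

/-- The functional `x ↦ ∫ χ x`. -/
def test (χ : 𝓢(ℝ, ℂ)) : H →L[ℂ] ℂ :=
  (ContinuousLinearMap.mul ℂ ℂ).lpPairing volume 2 2 (χ.toLp 2)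

lemma test_apply (χ : 𝓢(ℝ, ℂ)) (x : H) : test χ x = ∫ ξ, χ ξ * x ξ := by
  rw [test, ContinuousLinearMap.lpPairing_eq_integral]
  refine integral_congr_ae ?_
  filter_upwards [χ.coeFn_toLp 2] with ξ h
  rw [h, ContinuousLinearMap.mul_apply']

lemma eq_of_test_eq {x y : H} (h : ∀ χ, test χ x = test χ y) : x = y := by
  rw [← sub_eq_zero]
  have h1 : x - y ∈ (Lp.toTemperedDistributionCLM ℂ (volume : Measure ℝ) 2).ker := by
    rw [LinearMap.mem_ker]
    ext χ
    have h2 : test χ (x - y) = 0 := by rw [map_sub, h, sub_self]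
    rw [test_apply] at h2
    exact (Lp.toTemperedDistribution_apply (x - y) χ).trans h2
  rwa [Lp.ker_toTemperedDistributionCLM_eq_bot] at h1

/-! ### Real functions and Hermitian transforms -/

/-- Complex conjugation on `L²`. -/
def conjLp (F : H) : H := (Complex.conjCLE : ℂ →L[ℝ] ℂ).compLp F

lemma conjLp_ae (F : H) : conjLp F =ᵐ[volume] fun x ↦ (starRingEnd ℂ) (F x) :=
  (Complex.conjCLE : ℂ →L[ℝ] ℂ).coeFn_compLp F

/-- The reflection `ψ ↦ conj ψ(-·)` of Schwartz functions. -/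
def reflectSchwartz (ψ : 𝓢(ℝ, ℂ)) : 𝓢(ℝ, ℂ) :=
  SchwartzMap.compCLMOfContinuousLinearEquiv ℝ (ContinuousLinearEquiv.neg ℝ)
    (ψ.postcompCLM (𝕜 := ℝ) (Complex.conjCLE : ℂ →L[ℝ] ℂ))

lemma reflectSchwartz_apply (ψ : 𝓢(ℝ, ℂ)) (ξ : ℝ) :
    reflectSchwartz ψ ξ = (starRingEnd ℂ) (ψ (-ξ)) := rfl

lemma fourier_reflectSchwartz (ψ : 𝓢(ℝ, ℂ)) (x : ℝ) :
    (𝓕 (reflectSchwartz ψ)) x = (starRingEnd ℂ) ((𝓕 ψ) x) := by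
  rw [SchwartzMap.fourier_coe, SchwartzMap.fourier_coe, Real.fourier_real_eq_integral_exp_smul,
    Real.fourier_real_eq_integral_exp_smul, ← integral_conj, ← integral_neg_eq_self]
  congr 1; ext v
  simp only [reflectSchwartz_apply, neg_neg, smul_eq_mul, map_mul, ← Complex.exp_conj,
    Complex.conj_I, Complex.conj_ofReal]
  congr 2
  push_cast
  ring

/-- By duality the identity passes to the Schwartz test function, where it is a change of variables
in the Fourier integral. -/
lemma fourier_conjLp (F : H) : (𝓕 (conjLp F) : H) = reflect (𝓕 F : H) := by
  refine eq_of_test_eq fun χ ↦ ?_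
  have e1 : test χ (𝓕 (conjLp F) : H) = ∫ x, (𝓕 χ) x * (starRingEnd ℂ) (F x) := by
    rw [test_apply, ← coe_fourier, Lp.toTemperedDistribution_apply]
    refine integral_congr_ae ?_
    filter_upwards [conjLp_ae F] with x h
    rw [h, smul_eq_mul]
  have e2 : ∫ x, (𝓕 χ) x * (starRingEnd ℂ) (F x) =
      (starRingEnd ℂ) (∫ x, (𝓕 (reflectSchwartz χ)) x • F x) := by
    rw [← integral_conj]
    simp only [fourier_reflectSchwartz, smul_eq_mul, map_mul, Complex.conj_conj]
  rw [e1, e2, ← Lp.toTemperedDistribution_apply, coe_fourier, ← integral_conj, test_apply,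
    ← integral_neg_eq_self]
  refine integral_congr_ae ?_
  filter_upwards [reflect_ae (𝓕 F : H)] with ξ h
  rw [h]
  simp [reflectSchwartz_apply]

lemma toComplex_ae (f : L2) : toComplex f =ᵐ[volume] fun x ↦ (f x : ℂ) :=
  Complex.ofRealCLM.coeFn_compLp f

lemma isHerm_hat (f : L2) : IsHerm (hat f) := by
  rw [isHerm_iff_reflect_eq, hat, ← fourier_conjLp]
  congr 1
  refine Lp.ext ?_
  filter_upwards [conjLp_ae (toComplex f), toComplex_ae f] with x h1 h2
  rw [h1, h2, Complex.conj_ofReal]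

/-- The real function with a given Hermitian Fourier transform. -/
def realPart (a : H) : L2 := Complex.reCLM.compLp (𝓕⁻ a : H)

/-- Hermitian symmetry makes the inverse transform invariant under conjugation, so taking the real
part loses nothing. -/
lemma hat_realPart {a : H} (ha : IsHerm a) : hat (realPart a) = a := by
  have h1 : conjLp (𝓕⁻ a : H) = (𝓕⁻ a : H) := by
    have h2 := fourier_conjLp (𝓕⁻ a : H)
    rw [FourierTransform.fourier_fourierInv_eq, (isHerm_iff_reflect_eq a).1 ha] at h2
    calc conjLp (𝓕⁻ a : H) = (𝓕⁻ (𝓕 (conjLp (𝓕⁻ a : H)) : H) : H) :=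
          (FourierTransform.fourierInv_fourier_eq _).symm
      _ = (𝓕⁻ a : H) := by rw [h2]
  have h3 : toComplex (realPart a) = (𝓕⁻ a : H) := by
    refine Lp.ext ?_
    have h4 := conjLp_ae (𝓕⁻ a : H)
    rw [h1] at h4
    filter_upwards [toComplex_ae (realPart a), Complex.reCLM.coeFn_compLp (𝓕⁻ a : H), h4]
      with x e1 e2 e3
    rw [e1, realPart, e2]
    exact Complex.conj_eq_iff_re.1 e3.symm
  rw [hat, h3, FourierTransform.fourier_fourierInv_eq]

lemma hat_injective {f g : L2} (h : hat f = hat g) : f = g := by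
  have h1 : toComplex f = toComplex g := (Lp.fourierTransformₗᵢ ℝ ℂ).injective h
  refine Lp.ext ?_
  have h2 := toComplex_ae f
  rw [h1] at h2
  filter_upwards [h2, toComplex_ae g] with x e1 e2
  exact Complex.ofReal_injective (e1.symm.trans e2)

lemma hat_sub (f g : L2) : hat (f - g) = hat f - hat g := by
  have h : toComplex (f - g) = toComplex f - toComplex g :=
    map_sub (Complex.ofRealCLM.compLpL 2 volume) f g
  rw [hat, h]
  exact map_sub (Lp.fourierTransformₗᵢ ℝ ℂ) _ _

/-! ### Sobolev norms -/

lemma sobolevNorm_eq (σ : ℝ) (f : L2) : sobolevNorm σ f = wnorm (fun ξ ↦ jap ξ ^ σ) (hat f) := by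
  rw [sobolevNorm, wnorm]
  simp only [jap_rpow]
  rfl

lemma memLp_jap_hat {σ : ℝ} {f : L2} (h : sobolevNorm σ f < ∞) :
    MemLp (fun ξ ↦ jap ξ ^ σ • hat f ξ) 2 volume :=
  ⟨((measurable_jap_rpow σ).smul (measurable_coe _)).aestronglyMeasurable, by
    rwa [sobolevNorm_eq] at h⟩

/-- The function `J^σ f̂`, zero if `f` is not in `H^σ`. -/
def lev (σ : ℝ) (f : L2) : H :=
  open Classical in if h : sobolevNorm σ f < ∞ then (memLp_jap_hat h).toLp else 0

lemma lev_ae {σ : ℝ} {f : L2} (h : sobolevNorm σ f < ∞) :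
    lev σ f =ᵐ[volume] fun ξ ↦ jap ξ ^ σ • hat f ξ := by
  rw [lev, dif_pos h]
  exact (memLp_jap_hat h).coeFn_toLp

lemma hat_ae {σ : ℝ} {f : L2} (h : sobolevNorm σ f < ∞) :
    hat f =ᵐ[volume] low σ (lev σ f) := by
  filter_upwards [lev_ae h] with ξ e
  rw [low, e, smul_smul, ← Real.rpow_add (jap_pos ξ)]
  simp

lemma isHerm_lev {σ : ℝ} {f : L2} (h : sobolevNorm σ f < ∞) : IsHerm (lev σ f) := by
  refine IsHerm.congr (f := fun ξ ↦ jap ξ ^ σ • hat f ξ) ?_ (lev_ae h).symm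
  filter_upwards [isHerm_hat f] with ξ e
  rw [e, jap_neg, Complex.real_smul, Complex.real_smul, map_mul, Complex.conj_ofReal]

lemma sobolevNorm_of_hat_ae {σ τ : ℝ} {f : L2} {a : H} (h : hat f =ᵐ[volume] low τ a) :
    sobolevNorm σ f = wnorm (fun ξ ↦ jap ξ ^ (σ - τ)) a := by
  rw [sobolevNorm_eq, wnorm_congr h, wnorm, wnorm]
  congr 1; ext ξ
  rw [smul_low, ← Real.rpow_add (jap_pos ξ), sub_eq_add_neg]

lemma sobolevNorm_eq_enorm {σ : ℝ} {f : L2} {a : H} (h : hat f =ᵐ[volume] low σ a) :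
    sobolevNorm σ f = ‖a‖ₑ := by
  rw [sobolevNorm_of_hat_ae h, Lp.enorm_def, wnorm]
  simp

lemma lev_eq {σ : ℝ} {f : L2} {a : H} (h : hat f =ᵐ[volume] low σ a) : lev σ f = a := by
  have hf : sobolevNorm σ f < ∞ := by rw [sobolevNorm_eq_enorm h]; exact enorm_lt_top
  refine Lp.ext ?_
  filter_upwards [lev_ae hf, h] with ξ e1 e2
  rw [e1, e2, smul_low, ← Real.rpow_add (jap_pos ξ)]
  simp

lemma hat_sub_ae {σ : ℝ} {f g : L2} {a b : H} (hf : hat f =ᵐ[volume] low σ a)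
    (hg : hat g =ᵐ[volume] low σ b) : hat (f - g) =ᵐ[volume] low σ (a - b : H) := by
  rw [hat_sub]
  filter_upwards [hf, hg, Lp.coeFn_sub (hat f) (hat g), Lp.coeFn_sub a b] with ξ e1 e2 e3 e4
  rw [e3, Pi.sub_apply, e1, e2, low, low, low, e4, Pi.sub_apply, smul_sub]

lemma sobolevNorm_sub_one_eq {σ : ℝ} {f : L2} {a : H} (h : hat f =ᵐ[volume] low σ a) :
    sobolevNorm (σ - 1) f = ‖mulOp invJap a‖ₑ := by
  rw [sobolevNorm_of_hat_ae h, enorm_mulOp isMult_invJap]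
  congr 1; ext ξ
  rw [invJap, sub_sub_cancel_left, Real.rpow_neg_one]

lemma exists_hat_ae {σ : ℝ} (hσ : 0 ≤ σ) {a : H} (ha : IsHerm a) :
    ∃ f : L2, hat f =ᵐ[volume] low σ a := by
  have h := (memLp_low hσ a).coeFn_toLp
  refine ⟨realPart (memLp_low hσ a).toLp, ?_⟩
  rw [hat_realPart ((ha.low σ).congr h.symm)]
  exact h

lemma eq_of_hat_ae {σ : ℝ} {f g : L2} {a : H} (hf : hat f =ᵐ[volume] low σ a)
    (hg : hat g =ᵐ[volume] low σ a) : f = g :=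
  hat_injective (Lp.ext (hf.trans hg.symm))

/-! ### The equations tested against Schwartz functions -/

/-- The weight J^{τ-1} in the test function combines with k to J^τ · k/J, so the product rule for
transforms yields exactly `algOp` followed by `freqSymb 1`. -/
lemma prodDist_test {τ : ℝ} (hτ : 1 / 2 < τ) {f g : L2} {x y : H} (hf : hat f =ᵐ[volume] low τ x)
    (hg : hat g =ᵐ[volume] low τ y) (χ : 𝓢(ℝ, ℂ)) :
    prodDist f g (𝓕 (Complex.I • symbMul freq (symbMul (fun ξ ↦ jap ξ ^ (τ - 1)) χ))) =
      Complex.I * test χ (mulOp (freqSymb 1) (algOp τ hτ x y)) := by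
  rw [prodDist_fourier, test_apply, ← integral_const_mul]
  refine integral_congr_ae ?_
  filter_upwards [mulOp_ae (isMult_freqSymb le_rfl) (algOp τ hτ x y), algOp_ae hτ x y] with ξ h1 h2
  rw [h1, h2, conv_congr hf hg, smul_apply, symbMul_apply hasTemperateGrowth_freq,
    symbMul_apply (hasTemperateGrowth_jap_rpow _), freqSymb, Real.rpow_sub_one (jap_pos ξ).ne']
  simp only [Complex.real_smul, smul_eq_mul, pow_one]
  push_cast
  ring

lemma Lam_test {σ τ : ℝ} {j : ℕ} (hj : 1 ≤ j) (hτ : σ - 2 = τ - j) {f : L2} {x : H}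
    (hf : hat f =ᵐ[volume] low τ x) (χ : 𝓢(ℝ, ℂ)) :
    toDist f (𝓕 (symbMul (fun ξ ↦ jap ξ ^ (-2 : ℝ))
      (Complex.I • symbMul freq (symbMul (fun ξ ↦ jap ξ ^ σ) χ)))) =
      Complex.I * test χ (mulOp (freqSymb j) x) := by
  rw [toDist_fourier, test_apply, ← integral_const_mul]
  refine integral_congr_ae ?_
  filter_upwards [mulOp_ae (isMult_freqSymb hj) x, hf] with ξ h1 h2
  have e : (jap ξ ^ (-2 : ℝ) * jap ξ ^ σ * jap ξ ^ (-τ) : ℝ) = (jap ξ ^ j)⁻¹ := by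
    rw [← Real.rpow_add (jap_pos ξ), ← Real.rpow_add (jap_pos ξ), ← Real.rpow_natCast,
      ← Real.rpow_neg (jap_pos ξ).le]
    congr 1; linarith
  rw [h1, h2, symbMul_apply (hasTemperateGrowth_jap_rpow _), smul_apply,
    symbMul_apply hasTemperateGrowth_freq, symbMul_apply (hasTemperateGrowth_jap_rpow _),
    freqSymb, div_eq_mul_inv, ← e, low]
  simp only [Complex.real_smul, smul_eq_mul]
  push_cast
  ring

lemma toDist_test {τ : ℝ} {f : L2} {x : H} (hf : hat f =ᵐ[volume] low τ x) (χ : 𝓢(ℝ, ℂ)) :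
    toDist f (𝓕 (symbMul (fun ξ ↦ jap ξ ^ (τ - 1)) χ)) = test χ (mulOp invJap x) := by
  rw [toDist_fourier, test_apply]
  refine integral_congr_ae ?_
  filter_upwards [mulOp_ae isMult_invJap x, hf] with ξ h1 h2
  have e : (jap ξ ^ (τ - 1) * jap ξ ^ (-τ) : ℝ) = (jap ξ)⁻¹ := by
    rw [← Real.rpow_add (jap_pos ξ), ← Real.rpow_neg_one]
    congr 1; ring
  rw [h1, h2, symbMul_apply (hasTemperateGrowth_jap_rpow _), invJap, ← e, low]
  simp only [Complex.real_smul]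
  push_cast
  ring

lemma rhsU_test {s : ℝ} (hs : 3 / 2 < s) {f g : L2} {a b : H} (hf : hat f =ᵐ[volume] low s a)
    (hg : hat g =ᵐ[volume] low (s - 1) b) (χ : 𝓢(ℝ, ℂ)) :
    (-dx ((1 / 2 : ℂ) • prodDist f f) + dx (Lam (-2) (toDist g - toDist f)))
      (𝓕 (symbMul (fun ξ ↦ jap ξ ^ (s - 1)) χ)) = test χ (fieldU hs a b) := by
  have h1 := prodDist_test (τ := s) (by linarith) hf hf χ
  have h2 := Lam_test (σ := s - 1) (j := 3) (by norm_num) (by push_cast; ring) hf χ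
  have h3 := Lam_test (σ := s - 1) (j := 2) (by norm_num) (by push_cast; ring) hg χ
  have e1 : dx ((1 / 2 : ℂ) • prodDist f f) (𝓕 (symbMul (fun ξ ↦ jap ξ ^ (s - 1)) χ)) =
      (1 / 2 : ℂ) * (Complex.I * test χ (mulOp (freqSymb 1) (algOp s (by linarith) a a))) := by
    rw [dx_fourier, ← h1]; rfl
  have e2 : dx (Lam (-2) (toDist g - toDist f)) (𝓕 (symbMul (fun ξ ↦ jap ξ ^ (s - 1)) χ)) =
      Complex.I * test χ (mulOp (freqSymb 2) b) - Complex.I * test χ (mulOp (freqSymb 3) a) := by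
    rw [dx_fourier, Lam_fourier, ← h2, ← h3]; rfl
  have e3 : test χ (fieldU hs a b) = -(Complex.I / 2) *
      test χ (mulOp (freqSymb 1) (algOp s (by linarith) a a)) +
      (Complex.I * test χ (mulOp (freqSymb 2) b) - Complex.I * test χ (mulOp (freqSymb 3) a)) := by
    rw [fieldU, map_add, map_sub, map_smul, map_smul, map_smul]; rfl
  rw [e3, ← e2]
  change -(dx ((1 / 2 : ℂ) • prodDist f f) _) + dx (Lam (-2) (toDist g - toDist f)) _ = _
  rw [e1]
  ring

lemma rhsEta_test {s : ℝ} (hs : 3 / 2 < s) {f g : L2} {a b : H} (hf : hat f =ᵐ[volume] low s a)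
    (hg : hat g =ᵐ[volume] low (s - 1) b) (χ : 𝓢(ℝ, ℂ)) :
    (-dx (prodDist g f)) (𝓕 (symbMul (fun ξ ↦ jap ξ ^ (s - 1 - 1)) χ)) =
      test χ (fieldEta hs a b) := by
  have hf' : hat f =ᵐ[volume] low (s - 1) (mulOp invJap a) := hf.trans (low_invJap_ae s a).symm
  have h1 := prodDist_test (τ := s - 1) (by linarith) hg hf' χ
  have e3 : test χ (fieldEta hs a b) = -Complex.I * test χ (mulOp (freqSymb 1)
      (algOp (s - 1) (by linarith) b (mulOp invJap a))) := by
    rw [fieldEta, map_smul]; rfl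
  rw [e3]
  change -(dx (prodDist g f) _) = _
  rw [dx_fourier, h1]
  ring

/-- J^σ acts invertibly on Schwartz functions, so testing against 𝓕(J^σ χ) is no restriction. This
is needed to return from curves to distributional solutions. -/
lemma exists_fourier_symbMul (σ : ℝ) (φ : 𝓢(ℝ, ℂ)) :
    ∃ χ : 𝓢(ℝ, ℂ), φ = 𝓕 (symbMul (fun ξ ↦ jap ξ ^ σ) χ) := by
  refine ⟨symbMul (fun ξ ↦ jap ξ ^ (-σ)) (𝓕⁻ φ), ?_⟩
  have : symbMul (fun ξ ↦ jap ξ ^ σ) (symbMul (fun ξ ↦ jap ξ ^ (-σ)) (𝓕⁻ φ)) = 𝓕⁻ φ := by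
    ext ξ
    rw [symbMul_apply (hasTemperateGrowth_jap_rpow _), symbMul_apply (hasTemperateGrowth_jap_rpow _),
      ← mul_assoc, ← Complex.ofReal_mul, ← Real.rpow_add (jap_pos ξ)]
    simp
  rw [this, FourierTransform.fourier_fourierInv_eq]

/-! ### Solutions and curves -/

/-- A weak derivative that is norm continuous is a strong one: the integral equation holds after
each test, hence in H, and can be differentiated in norm. -/
lemma hasDerivWithinAt_of_test {T : ℝ} {g F : ℝ → H} (hF : ContinuousOn F (Icc 0 T))
    (h : ∀ χ, ∀ t ∈ Icc 0 T, HasDerivWithinAt (fun τ ↦ test χ (g τ)) (test χ (F t)) (Icc 0 T) t) :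
    ∀ t ∈ Icc 0 T, HasDerivWithinAt g (F t) (Icc 0 T) t := by
  refine hasDerivWithinAt_of_eq_add_integral hF fun t ht ↦ eq_of_test_eq fun χ ↦ ?_
  have hc : ContinuousOn (fun t ↦ test χ (F t)) (Icc 0 T) :=
    (test χ).continuous.comp_continuousOn hF
  rw [eq_add_integral_of_hasDerivWithinAt hc (h χ) t ht, map_add]
  congr 1
  have hi : IntervalIntegrable F volume 0 t :=
    (hF.mono (Icc_subset_Icc_right ht.2)).intervalIntegrable_of_Icc ht.1
  exact (test χ).intervalIntegral_comp_comm hi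

lemma pairNorm_lt_top {σ : ℝ} {f g : L2} (h : pairNorm σ f g < ∞) :
    sobolevNorm σ f < ∞ ∧ sobolevNorm (σ - 1) g < ∞ := ENNReal.add_lt_top.1 h

lemma pairNorm_eq {σ : ℝ} {f g : L2} {a b : H} (hf : hat f =ᵐ[volume] low σ a)
    (hg : hat g =ᵐ[volume] low (σ - 1) b) : pairNorm σ f g = ENNReal.ofReal (‖a‖ + ‖b‖) := by
  rw [pairNorm, sobolevNorm_eq_enorm hf, sobolevNorm_eq_enorm hg,
    ENNReal.ofReal_add (norm_nonneg _) (norm_nonneg _), ofReal_norm, ofReal_norm]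

section Solution

variable {s T : ℝ} {u₀ η₀ : L2} {u η : ℝ → L2}

lemma IsSolution.hat_u (h : IsSolution s T u₀ η₀ u η) {t : ℝ} (ht : t ∈ Icc 0 T) :
    hat (u t) =ᵐ[volume] low s (lev s (u t)) :=
  hat_ae (pairNorm_lt_top (h.finite t ht)).1

lemma IsSolution.hat_η (h : IsSolution s T u₀ η₀ u η) {t : ℝ} (ht : t ∈ Icc 0 T) :
    hat (η t) =ᵐ[volume] low (s - 1) (lev (s - 1) (η t)) :=
  hat_ae (pairNorm_lt_top (h.finite t ht)).2

lemma IsSolution.tendsto_lev (h : IsSolution s T u₀ η₀ u η) {t : ℝ} (ht : t ∈ Icc 0 T) :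
    Tendsto (fun τ ↦ ENNReal.ofReal (‖lev s (u τ) - lev s (u t)‖ +
      ‖lev (s - 1) (η τ) - lev (s - 1) (η t)‖)) (𝓝[Icc 0 T] t) (𝓝 0) := by
  refine (h.continuous t ht).congr' ?_
  filter_upwards [self_mem_nhdsWithin] with τ hτ
  exact pairNorm_eq (hat_sub_ae (h.hat_u hτ) (h.hat_u ht)) (hat_sub_ae (h.hat_η hτ) (h.hat_η ht))

lemma IsSolution.isCurve (hs : 3 / 2 < s) (h : IsSolution s T u₀ η₀ u η) :
    IsCurve hs T (fun t ↦ lev s (u t)) fun t ↦ lev (s - 1) (η t) := by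
  have hc : ∀ (x : ℝ → H), (∀ t ∈ Icc 0 T, ∀ τ ∈ Icc 0 T, ‖x τ - x t‖ ≤
      ‖lev s (u τ) - lev s (u t)‖ + ‖lev (s - 1) (η τ) - lev (s - 1) (η t)‖) →
      ContinuousOn x (Icc 0 T) := fun x hx t ht ↦ by
    have h1 := (ENNReal.continuousAt_toReal ENNReal.zero_ne_top).tendsto.comp (h.tendsto_lev ht)
    rw [ENNReal.toReal_zero] at h1
    rw [ContinuousWithinAt, tendsto_iff_norm_sub_tendsto_zero]
    refine squeeze_zero' (Eventually.of_forall fun _ ↦ norm_nonneg _) ?_ h1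
    filter_upwards [self_mem_nhdsWithin] with τ hτ
    rw [Function.comp_apply, ENNReal.toReal_ofReal (by positivity)]
    exact hx t ht τ hτ
  have ha : ContinuousOn (fun t ↦ lev s (u t)) (Icc 0 T) :=
    hc _ fun t _ τ _ ↦ le_add_of_nonneg_right (norm_nonneg _)
  have hb : ContinuousOn (fun t ↦ lev (s - 1) (η t)) (Icc 0 T) :=
    hc _ fun t _ τ _ ↦ le_add_of_nonneg_left (norm_nonneg _)
  refine ⟨fun t ht ↦ isHerm_lev (pairNorm_lt_top (h.finite t ht)).1,
    fun t ht ↦ isHerm_lev (pairNorm_lt_top (h.finite t ht)).2, ha, hb, ?_, ?_⟩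
  · refine hasDerivWithinAt_of_test (continuousOn_fieldU hs ha hb) fun χ t ht ↦ ?_
    have h1 := h.eq_u t ht (𝓕 (symbMul (fun ξ ↦ jap ξ ^ (s - 1)) χ))
    rw [rhsU_test hs (h.hat_u ht) (h.hat_η ht)] at h1
    exact h1.congr (fun τ hτ ↦ (toDist_test (h.hat_u hτ) χ).symm)
      (toDist_test (h.hat_u ht) χ).symm
  · refine hasDerivWithinAt_of_test (continuousOn_fieldEta hs ha hb) fun χ t ht ↦ ?_
    have h1 := h.eq_η t ht (𝓕 (symbMul (fun ξ ↦ jap ξ ^ (s - 1 - 1)) χ))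
    rw [rhsEta_test hs (h.hat_u ht) (h.hat_η ht)] at h1
    exact h1.congr (fun τ hτ ↦ (toDist_test (h.hat_η hτ) χ).symm)
      (toDist_test (h.hat_η ht) χ).symm

lemma IsCurve.isSolution (hs : 3 / 2 < s) {a b : ℝ → H} (h : IsCurve hs T a b)
    (hu : ∀ t ∈ Icc 0 T, hat (u t) =ᵐ[volume] low s (a t))
    (hη : ∀ t ∈ Icc 0 T, hat (η t) =ᵐ[volume] low (s - 1) (b t)) (hu0 : u 0 = u₀)
    (hη0 : η 0 = η₀) : IsSolution s T u₀ η₀ u η := by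
  refine ⟨fun t ht ↦ ?_, fun t ht ↦ ?_, fun t ht φ ↦ ?_, fun t ht φ ↦ ?_, hu0, hη0⟩
  · rw [pairNorm_eq (hu t ht) (hη t ht)]; exact ENNReal.ofReal_lt_top
  · have h1 := tendsto_iff_norm_sub_tendsto_zero.1 (h.cont_a t ht)
    have h2 := tendsto_iff_norm_sub_tendsto_zero.1 (h.cont_b t ht)
    have h3 := ENNReal.tendsto_ofReal (h1.add h2)
    rw [add_zero, ENNReal.ofReal_zero] at h3
    refine h3.congr' ?_
    filter_upwards [self_mem_nhdsWithin] with τ hτ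
    exact (pairNorm_eq (hat_sub_ae (hu τ hτ) (hu t ht)) (hat_sub_ae (hη τ hτ) (hη t ht))).symm
  · obtain ⟨χ, rfl⟩ := exists_fourier_symbMul (s - 1) φ
    rw [rhsU_test hs (hu t ht) (hη t ht)]
    have h1 := ((test χ).restrictScalars ℝ).hasFDerivAt.comp_hasDerivWithinAt t (h.deriv_a t ht)
    exact h1.congr (fun τ hτ ↦ toDist_test (hu τ hτ) χ) (toDist_test (hu t ht) χ)
  · obtain ⟨χ, rfl⟩ := exists_fourier_symbMul (s - 1 - 1) φ
    rw [rhsEta_test hs (hu t ht) (hη t ht)]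
    have h1 := ((test χ).restrictScalars ℝ).hasFDerivAt.comp_hasDerivWithinAt t (h.deriv_b t ht)
    exact h1.congr (fun τ hτ ↦ toDist_test (hη τ hτ) χ) (toDist_test (hη t ht) χ)

end Solution

/-! ### Stability and uniqueness -/

/-- Compactness of the time interval bounds any curve, so uniqueness requires no a priori bound on
the competitor. -/
lemma IsCurve.bddOn {s T : ℝ} {hs : 3 / 2 < s} {a b : ℝ → H} (h : IsCurve hs T a b) :
    ∃ M, ∀ t ∈ Icc 0 T, ‖a t‖ ≤ M ∧ ‖b t‖ ≤ M := by
  obtain ⟨M₁, h1⟩ := isCompact_Icc.exists_bound_of_continuousOn h.cont_a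
  obtain ⟨M₂, h2⟩ := isCompact_Icc.exists_bound_of_continuousOn h.cont_b
  exact ⟨max M₁ M₂, fun t ht ↦ ⟨(h1 t ht).trans (le_max_left _ _),
    (h2 t ht).trans (le_max_right _ _)⟩⟩

lemma exists_curve_stability {s : ℝ} (hs : 3 / 2 < s) (M T : ℝ) :
    ∃ R : ℝ, 0 ≤ R ∧ ∀ a b a' b' : ℝ → H, IsCurve hs T a b → IsCurve hs T a' b' →
      (∀ t ∈ Icc 0 T, ‖a t‖ ≤ M) → (∀ t ∈ Icc 0 T, ‖a' t‖ ≤ M ∧ ‖b' t‖ ≤ M) →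
      ∀ t ∈ Icc 0 T, ‖mulOp invJap (a t - a' t)‖ + ‖mulOp invJap (b t - b' t)‖ ≤
        R * (‖mulOp invJap (a 0 - a' 0)‖ + ‖mulOp invJap (b 0 - b' 0)‖) := by
  obtain ⟨L, hL1, hL⟩ := exists_stability hs M
  refine ⟨2 * Real.exp (L * T), by positivity, fun a b a' b' h h' ha ha' t ht ↦ ?_⟩
  have h1 := hL T 0 a b a' b' (fun _ ↦ 0) (fun _ ↦ 0) (fun _ ↦ 0) (fun _ ↦ 0) h.herm_a h'.herm_a ha
    (fun t ht ↦ (ha' t ht).1) (fun t ht ↦ (ha' t ht).2) (by simp) (by simp) (by simp) (by simp)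
    (fun t ht ↦ by rw [add_zero]; exact h.deriv_a t ht)
    (fun t ht ↦ by rw [add_zero]; exact h.deriv_b t ht)
    (fun t ht ↦ by rw [add_zero]; exact h'.deriv_a t ht)
    (fun t ht ↦ by rw [add_zero]; exact h'.deriv_b t ht) t ht
  have hT : 0 ≤ T := ht.1.trans ht.2
  set x := ‖mulOp invJap (a t - a' t)‖
  set y := ‖mulOp invJap (b t - b' t)‖
  set x₀ := ‖mulOp invJap (a 0 - a' 0)‖
  set y₀ := ‖mulOp invJap (b 0 - b' 0)‖
  have hx0 : 0 ≤ x₀ := norm_nonneg _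
  have hy0 : 0 ≤ y₀ := norm_nonneg _
  have hE1 : 1 ≤ Real.exp (L * T) := Real.one_le_exp (by positivity)
  -- The squared exponential is a wasteful bound that makes the right side a perfect square, so that
  -- roots can be taken.
  have hE : Real.exp (L * t) ≤ Real.exp (L * T) ^ 2 := by
    calc Real.exp (L * t) ≤ Real.exp (L * T) := by
          have := ht.2
          gcongr
      _ ≤ Real.exp (L * T) ^ 2 := le_self_pow₀ hE1 two_ne_zero
  have h2 : x ^ 2 + y ^ 2 ≤ (Real.exp (L * T) * (x₀ + y₀)) ^ 2 := by
    calc x ^ 2 + y ^ 2 ≤ (x₀ ^ 2 + y₀ ^ 2 + 4 * 0 ^ 2) * Real.exp (L * t) := h1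
      _ ≤ (x₀ + y₀) ^ 2 * Real.exp (L * T) ^ 2 := by
          refine mul_le_mul ?_ hE (Real.exp_pos _).le (sq_nonneg _)
          nlinarith
      _ = _ := by ring
  have hR : 0 ≤ Real.exp (L * T) * (x₀ + y₀) := by positivity
  have hx : x ≤ Real.exp (L * T) * (x₀ + y₀) := le_of_sq_le_sq (by linarith [sq_nonneg y]) hR
  have hy : y ≤ Real.exp (L * T) * (x₀ + y₀) := le_of_sq_le_sq (by linarith [sq_nonneg x]) hR
  linarith

lemma mulOp_invJap_injective {x : H} (h : mulOp invJap x = 0) : x = 0 := by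
  refine Lp.ext ?_
  have h1 := mulOp_ae isMult_invJap x
  rw [h] at h1
  filter_upwards [h1, Lp.coeFn_zero ℂ 2 volume] with ξ e1 e2
  rw [e2, Pi.zero_apply, invJap] at e1
  rw [e2, Pi.zero_apply]
  exact (smul_eq_zero.1 e1.symm).resolve_left (inv_ne_zero (jap_pos ξ).ne')

lemma IsCurve.eq {s T : ℝ} {hs : 3 / 2 < s} {a b a' b' : ℝ → H} (h : IsCurve hs T a b)
    (h' : IsCurve hs T a' b') (ha : a 0 = a' 0) (hb : b 0 = b' 0) :
    ∀ t ∈ Icc 0 T, a t = a' t ∧ b t = b' t := by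
  intro t ht
  obtain ⟨M, hM⟩ := h.bddOn
  obtain ⟨M', hM'⟩ := h'.bddOn
  obtain ⟨R, _, hR⟩ := exists_curve_stability hs (max M M') T
  have h1 := hR a b a' b' h h' (fun t ht ↦ (hM t ht).1.trans (le_max_left _ _))
    (fun t ht ↦ ⟨(hM' t ht).1.trans (le_max_right _ _), (hM' t ht).2.trans (le_max_right _ _)⟩) t ht
  rw [ha, hb, sub_self, sub_self, map_zero, norm_zero, add_zero, mul_zero] at h1
  have h2 := norm_nonneg (mulOp invJap (a t - a' t))
  have h3 := norm_nonneg (mulOp invJap (b t - b' t))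
  exact ⟨sub_eq_zero.1 (mulOp_invJap_injective (norm_eq_zero.1 (by linarith))),
    sub_eq_zero.1 (mulOp_invJap_injective (norm_eq_zero.1 (by linarith)))⟩

/-! ### Interpolation -/

lemma mag_interpolate {s r : ℝ} (h1 : s - 1 ≤ r) (h2 : r < s) (f : ℝ → ℂ) (ξ : ℝ) :
    mag (fun ξ ↦ jap ξ ^ r) f ξ =
      mag (fun ξ ↦ jap ξ ^ (s - 1)) f ξ ^ (s - r) * mag (fun ξ ↦ jap ξ ^ s) f ξ ^ (1 - (s - r)) := by
  have hβ : 0 ≤ s - r := by linarith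
  have hβ' : 0 ≤ 1 - (s - r) := by linarith
  simp only [mag]
  rw [ENNReal.mul_rpow_of_nonneg _ _ hβ, ENNReal.mul_rpow_of_nonneg _ _ hβ',
    ENNReal.ofReal_rpow_of_pos (jap_rpow_pos _ _), ENNReal.ofReal_rpow_of_pos (jap_rpow_pos _ _),
    ← Real.rpow_mul (jap_pos ξ).le, ← Real.rpow_mul (jap_pos ξ).le, mul_mul_mul_comm,
    ← ENNReal.rpow_add_of_nonneg _ _ hβ hβ', ← ENNReal.ofReal_mul (jap_rpow_pos _ _).le,
    ← Real.rpow_add (jap_pos ξ), add_sub_cancel, ENNReal.rpow_one]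
  congr 3
  ring

/-- Since r = (s - r)(s - 1) + (1 - (s - r)) s, the weighted moduli interpolate pointwise, and
Hölder's inequality is applied to their squares with weights s - r and 1 - (s - r). -/
lemma sobolevNorm_interpolate {s r : ℝ} (h1 : s - 1 ≤ r) (h2 : r < s) (f : L2) :
    sobolevNorm r f ≤ sobolevNorm (s - 1) f ^ (s - r) * sobolevNorm s f ^ (1 - (s - r)) := by
  have e : ∀ (x : ℝ≥0∞) (p : ℝ), (x ^ p) ^ 2 = (x ^ 2) ^ p := fun x p ↦ by
    rw [← ENNReal.rpow_natCast, ← ENNReal.rpow_natCast, ← ENNReal.rpow_mul, ← ENNReal.rpow_mul,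
      mul_comm]
  have hm : ∀ σ : ℝ, Measurable (mag (fun ξ ↦ jap ξ ^ σ) (hat f)) := fun σ ↦
    measurable_mag (measurable_jap_rpow σ) (measurable_coe _)
  have hw : ∀ σ : ℝ, sobolevNorm σ f = eLpNorm (mag (fun ξ ↦ jap ξ ^ σ) (hat f)) 2 volume :=
    fun σ ↦ by rw [sobolevNorm_eq, wnorm_eq fun ξ ↦ (jap_rpow_pos _ _).le]
  refine (ENNReal.pow_le_pow_left_iff two_ne_zero).1 ?_
  rw [mul_pow, e, e, hw, hw, hw, eLpNorm_two_sq, eLpNorm_two_sq, eLpNorm_two_sq]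
  refine le_trans (le_of_eq ?_) (ENNReal.lintegral_mul_norm_pow_le
    ((hm (s - 1)).pow_const 2).aemeasurable ((hm s).pow_const 2).aemeasurable
    (show 0 ≤ s - r by linarith) (show 0 ≤ 1 - (s - r) by linarith) (by ring))
  congr 1; ext ξ
  rw [mag_interpolate h1 h2, mul_pow, e, e]

lemma sobolevNorm_mono {σ τ : ℝ} (h : σ ≤ τ) (f : L2) : sobolevNorm σ f ≤ sobolevNorm τ f := by
  rw [sobolevNorm_eq, sobolevNorm_eq]
  exact wnorm_mono (fun ξ ↦ (jap_rpow_pos _ _).le)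
    (fun ξ ↦ Real.rpow_le_rpow_of_exponent_le (one_le_jap ξ) h) _

lemma pairNorm_mono {σ τ : ℝ} (h : σ ≤ τ) (f g : L2) : pairNorm σ f g ≤ pairNorm τ f g :=
  add_le_add (sobolevNorm_mono h f) (sobolevNorm_mono (by linarith) g)

lemma pairNorm_interpolate {s r : ℝ} (h1 : s - 1 ≤ r) (h2 : r < s) (f g : L2) :
    pairNorm r f g ≤ 2 * (pairNorm (s - 1) f g ^ (s - r) * pairNorm s f g ^ (1 - (s - r))) := by
  have e1 := sobolevNorm_interpolate h1 h2 f
  have e2 := sobolevNorm_interpolate (s := s - 1) (r := r - 1) (by linarith) (by linarith) g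
  rw [show s - 1 - (r - 1) = s - r by ring] at e2
  have hβ : 0 ≤ s - r := by linarith
  have hβ' : 0 ≤ 1 - (s - r) := by linarith
  rw [two_mul]
  refine add_le_add (e1.trans ?_) (e2.trans ?_)
  · exact mul_le_mul' (ENNReal.rpow_le_rpow le_self_add hβ) (ENNReal.rpow_le_rpow le_self_add hβ')
  · exact mul_le_mul' (ENNReal.rpow_le_rpow le_add_self hβ) (ENNReal.rpow_le_rpow le_add_self hβ')

/-! ### The solution map -/

lemma norm_lev_le_of_mem_Q {s m : ℝ} (hm : 0 < m) {u₀ η₀ : L2} (h : (u₀, η₀) ∈ Q s m) :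
    sobolevNorm s u₀ < ∞ ∧ sobolevNorm (s - 1) η₀ < ∞ ∧
      ‖lev s u₀‖ + ‖lev (s - 1) η₀‖ ≤ m := by
  have h1 : pairNorm s u₀ η₀ ≤ ENNReal.ofReal m := h
  obtain ⟨h2, h3⟩ := pairNorm_lt_top (h1.trans_lt ENNReal.ofReal_lt_top)
  rw [pairNorm_eq (hat_ae h2) (hat_ae h3), ENNReal.ofReal_le_ofReal_iff hm.le] at h1
  exact ⟨h2, h3, h1⟩

theorem exists_isSolution {s : ℝ} (hs : 3 / 2 < s) :
    ∃ c : ℝ, 0 < c ∧ ∀ m T : ℝ, 0 < m → 0 ≤ T → T ≤ Real.log (1 + 1 / m) / (2 * c) →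
      ∀ u₀ η₀ : L2, (u₀, η₀) ∈ Q s m → ∃ u η : ℝ → L2, IsSolution s T u₀ η₀ u η ∧
        ∀ t ∈ Icc 0 T, ‖lev s (u t)‖ ≤ 2 * m + 1 ∧ ‖lev (s - 1) (η t)‖ ≤ 2 * m + 1 := by
  obtain ⟨c, hc0, hc⟩ := exists_isCurve hs
  refine ⟨c, hc0, fun m T hm hT hTm u₀ η₀ h0 ↦ ?_⟩
  obtain ⟨h1, h2, h3⟩ := norm_lev_le_of_mem_Q hm h0
  obtain ⟨a, b, hab, ha0, hb0, hbd⟩ := hc m T hm hT hTm _ _ (isHerm_lev h1) (isHerm_lev h2) h3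
  have hu : ∀ t, ∃ f : L2, t ∈ Icc 0 T → hat f =ᵐ[volume] low s (a t) := fun t ↦ by
    by_cases ht : t ∈ Icc 0 T
    · obtain ⟨f, hf⟩ := exists_hat_ae (σ := s) (by linarith) (hab.herm_a t ht)
      exact ⟨f, fun _ ↦ hf⟩
    · exact ⟨0, fun h ↦ absurd h ht⟩
  have hη : ∀ t, ∃ f : L2, t ∈ Icc 0 T → hat f =ᵐ[volume] low (s - 1) (b t) := fun t ↦ by
    by_cases ht : t ∈ Icc 0 T
    · obtain ⟨f, hf⟩ := exists_hat_ae (σ := s - 1) (by linarith) (hab.herm_b t ht)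
      exact ⟨f, fun _ ↦ hf⟩
    · exact ⟨0, fun h ↦ absurd h ht⟩
  choose u hu using hu
  choose η hη using hη
  have h0T : (0 : ℝ) ∈ Icc 0 T := ⟨le_rfl, hT⟩
  refine ⟨u, η, hab.isSolution hs hu hη ?_ ?_, fun t ht ↦ ?_⟩
  · refine eq_of_hat_ae (hu 0 h0T) ?_
    rw [ha0]; exact hat_ae h1
  · refine eq_of_hat_ae (hη 0 h0T) ?_
    rw [hb0]; exact hat_ae h2
  · rw [lev_eq (hu t ht), lev_eq (hη t ht)]
    exact hbd t ht

lemma IsSolution.eq {s T : ℝ} (hs : 3 / 2 < s) {u₀ η₀ : L2} {u η u' η' : ℝ → L2}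
    (h : IsSolution s T u₀ η₀ u η) (h' : IsSolution s T u₀ η₀ u' η') :
    ∀ t ∈ Icc 0 T, u' t = u t ∧ η' t = η t := by
  intro t ht
  obtain ⟨e1, e2⟩ := (h'.isCurve hs).eq (h.isCurve hs) (by rw [h.init_u, h'.init_u])
    (by rw [h.init_η, h'.init_η]) t ht
  refine ⟨eq_of_hat_ae (h'.hat_u ht) ?_, eq_of_hat_ae (h'.hat_η ht) ?_⟩
  · rw [e1]; exact h.hat_u ht
  · rw [e2]; exact h.hat_η ht

/-- Lipschitz dependence on the data, one derivative below the regularity of the solutions. -/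
lemma exists_pairNorm_sub_le {s : ℝ} (hs : 3 / 2 < s) (M T : ℝ) :
    ∃ R : ℝ≥0, ∀ (u₀ η₀ v₀ θ₀ : L2) (u η v θ : ℝ → L2), IsSolution s T u₀ η₀ u η →
      IsSolution s T v₀ θ₀ v θ →
      (∀ t ∈ Icc 0 T, ‖lev s (u t)‖ ≤ M ∧ ‖lev (s - 1) (η t)‖ ≤ M) →
      (∀ t ∈ Icc 0 T, ‖lev s (v t)‖ ≤ M ∧ ‖lev (s - 1) (θ t)‖ ≤ M) →
      ∀ t ∈ Icc 0 T, pairNorm (s - 1) (u t - v t) (η t - θ t) ≤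
        R * pairNorm (s - 1) (u₀ - v₀) (η₀ - θ₀) := by
  obtain ⟨R, hR0, hR⟩ := exists_curve_stability hs M T
  refine ⟨R.toNNReal, fun u₀ η₀ v₀ θ₀ u η v θ h h' hM hM' t ht ↦ ?_⟩
  have h0T : (0 : ℝ) ∈ Icc 0 T := ⟨le_rfl, ht.1.trans ht.2⟩
  have key : ∀ t ∈ Icc 0 T, pairNorm (s - 1) (u t - v t) (η t - θ t) =
      ENNReal.ofReal (‖mulOp invJap (lev s (u t) - lev s (v t))‖ +
        ‖mulOp invJap (lev (s - 1) (η t) - lev (s - 1) (θ t))‖) := fun t ht ↦ by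
    rw [pairNorm, sobolevNorm_sub_one_eq (hat_sub_ae (h.hat_u ht) (h'.hat_u ht)),
      sobolevNorm_sub_one_eq (hat_sub_ae (h.hat_η ht) (h'.hat_η ht)),
      ENNReal.ofReal_add (norm_nonneg _) (norm_nonneg _), ofReal_norm, ofReal_norm]
  have h1 := hR _ _ _ _ (h.isCurve hs) (h'.isCurve hs) (fun t ht ↦ (hM t ht).1) hM' t ht
  have h2 := key 0 h0T
  rw [h.init_u, h.init_η, h'.init_u, h'.init_η] at h2
  rw [h2, key t ht, show ((R.toNNReal : ℝ≥0) : ℝ≥0∞) = ENNReal.ofReal R from rfl,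
    ← ENNReal.ofReal_mul hR0]
  refine ENNReal.ofReal_le_ofReal (h1.trans_eq ?_)
  simp only [h.init_u, h.init_η, h'.init_u, h'.init_η]

lemma pairNorm_sub_le {s T M : ℝ} {u₀ η₀ v₀ θ₀ : L2} {u η v θ : ℝ → L2}
    (h : IsSolution s T u₀ η₀ u η) (h' : IsSolution s T v₀ θ₀ v θ)
    (hM : ∀ t ∈ Icc 0 T, ‖lev s (u t)‖ ≤ M ∧ ‖lev (s - 1) (η t)‖ ≤ M)
    (hM' : ∀ t ∈ Icc 0 T, ‖lev s (v t)‖ ≤ M ∧ ‖lev (s - 1) (θ t)‖ ≤ M) {t : ℝ}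
    (ht : t ∈ Icc 0 T) : pairNorm s (u t - v t) (η t - θ t) ≤ ENNReal.ofReal (4 * M) := by
  rw [pairNorm_eq (hat_sub_ae (h.hat_u ht) (h'.hat_u ht)) (hat_sub_ae (h.hat_η ht) (h'.hat_η ht))]
  refine ENNReal.ofReal_le_ofReal ?_
  obtain ⟨h1, h2⟩ := hM t ht
  obtain ⟨h3, h4⟩ := hM' t ht
  have h5 := norm_sub_le (lev s (u t)) (lev s (v t))
  have h6 := norm_sub_le (lev (s - 1) (η t)) (lev (s - 1) (θ t))
  linarith

/-- Hölder dependence on the data. -/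
theorem exists_holder {s : ℝ} (hs : 3 / 2 < s) (M T : ℝ) {r : ℝ} (h1 : s - 1 ≤ r) (h2 : r < s) :
    ∃ C : ℝ≥0, ∀ (u₀ η₀ v₀ θ₀ : L2) (u η v θ : ℝ → L2), IsSolution s T u₀ η₀ u η →
      IsSolution s T v₀ θ₀ v θ →
      (∀ t ∈ Icc 0 T, ‖lev s (u t)‖ ≤ M ∧ ‖lev (s - 1) (η t)‖ ≤ M) →
      (∀ t ∈ Icc 0 T, ‖lev s (v t)‖ ≤ M ∧ ‖lev (s - 1) (θ t)‖ ≤ M) →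
      ∀ t ∈ Icc 0 T, pairNorm r (u t - v t) (η t - θ t) ≤
        C * pairNorm r (u₀ - v₀) (η₀ - θ₀) ^ (s - r) := by
  obtain ⟨R, hR⟩ := exists_pairNorm_sub_le hs M T
  have hβ : 0 ≤ s - r := by linarith
  have hβ' : 0 ≤ 1 - (s - r) := by linarith
  -- The Lipschitz constant R one derivative lower enters with power s - r, the bound 4M for the
  -- difference at full regularity with power 1 - (s - r). The initial difference at order s - 1 is
  -- at most the one at order r.
  refine ⟨2 * (R ^ (s - r) * (4 * M).toNNReal ^ (1 - (s - r))),
    fun u₀ η₀ v₀ θ₀ u η v θ h h' hM hM' t ht ↦ ?_⟩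
  set d := pairNorm r (u₀ - v₀) (η₀ - θ₀)
  have e1 : pairNorm (s - 1) (u t - v t) (η t - θ t) ≤ R * d :=
    (hR u₀ η₀ v₀ θ₀ u η v θ h h' hM hM' t ht).trans (by gcongr; exact pairNorm_mono h1 _ _)
  have e2 := pairNorm_sub_le h h' hM hM' ht
  calc pairNorm r (u t - v t) (η t - θ t)
      ≤ 2 * (pairNorm (s - 1) (u t - v t) (η t - θ t) ^ (s - r) *
          pairNorm s (u t - v t) (η t - θ t) ^ (1 - (s - r))) := pairNorm_interpolate h1 h2 _ _
    _ ≤ 2 * ((R * d) ^ (s - r) * ENNReal.ofReal (4 * M) ^ (1 - (s - r))) := by gcongr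
    _ = _ := by
      rw [ENNReal.mul_rpow_of_nonneg _ _ hβ, ENNReal.coe_mul, ENNReal.coe_mul,
        ENNReal.coe_rpow_of_nonneg _ hβ, ENNReal.coe_rpow_of_nonneg _ hβ', ENNReal.ofReal,
        ENNReal.coe_ofNat]
      ring

end

end FornbergWhitham

theorem theorem3p4 (s : ℝ) (hs : 3 / 2 < s) :
    ∃ c : ℝ, 0 < c ∧ ∀ m T : ℝ, 0 < m → 0 < T → T ≤ Real.log (1 + 1 / m) / (2 * c) →
      -- the solution map is defined on `Q_m`, with values in `C([0, T]; H^s × H^{s-1})`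
      (∀ u₀ η₀ : FornbergWhitham.L2, (u₀, η₀) ∈ FornbergWhitham.Q s m →
        ∃ u η : ℝ → FornbergWhitham.L2,
          FornbergWhitham.IsSolution s T u₀ η₀ u η ∧
          ∀ u' η' : ℝ → FornbergWhitham.L2, FornbergWhitham.IsSolution s T u₀ η₀ u' η' →
            ∀ t ∈ Set.Icc 0 T, u' t = u t ∧ η' t = η t) ∧
      -- it is Hölder continuous with exponent `s - r` from `H^r × H^{r-1}` to
      -- `C([0, T]; H^r × H^{r-1})`
      (∀ r : ℝ, s - 1 ≤ r → r < s →
        ∃ C : ℝ≥0, ∀ u₀ η₀ v₀ θ₀ : FornbergWhitham.L2,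
          (u₀, η₀) ∈ FornbergWhitham.Q s m → (v₀, θ₀) ∈ FornbergWhitham.Q s m →
          ∀ u η v θ : ℝ → FornbergWhitham.L2,
            FornbergWhitham.IsSolution s T u₀ η₀ u η →
            FornbergWhitham.IsSolution s T v₀ θ₀ v θ →
            (⨆ t ∈ Set.Icc 0 T, FornbergWhitham.pairNorm r (u t - v t) (η t - θ t)) ≤
              (C : ℝ≥0∞) * FornbergWhitham.pairNorm r (u₀ - v₀) (η₀ - θ₀) ^ (s - r)) := by
  obtain ⟨c, hc0, hc⟩ := FornbergWhitham.exists_isSolution hs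
  refine ⟨c, hc0, fun m T hm hT hTm ↦ ⟨fun u₀ η₀ h0 ↦ ?_, fun r hr1 hr2 ↦ ?_⟩⟩
  · obtain ⟨u, η, h, _⟩ := hc m T hm hT.le hTm u₀ η₀ h0
    exact ⟨u, η, h, fun u' η' h' ↦ h.eq hs h'⟩
  · obtain ⟨C, hC⟩ := FornbergWhitham.exists_holder hs (2 * m + 1) T hr1 hr2
    -- The bound 2m + 1 is known for the constructed solution; uniqueness transfers it to every
    -- solution with data in Q_m, so the Hölder constant depends on no particular solution.
    have hbd : ∀ (w₀ ζ₀ : FornbergWhitham.L2) (w ζ : ℝ → FornbergWhitham.L2),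
        (w₀, ζ₀) ∈ FornbergWhitham.Q s m → FornbergWhitham.IsSolution s T w₀ ζ₀ w ζ →
        ∀ t ∈ Set.Icc 0 T, ‖FornbergWhitham.lev s (w t)‖ ≤ 2 * m + 1 ∧
          ‖FornbergWhitham.lev (s - 1) (ζ t)‖ ≤ 2 * m + 1 := fun w₀ ζ₀ w ζ hQ hw t ht ↦ by
      obtain ⟨w', ζ', hw', hb⟩ := hc m T hm hT.le hTm w₀ ζ₀ hQ
      obtain ⟨e1, e2⟩ := hw'.eq hs hw t ht
      rw [e1, e2]
      exact hb t ht
    refine ⟨C, fun u₀ η₀ v₀ θ₀ hu hv u η v θ h h' ↦ iSup₂_le fun t ht ↦ ?_⟩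
    exact hC u₀ η₀ v₀ θ₀ u η v θ h h' (hbd _ _ _ _ hu h) (hbd _ _ _ _ hv h') t ht
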